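/- **Setting.** Let $m\ge1$, $n\ge2$, $1\le k\le d$. Given are points $x^l_i,y_j\in\mathbb R^d$ ($l\in[m]$, $i,j\in[n]$), probability vectors $p^l\in\mathbb R^n$ with positive entries and weights $\omega^l>0$ with $\sum_l\omega^l=1$. Put $\bar c=\max_{l,i,j}\|x^l_i-y_j\|^2$, $\underline\omega=\min_l\omega^l$, $\mathcal M=\mathrm{St}(d,k)=\{U\in\mathbb R^{d\times k}:U^\top U=I_k\}$, $f(\boldsymbol\pi,U)=\sum_l\omega^l\sum_{i,j}\pi^l_{ij}\|U^\top(x^l_i-y_j)\|^2$, and let $\Pi(\boldsymbol p)$ be the set of all $\boldsymbol\pi=(\pi^l)_l$ with $\pi^l\in\mathbb R^{n\times n}_+$, $\pi^l\mathbf 1=p^l$ and $(\pi^l)^\top\mathbf 1$ independent of $l$. A pair $(\hat{\boldsymbol\pi},\hat U)\in\Pi(\boldsymbol p)\times\mathcal M$ is an $\epsilon$-stationary point of $\max_{U\in\mathcal M}\min_{\boldsymbol\pi\in\Pi(\boldsymbol p)}f(\boldsymbol\pi,U)$ if $\|\mathrm{grad}_Uf(\hat{\boldsymbol\pi},\hat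 U)\|_F\le\epsilon$ and $f(\hat{\boldsymbol\pi},\hat U)-\min_{\boldsymbol\pi\in\Pi(\boldsymbol p)}f(\boldsymbol\pi,\hat U)\le\epsilon$, where $\mathrm{grad}_U$ is the Riemannian gradient on $\mathcal M$ (Euclidean gradient projected orthogonally onto the tangent space). Let $\mathrm{Retr}$ be a retraction on $\mathcal M$ with constants $L_1,L_2>0$: $\|\mathrm{Retr}_U(\xi)-U\|_F\le L_1\|\xi\|_F$ and $\|\mathrm{Retr}_U(\xi)-(U+\xi)\|_F\le L_2\|\xi\|_F^2$ for all $U\in\mathcal M$, $\xi\in T_U\mathcal M$; it is computed by a subroutine with $O(dk^2+k^3)$ arithmetic operations. (Such retractions exist for all $1\le k\le d$, with one implied constant for all of them; this is part of the statement.) **RBCD.** For $\epsilon>0$ put $\eta=\frac{\epsilon}{4\log n+2}$, $\rho=\frac{2\bar c}\eta+\frac{4\bar c^2}{\eta^2}$, $\tau=\frac1{4L_2\bar c/\eta+\rho L_1^2}$, $\zeta(u^l,v^l,U)_{ij}=\exp\bigl(-\|U^\top(x^l_i-y_j)\|^2/\eta+u^l_i+v^l_j\bigr)$, $\pi(u^l,v^l,U)=\zeta(u^l,v^l,U)/\|\zeta(u^l,v^l,U)\|_1$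 and $g(\boldsymbol u,\boldsymbol v,U)=\sum_l\omega^l\{\log\|\zeta(u^l,v^l,U)\|_1-\langle u^l,p^l\rangle\}$. Start from $U_0\in\mathcal M$, any $\boldsymbol u_0$, and $\boldsymbol v_0$ with $\sum_l\omega^lv^l_0=0$ and $\max_jv^l_{0,j}-\min_jv^l_{0,j}\le2\bar c/\eta$ for all $l$ (for example $\boldsymbol v_0=0$). Iteration $t=0,1,2,\dots$ computes (logarithms, exponentials and quotients of vectors entrywise) $$u^l_{t+1}=u^l_t+\log\frac{p^l}{\zeta(u^l_t,v^l_t,U_t)\mathbf 1},\quad q^l_t=\zeta(u^l_{t+1},v^l_t,U_t)^\top\mathbf 1,\quad q_{t+1}=\exp\Bigl(\sum_l\omega^l\log q^l_t\Bigr),\quad v^l_{t+1}=v^l_t+\log\frac{q_{t+1}}{q^l_t},$$ $$U_{t+1}=\mathrm{Retr}_{U_t}\bigl(-\tau\,\mathrm{grad}_Ug(\boldsymbol u_{t+1},\boldsymbol v_{t+1},U_t)\bigr),$$ and stops if, with $\bar q_t=\sum_l\omega^lq^l_t$, both $\sum_l\omega^l\|q^l_t-\bar q_t\|_1\le\underline\omega^{3/2}\epsilon/(12\bar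 c)$ and $\eta\|\mathrm{grad}_Ug(\boldsymbol u_{t+1},\boldsymbol v_{t+1},U_t)\|_F\le\epsilon/3$. The output is $q=\bar q_t$, $\hat U=U_t$, $\hat\pi^l=\mathrm{Round}(\pi(u^l_{t+1},v^l_t,U_t),p^l,q)$. Here $\mathrm{Round}(\pi,p,q)$ is computed as follows: multiply row $i$ of $\pi$ by $\min(p_i/[\pi\mathbf 1]_i,1)$ to get $\pi'$; multiply column $j$ of $\pi'$ by $\min(q_j/[(\pi')^\top\mathbf 1]_j,1)$ to get $\pi''$; return $\pi''+e_pe_q^\top/\|e_p\|_1$ with $e_p=p-\pi''\mathbf 1$ and $e_q=q-(\pi'')^\top\mathbf 1$ (return $\pi''$ if $e_p=0$). **Cost.** Each operation $+,-,\times,/,\exp,\log,\sqrt{\cdot}$, comparison, copy or loading of an integer constant on real registers costs one. An implementation consists of three lists of such instructions, depending only on $(m,n,d,k)$ and the retraction subroutine: an initialization, a loop body (one iteration and the stopping test; repeated until a flag register is nonzero), and a final block computing the output. **Theorem.** RBCD has an implementation for which the following hold. 1. Each iteration costs $O(mn^2d)$ operations if $k\le n$, and $O(mn^2dk+dk^2)$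 operations for every $k\le d$. 2. RBCD stops after $O\bigl(\log(n)L_1^2\bar c^5\underline\omega^{-3}\epsilon^{-3}\bigr)$ iterations and returns an $\epsilon$-stationary point; if $k\le mn^2$, the total number of arithmetic operations, including initialization and output, is $$O\bigl(mn^2\log(n)\,d\,L_1^2\,\bar c^5\,k\,\underline\omega^{-3}\epsilon^{-3}\bigr).$$ The implied constants are uniform in the following sense: for every $K$ there is a constant $C$, depending only on $K$, that serves in 1 for all $m,n,d,k$ and all retraction subroutines with at most $K(dk^2+k^3)$ operations, and in 2 for all such data that moreover satisfy $\epsilon\le K$, $\bar c\ge1/K$, $L_1\ge1/K$ and $L_2\epsilon\le KL_1^2\bar c$. -/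

import Mathlib

noncomputable section

namespace RPRWB

open Matrix

/-! ### Stiefel manifold, tangent spaces, Riemannian gradients, retractions -/

/-- The Frobenius norm. -/
def frobNorm {d k : ℕ} (A : Matrix (Fin d) (Fin k) ℝ) : ℝ :=
  Real.sqrt (∑ a, ∑ b, A a b ^ 2)

/-- `U ∈ St(d,k)`. -/
def Stiefel {d k : ℕ} (U : Matrix (Fin d) (Fin k) ℝ) : Prop := Uᵀ * U = 1

/-- `ξ` is a tangent vector of `St(d,k)` at `U`. -/
def Tangent {d k : ℕ} (U ξ : Matrix (Fin d) (Fin k) ℝ) : Prop := ξᵀ * U + Uᵀ * ξ = 0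

/-- The projection onto the tangent space of `St(d,k)` at `U`, orthogonal with respect to the
Frobenius inner product (see the two lemmas below). -/
def tangentProj {d k : ℕ} (U Z : Matrix (Fin d) (Fin k) ℝ) : Matrix (Fin d) (Fin k) ℝ :=
  Z - (1 / 2 : ℝ) • (U * (Uᵀ * Z + Zᵀ * U))

theorem tangent_tangentProj {d k : ℕ} {U : Matrix (Fin d) (Fin k) ℝ} (hU : Stiefel U)
    (Z : Matrix (Fin d) (Fin k) ℝ) : Tangent U (tangentProj U Z) := by
  unfold Stiefel at hU
  unfold Tangent tangentProj
  simp only [transpose_sub, transpose_smul, transpose_mul, transpose_add, transpose_transpose,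
    Matrix.sub_mul, Matrix.mul_sub, Matrix.smul_mul, Matrix.mul_smul]
  rw [Matrix.mul_assoc _ Uᵀ U, ← Matrix.mul_assoc Uᵀ U, hU, Matrix.mul_one, Matrix.one_mul]
  ext i j
  simp only [Matrix.add_apply, Matrix.sub_apply, Matrix.smul_apply, smul_eq_mul,
    Matrix.zero_apply]
  ring

theorem trace_sub_tangentProj {d k : ℕ} {U ξ : Matrix (Fin d) (Fin k) ℝ} (hξ : Tangent U ξ)
    (Z : Matrix (Fin d) (Fin k) ℝ) : ((Z - tangentProj U Z)ᵀ * ξ).trace = 0 := by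
  unfold Tangent at hξ
  have h1 : Z - tangentProj U Z = (1 / 2 : ℝ) • (U * (Uᵀ * Z + Zᵀ * U)) := by
    unfold tangentProj; abel
  have hS : (Uᵀ * Z + Zᵀ * U)ᵀ = Uᵀ * Z + Zᵀ * U := by
    simp only [transpose_mul, transpose_add, transpose_transpose]; abel
  rw [h1, transpose_smul, transpose_mul, hS]
  generalize Uᵀ * Z + Zᵀ * U = S at hS
  rw [Matrix.smul_mul, trace_smul, Matrix.mul_assoc]
  have h2 : (S * (ξᵀ * U)).trace = (S * (Uᵀ * ξ)).trace := by
    rw [← trace_transpose]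
    simp only [transpose_mul, transpose_transpose, hS]
    rw [trace_mul_comm]
  have h3 : (S * (ξᵀ * U)).trace + (S * (Uᵀ * ξ)).trace = 0 := by
    rw [← trace_add, ← Matrix.mul_add, hξ, Matrix.mul_zero, trace_zero]
  have : (S * (Uᵀ * ξ)).trace = 0 := by linarith
  rw [this, smul_zero]

/-- The Euclidean gradient: the matrix of partial derivatives. -/
def eucGrad {d k : ℕ} (F : Matrix (Fin d) (Fin k) ℝ → ℝ) (U : Matrix (Fin d) (Fin k) ℝ) :
    Matrix (Fin d) (Fin k) ℝ :=
  Matrix.of fun a b => deriv (fun s : ℝ => F (U + s • Matrix.single a b (1 : ℝ))) 0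

/-- The Riemannian gradient on the Stiefel manifold (with the embedded metric). -/
def riemGrad {d k : ℕ} (F : Matrix (Fin d) (Fin k) ℝ → ℝ) (U : Matrix (Fin d) (Fin k) ℝ) :
    Matrix (Fin d) (Fin k) ℝ :=
  tangentProj U (eucGrad F U)

/-- `Retr U ξ` is a retraction on `St(d,k)` with constants `L₁, L₂`. The two bounds imply
`Retr U 0 = U` and `‖Retr U ξ - (U + ξ)‖ = o(‖ξ‖)`; smoothness is not required. -/
structure IsRetraction {d k : ℕ}
    (Retr : Matrix (Fin d) (Fin k) ℝ → Matrix (Fin d) (Fin k) ℝ → Matrix (Fin d) (Fin k) ℝ)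
    (L₁ L₂ : ℝ) : Prop where
  L₁_pos : 0 < L₁
  L₂_pos : 0 < L₂
  mem : ∀ U ξ, Stiefel U → Tangent U ξ → Stiefel (Retr U ξ)
  bound₁ : ∀ U ξ, Stiefel U → Tangent U ξ → frobNorm (Retr U ξ - U) ≤ L₁ * frobNorm ξ
  bound₂ : ∀ U ξ, Stiefel U → Tangent U ξ →
    frobNorm (Retr U ξ - (U + ξ)) ≤ L₂ * frobNorm ξ ^ 2

/-! ### The fixed-support problem -/

/-- `m` discrete measures `μ^l = ∑ i, p l i • δ_{X l i}` on `ℝ^d`, weights `w`, and the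
support points `Y j` of the barycenter. -/
structure Problem (m n d : ℕ) where
  X : Fin m → Fin n → Fin d → ℝ
  Y : Fin n → Fin d → ℝ
  p : Fin m → Fin n → ℝ
  w : Fin m → ℝ

variable {m n d k : ℕ}

/-- Every `p l` is a probability vector with positive entries (the `X l i` are the support of
`μ^l`), and so is `w`. -/
structure Problem.Valid (D : Problem m n d) : Prop where
  p_pos : ∀ l i, 0 < D.p l i
  p_sum : ∀ l, ∑ i, D.p l i = 1
  w_pos : ∀ l, 0 < D.w l
  w_sum : ∑ l, D.w l = 1

/-- `C^l_{ij} = ‖x^l_i - y_j‖²`. -/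
def Problem.cost (D : Problem m n d) (l : Fin m) (i j : Fin n) : ℝ :=
  ∑ a, (D.X l i a - D.Y j a) ^ 2

/-- `c̄ = max_l ‖C^l‖_∞`. -/
def Problem.cbar (D : Problem m n d) : ℝ := ⨆ l, ⨆ i, ⨆ j, |D.cost l i j|

/-- The smallest weight. -/
def Problem.wmin (D : Problem m n d) : ℝ := ⨅ l, D.w l

/-- `‖Uᵀ (x^l_i - y_j)‖²`. -/
def Problem.projCost (D : Problem m n d) (U : Matrix (Fin d) (Fin k) ℝ)
    (l : Fin m) (i j : Fin n) : ℝ :=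
  ∑ b, ((Uᵀ *ᵥ (D.X l i - D.Y j)) b) ^ 2

/-- `f(π, U)`. -/
def Problem.f (D : Problem m n d) (π : Fin m → Fin n → Fin n → ℝ)
    (U : Matrix (Fin d) (Fin k) ℝ) : ℝ :=
  ∑ l, D.w l * ∑ i, ∑ j, π l i j * D.projCost U l i j

/-- The feasible set `Π(p)`: plans with prescribed first marginals and a common second one. -/
def Problem.Feasible (D : Problem m n d) (π : Fin m → Fin n → Fin n → ℝ) : Prop :=
  (∀ l i j, 0 ≤ π l i j) ∧ (∀ l i, ∑ j, π l i j = D.p l i) ∧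
    ∀ l l' j, ∑ i, π l i j = ∑ i, π l' i j

/-- `(π, U)` is an `ε`-stationary point of `max_{U ∈ St(d,k)} min_{π ∈ Π(p)} f(π, U)`. -/
structure Problem.EpsStationary (D : Problem m n d) (ε : ℝ)
    (π : Fin m → Fin n → Fin n → ℝ) (U : Matrix (Fin d) (Fin k) ℝ) : Prop where
  feasible : D.Feasible π
  stiefel : Stiefel U
  grad : frobNorm (riemGrad (fun V => D.f π V) U) ≤ ε
  gap : ∀ π', D.Feasible π' → D.f π U - D.f π' U ≤ ε

/-! ### The RBCD algorithm -/

/-- `η = ε / (4 log n + 2)`. -/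
def etaPar (n : ℕ) (ε : ℝ) : ℝ := ε / (4 * Real.log n + 2)

/-- `ρ = 2 c̄ / η + 4 c̄² / η²`. -/
def Problem.rho (D : Problem m n d) (ε : ℝ) : ℝ :=
  2 * D.cbar / etaPar n ε + 4 * D.cbar ^ 2 / etaPar n ε ^ 2

/-- `τ = 1 / (4 L₂ c̄ / η + ρ L₁²)`. -/
def Problem.tau (D : Problem m n d) (ε L₁ L₂ : ℝ) : ℝ :=
  1 / (4 * L₂ * D.cbar / etaPar n ε + D.rho ε * L₁ ^ 2)

/-- `ζ(u^l, v^l, U)_{ij}`. -/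
def Problem.zeta (D : Problem m n d) (η : ℝ) (u v : Fin m → Fin n → ℝ)
    (U : Matrix (Fin d) (Fin k) ℝ) (l : Fin m) (i j : Fin n) : ℝ :=
  Real.exp (-(D.projCost U l i j) / η + u l i + v l j)

/-- `π(u^l, v^l, U)_{ij} = ζ_{ij} / ‖ζ‖₁`. -/
def Problem.plan (D : Problem m n d) (η : ℝ) (u v : Fin m → Fin n → ℝ)
    (U : Matrix (Fin d) (Fin k) ℝ) (l : Fin m) (i j : Fin n) : ℝ :=
  D.zeta η u v U l i j / ∑ i', ∑ j', D.zeta η u v U l i' j'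

/-- The dual objective `g(u, v, U)`. -/
def Problem.g (D : Problem m n d) (η : ℝ) (u v : Fin m → Fin n → ℝ)
    (U : Matrix (Fin d) (Fin k) ℝ) : ℝ :=
  ∑ l, D.w l * (Real.log (∑ i, ∑ j, D.zeta η u v U l i j) - ∑ i, u l i * D.p l i)

/-- An iterate `(u_t, v_t, U_t)`. -/
structure Iterate (m n d k : ℕ) where
  u : Fin m → Fin n → ℝ
  v : Fin m → Fin n → ℝ
  U : Matrix (Fin d) (Fin k) ℝ

/-- `u_{t+1}`. -/
def Problem.uNext (D : Problem m n d) (η : ℝ) (s : Iterate m n d k) : Fin m → Fin n → ℝ :=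
  fun l i => s.u l i + Real.log (D.p l i / ∑ j, D.zeta η s.u s.v s.U l i j)

/-- `q^l_t`, the column sums of `ζ(u^l_{t+1}, v^l_t, U_t)`. -/
def Problem.qCol (D : Problem m n d) (η : ℝ) (s : Iterate m n d k) : Fin m → Fin n → ℝ :=
  fun l j => ∑ i, D.zeta η (D.uNext η s) s.v s.U l i j

/-- `q_{t+1} = exp (∑ l, w l * log q^l_t)`. -/
def Problem.qGeo (D : Problem m n d) (η : ℝ) (s : Iterate m n d k) : Fin n → ℝ :=
  fun j => Real.exp (∑ l, D.w l * Real.log (D.qCol η s l j))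

/-- `q̄_t = ∑ l, w l * q^l_t`. -/
def Problem.qBar (D : Problem m n d) (η : ℝ) (s : Iterate m n d k) : Fin n → ℝ :=
  fun j => ∑ l, D.w l * D.qCol η s l j

/-- `v_{t+1}`. -/
def Problem.vNext (D : Problem m n d) (η : ℝ) (s : Iterate m n d k) : Fin m → Fin n → ℝ :=
  fun l j => s.v l j + Real.log (D.qGeo η s j / D.qCol η s l j)

/-- `grad_U g(u_{t+1}, v_{t+1}, U_t)`. -/
def Problem.gradStep (D : Problem m n d) (η : ℝ) (s : Iterate m n d k) :
    Matrix (Fin d) (Fin k) ℝ :=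
  riemGrad (fun V => D.g η (D.uNext η s) (D.vNext η s) V) s.U

/-- One RBCD iteration. -/
def Problem.step (D : Problem m n d)
    (Retr : Matrix (Fin d) (Fin k) ℝ → Matrix (Fin d) (Fin k) ℝ → Matrix (Fin d) (Fin k) ℝ)
    (ε L₁ L₂ : ℝ) (s : Iterate m n d k) : Iterate m n d k where
  u := D.uNext (etaPar n ε) s
  v := D.vNext (etaPar n ε) s
  U := Retr s.U (-(D.tau ε L₁ L₂) • D.gradStep (etaPar n ε) s)

/-- The RBCD iterates. -/
def Problem.iter (D : Problem m n d)
    (Retr : Matrix (Fin d) (Fin k) ℝ → Matrix (Fin d) (Fin k) ℝ → Matrix (Fin d) (Fin k) ℝ)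
    (ε L₁ L₂ : ℝ) (s₀ : Iterate m n d k) : ℕ → Iterate m n d k
  | 0 => s₀
  | t + 1 => D.step Retr ε L₁ L₂ (D.iter Retr ε L₁ L₂ s₀ t)

/-- The stopping test of the iteration that starts from the iterate `s`. -/
def Problem.Stop (D : Problem m n d) (ε : ℝ) (s : Iterate m n d k) : Prop :=
  (∑ l, D.w l * ∑ j, |D.qCol (etaPar n ε) s l j - D.qBar (etaPar n ε) s j| ≤
      D.wmin ^ (3 / 2 : ℝ) * ε / (12 * D.cbar)) ∧
    etaPar n ε * frobNorm (D.gradStep (etaPar n ε) s) ≤ ε / 3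

/-- The rounding procedure `Round(π, p, q)`. -/
def roundPlan (π : Fin n → Fin n → ℝ) (p q : Fin n → ℝ) : Fin n → Fin n → ℝ :=
  let π₁ : Fin n → Fin n → ℝ := fun i j => min (p i / ∑ j', π i j') 1 * π i j
  let π₂ : Fin n → Fin n → ℝ := fun i j => π₁ i j * min (q j / ∑ i', π₁ i' j) 1
  let errp : Fin n → ℝ := fun i => p i - ∑ j, π₂ i j
  let errq : Fin n → ℝ := fun j => q j - ∑ i, π₂ i j
  fun i j => π₂ i j + errp i * errq j / ∑ i', |errp i'|

/-- The output plans `π̂^l` when the algorithm stops in the iteration that starts from `s`;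
the other outputs are `q = q̄_t` and `Û = s.U`. -/
def Problem.planOut (D : Problem m n d) (ε : ℝ) (s : Iterate m n d k) :
    Fin m → Fin n → Fin n → ℝ :=
  fun l => roundPlan
    (D.plan (etaPar n ε) (D.uNext (etaPar n ε) s) s.v s.U l) (D.p l) (D.qBar (etaPar n ε) s)

/-! ### Arithmetic operations: a register machine over the reals

A register holds a real number, an instruction performs one arithmetic operation on fixed
registers, and every instruction costs one. -/

/-- An elementary operation on registers named by `R`. -/
inductive Op (R : Type) : Type
  | const (z : ℤ)
  | copy (a : R)
  | add (a b : R)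
  | sub (a b : R)
  | mul (a b : R)
  | div (a b : R)
  | exp (a : R)
  | log (a : R)
  | sqrt (a : R)
  | le (a b : R)

open Classical in
/-- The value of an operation; a comparison returns `1` or `0`. -/
def Op.eval {R : Type} (M : R → ℝ) : Op R → ℝ
  | .const z => z
  | .copy a => M a
  | .add a b => M a + M b
  | .sub a b => M a - M b
  | .mul a b => M a * M b
  | .div a b => M a / M b
  | .exp a => Real.exp (M a)
  | .log a => Real.log (M a)
  | .sqrt a => Real.sqrt (M a)
  | .le a b => if M a ≤ M b then 1 else 0

/-- The instruction `dst := op`. -/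
structure Instr (R : Type) : Type where
  dst : R
  op : Op R

open Classical in
/-- The effect of one instruction on the memory. -/
def Instr.exec {R : Type} (M : R → ℝ) (c : Instr R) : R → ℝ :=
  fun r => if r = c.dst then c.op.eval M else M r

/-- The effect of a straight-line block; its number of operations is its length. -/
def runBlock {R : Type} (B : List (Instr R)) (M : R → ℝ) : R → ℝ := B.foldl Instr.exec M

/-- The program `init; repeat body until flag ≠ 0; final`. -/
structure LoopProgram (R : Type) : Type where
  init : List (Instr R)
  body : List (Instr R)
  final : List (Instr R)

/-- The memory after `init` and `t` executions of `body`. -/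
def LoopProgram.memAt {R : Type} (P : LoopProgram R) (M : R → ℝ) : ℕ → R → ℝ
  | 0 => runBlock P.init M
  | t + 1 => runBlock P.body (P.memAt M t)

/-- On the initial memory `M` the loop is left after exactly `N` executions of `body`. -/
def LoopProgram.LoopEndsAt {R : Type} (P : LoopProgram R) (flag : R) (M : R → ℝ) (N : ℕ) :
    Prop :=
  1 ≤ N ∧ P.memAt M N flag ≠ 0 ∧ ∀ t, 1 ≤ t → t < N → P.memAt M t flag = 0

/-- The operations of one iteration: the body and the test of the flag. -/
def LoopProgram.iterOps {R : Type} (P : LoopProgram R) : ℕ := P.body.length + 1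

/-- All operations of an execution with `N` iterations. -/
def LoopProgram.totalOps {R : Type} (P : LoopProgram R) (N : ℕ) : ℕ :=
  P.init.length + N * P.iterOps + P.final.length

/-- Registers of a retraction subroutine. -/
inductive RetrReg (d k : ℕ) : Type
  | U (a : Fin d) (b : Fin k)
  | xi (a : Fin d) (b : Fin k)
  | out (a : Fin d) (b : Fin k)
  | tmp (name i j l : ℕ)

/-- The block `Q` computes the retraction `Retr`, whatever the other registers contain. -/
def ComputesRetr (Q : List (Instr (RetrReg d k)))
    (Retr : Matrix (Fin d) (Fin k) ℝ → Matrix (Fin d) (Fin k) ℝ → Matrix (Fin d) (Fin k) ℝ) :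
    Prop :=
  ∀ (U ξ : Matrix (Fin d) (Fin k) ℝ) (M : RetrReg d k → ℝ), Stiefel U → Tangent U ξ →
    (∀ a b, M (.U a b) = U a b) → (∀ a b, M (.xi a b) = ξ a b) →
    ∀ a b, runBlock Q M (.out a b) = Retr U ξ a b

/-- Registers of an RBCD program: input data, current iterate, outputs, flag, scratch. -/
inductive Reg (m n d k : ℕ) : Type
  | X (l : Fin m) (i : Fin n) (a : Fin d)
  | Y (j : Fin n) (a : Fin d)
  | p (l : Fin m) (i : Fin n)
  | w (l : Fin m)
  | eps
  | L₁
  | L₂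
  | u (l : Fin m) (i : Fin n)
  | v (l : Fin m) (j : Fin n)
  | U (a : Fin d) (b : Fin k)
  | qOut (j : Fin n)
  | UOut (a : Fin d) (b : Fin k)
  | planOut (l : Fin m) (i j : Fin n)
  | flag
  | tmp (name i j l : ℕ)

/-- The initial memory: the input in its registers, and `0` elsewhere. -/
def inputMem (D : Problem m n d) (ε L₁ L₂ : ℝ) (s₀ : Iterate m n d k) : Reg m n d k → ℝ
  | .X l i a => D.X l i a
  | .Y j a => D.Y j a
  | .p l i => D.p l i
  | .w l => D.w l
  | .eps => ε
  | .L₁ => L₁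
  | .L₂ => L₂
  | .u l i => s₀.u l i
  | .v l j => s₀.v l j
  | .U a b => s₀.U a b
  | _ => 0

/-- The memory holds the iterate `s`. -/
def HoldsIterate (M : Reg m n d k → ℝ) (s : Iterate m n d k) : Prop :=
  (∀ l i, M (.u l i) = s.u l i) ∧ (∀ l j, M (.v l j) = s.v l j) ∧ ∀ a b, M (.U a b) = s.U a b

/-- The output registers hold `q`, `Û` and `π̂`. -/
def HoldsOutput (M : Reg m n d k → ℝ) (q : Fin n → ℝ) (U : Matrix (Fin d) (Fin k) ℝ)
    (π : Fin m → Fin n → Fin n → ℝ) : Prop :=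
  (∀ j, M (.qOut j) = q j) ∧ (∀ a b, M (.UOut a b) = U a b) ∧
    ∀ l i j, M (.planOut l i j) = π l i j

end RPRWB

end

namespace RPRWB

open Matrix InnerProductSpace

/-! ### Compiling expressions to straight-line code -/

/-! RBCD is block descent on the dual objective `g`; the iteration bound is the length of the
interval in which a potential lives, divided by the least decrease per iteration. The potential is
g(u_{t+1}, v_t, U_t), the value right after a u-update.

Decrease. The u-update minimizes `g` in u by Gibbs' inequality (`g_uNext_le`) and makes every ζ^l a
probability matrix with row sums p^l. The v-update changes `g` by exactly log Q, where Q is the mass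
of the geometric mean of the column sums. Since -log Q is a weighted sum of relative entropies, a
weak Pinsker inequality bounds log Q by minus a sixteenth of the squared distance `colGap` of the
column sums from their mean (`log_sum_qGeo_le`). For the retraction step, Hoeffding's lemma gives a
quadratic upper bound for `g` in U (`g_le_add`), whence a decrease of τ/2 times the squared gradient
norm (`g_retr_le`). While the stopping test fails, one of the two decreases is at least a multiple
of ω³ε²/(c̄⁴L₁²), with ω the smallest weight (`le_decrease_of_not_stop`).

Range. The weighted sum of the v^l stays zero, and each v^l oscillates by at most 2c̄/η
(`range_vNext`). After a u-update `g` has a closed form in v and U alone, which confines the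
potential to an interval of length log n + 3c̄/η = O(c̄ log n / ε) (`g_uNext_upper`,
`g_uNext_lower`).

Stationarity. Once the test holds, rounding moves the plans by at most `colGap` (`roundPlan_spec`).
The duality gap of the unrounded plans is at most 2c̄ `colGap` plus the entropy error 2η log n
(`f_zeta_sub_le`). The gradient of f at the output differs from -η grad g only through the distance
to the plans after the v-update; controlling the mass lost there costs a factor 1/ω
(`one_sub_sum_qGeo_le`).

Cost. Points are projected before they are paired, and the gradient is summed over one index at a
time, so mn²dk never occurs as a product: an iteration takes O(mndk + mn²k + mn²d + dk²) operations
besides the retraction. The program writes its arrays in order of increasing tags, each array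
reading only lower tags, so its assignments remain true as equations of the final memory
(`Computes`).

Retractions. Tangency makes the Gram matrix of U + ξ equal to I + ξᵀξ, so Gram–Schmidt changes its
columns only to second order in ξ (`norm_gramSchmidtNormed_sub_le`). -/

theorem runBlock_append {R : Type} (A B : List (Instr R)) (M : R → ℝ) :
    runBlock (A ++ B) M = runBlock B (runBlock A M) := List.foldl_append

theorem runBlock_nil {R : Type} (M : R → ℝ) : runBlock [] M = M := rfl

theorem runBlock_cons {R : Type} (c : Instr R) (B : List (Instr R)) (M : R → ℝ) :
    runBlock (c :: B) M = runBlock B (c.exec M) := rfl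

/-- Unary operations on values. -/
inductive UnOp : Type
  | exp
  | log
  | sqrt

/-- Binary operations on values. -/
inductive BinOp : Type
  | add
  | sub
  | mul
  | div
  | le

/-- The value of a unary operation. -/
noncomputable def UnOp.val : UnOp → ℝ → ℝ
  | .exp => Real.exp
  | .log => Real.log
  | .sqrt => Real.sqrt

open Classical in
/-- The value of a binary operation. -/
noncomputable def BinOp.val : BinOp → ℝ → ℝ → ℝ
  | .add => fun x y => x + y
  | .sub => fun x y => x - y
  | .mul => fun x y => x * y
  | .div => fun x y => x / y
  | .le => fun x y => if x ≤ y then 1 else 0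

/-- The machine operation for a unary operation. -/
def UnOp.toOp {R : Type} : UnOp → R → Op R
  | .exp => Op.exp
  | .log => Op.log
  | .sqrt => Op.sqrt

/-- The machine operation for a binary operation. -/
def BinOp.toOp {R : Type} : BinOp → R → R → Op R
  | .add => Op.add
  | .sub => Op.sub
  | .mul => Op.mul
  | .div => Op.div
  | .le => Op.le

theorem UnOp.eval_toOp {R : Type} (o : UnOp) (M : R → ℝ) (a : R) :
    (o.toOp a).eval M = o.val (M a) := by cases o <;> rfl

theorem BinOp.eval_toOp {R : Type} (o : BinOp) (M : R → ℝ) (a b : R) :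
    (o.toOp a b).eval M = o.val (M a) (M b) := by cases o <;> rfl

/-- Arithmetic expressions over registers. -/
inductive Expr (R : Type) : Type
  | reg (r : R)
  | const (z : ℤ)
  | un (o : UnOp) (a : Expr R)
  | bin (o : BinOp) (a b : Expr R)
  -- A primitive, because its code reuses both operands from the stack. A derived form a + (a ≤ b)(b
  -- - a) would evaluate them repeatedly, and nested maxima would become exponentially long.
  | max (a b : Expr R)

namespace Expr

variable {R : Type}

instance : Add (Expr R) := ⟨.bin .add⟩
instance : Sub (Expr R) := ⟨.bin .sub⟩
instance : Mul (Expr R) := ⟨.bin .mul⟩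
instance : Div (Expr R) := ⟨.bin .div⟩

/-- The value of an expression. -/
noncomputable def eval (M : R → ℝ) : Expr R → ℝ
  | .reg r => M r
  | .const z => z
  | .un o a => o.val (a.eval M)
  | .bin o a b => o.val (a.eval M) (b.eval M)
  | .max a b => Max.max (a.eval M) (b.eval M)

/-- The number of instructions of the compiled expression. -/
def cost : Expr R → ℕ
  | .reg _ => 1
  | .const _ => 1
  | .un _ a => a.cost + 1
  | .bin _ a b => a.cost + b.cost + 1
  | .max a b => a.cost + b.cost + 4

/-- All registers read by the expression satisfy `P`. -/
def ReadsOnly (P : R → Prop) : Expr R → Prop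
  | .reg r => P r
  | .const _ => True
  | .un _ a => a.ReadsOnly P
  | .bin _ a b => a.ReadsOnly P ∧ b.ReadsOnly P
  | .max a b => a.ReadsOnly P ∧ b.ReadsOnly P

/-- Code that stores the value of the expression in the stack register `scr t`, using the stack
registers above it. -/
def compile (scr : ℕ → R) : Expr R → ℕ → List (Instr R)
  | .reg r, t => [⟨scr t, .copy r⟩]
  | .const z, t => [⟨scr t, .const z⟩]
  | .un o a, t => a.compile scr t ++ [⟨scr t, o.toOp (scr t)⟩]
  | .bin o a b, t =>
    a.compile scr t ++ (b.compile scr (t + 1) ++ [⟨scr t, o.toOp (scr t) (scr (t + 1))⟩])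
  | .max a b, t =>
    a.compile scr t ++ (b.compile scr (t + 1) ++
      [⟨scr (t + 2), .le (scr t) (scr (t + 1))⟩, ⟨scr (t + 1), .sub (scr (t + 1)) (scr t)⟩,
        ⟨scr (t + 1), .mul (scr (t + 1)) (scr (t + 2))⟩, ⟨scr t, .add (scr t) (scr (t + 1))⟩])

theorem length_compile (scr : ℕ → R) (e : Expr R) (t : ℕ) :
    (e.compile scr t).length = e.cost := by
  induction e generalizing t with
  | reg r => rfl
  | const z => rfl
  | un o a ih => simp [compile, cost, ih]
  | bin o a b iha ihb => simp [compile, cost, iha, ihb]; ring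
  | max a b iha ihb => simp [compile, cost, iha, ihb]; ring

theorem ReadsOnly.eval_eq {P : R → Prop} {e : Expr R} (he : e.ReadsOnly P) {M M' : R → ℝ}
    (h : ∀ r, P r → M r = M' r) : e.eval M = e.eval M' := by
  induction e with
  | reg r => exact h r he
  | const z => rfl
  | un o a ih => simp only [eval, ih he]
  | bin o a b iha ihb => simp only [eval, iha he.1, ihb he.2]
  | max a b iha ihb => simp only [eval, iha he.1, ihb he.2]

theorem ReadsOnly.mono {P P' : R → Prop} {e : Expr R} (he : e.ReadsOnly P)
    (h : ∀ r, P r → P' r) : e.ReadsOnly P' := by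
  induction e with
  | reg r => exact h r he
  | const z => trivial
  | un o a ih => exact ih he
  | bin o a b iha ihb => exact ⟨iha he.1, ihb he.2⟩
  | max a b iha ihb => exact ⟨iha he.1, ihb he.2⟩

/-- Stack discipline: code at height t touches only stack registers from t upwards. This frame
clause, proved along with the value, keeps the left operand intact while the right one is computed
at height t + 1. -/
theorem run_compile {scr : ℕ → R} (hs : Function.Injective scr) (e : Expr R)
    (he : e.ReadsOnly fun r => ∀ s, r ≠ scr s) (t : ℕ) (M : R → ℝ) :
    runBlock (e.compile scr t) M (scr t) = e.eval M ∧
      ∀ r, (∀ s, t ≤ s → r ≠ scr s) → runBlock (e.compile scr t) M r = M r := by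
  induction e generalizing t M with
  | reg r =>
    simp only [compile, runBlock_cons, runBlock_nil, Instr.exec, Op.eval, eval, if_true, true_and]
    intro r' h
    rw [if_neg (h t le_rfl)]
  | const z =>
    simp only [compile, runBlock_cons, runBlock_nil, Instr.exec, Op.eval, eval, if_true, true_and]
    intro r' h
    rw [if_neg (h t le_rfl)]
  | un o a ih =>
    obtain ⟨h1, h2⟩ := ih he t M
    simp only [compile, runBlock_append, runBlock_cons, runBlock_nil, Instr.exec, eval, if_true,
      UnOp.eval_toOp, h1, true_and]
    intro r' h
    rw [if_neg (h t le_rfl), h2 r' h]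
  | bin o a b iha ihb =>
    obtain ⟨h1, h2⟩ := iha he.1 t M
    set M₁ := runBlock (a.compile scr t) M with hM₁
    obtain ⟨h3, h4⟩ := ihb he.2 (t + 1) M₁
    have hb : b.eval M₁ = b.eval M := he.2.eval_eq fun r hr => h2 r fun s _ => hr s
    have ht : runBlock (b.compile scr (t + 1)) M₁ (scr t) = a.eval M := by
      rw [h4 _ fun s hst h => by have := hs h; omega, h1]
    simp only [compile, runBlock_append, runBlock_cons, runBlock_nil, Instr.exec, eval, if_true,
      BinOp.eval_toOp, ← hM₁, h3, hb, ht, true_and]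
    intro r' h
    rw [if_neg (h t le_rfl), h4 r' fun s hst => h s (by omega), h2 r' h]
  | max a b iha ihb =>
    obtain ⟨h1, h2⟩ := iha he.1 t M
    set M₁ := runBlock (a.compile scr t) M with hM₁
    obtain ⟨h3, h4⟩ := ihb he.2 (t + 1) M₁
    have hb : b.eval M₁ = b.eval M := he.2.eval_eq fun r hr => h2 r fun s _ => hr s
    have ht : runBlock (b.compile scr (t + 1)) M₁ (scr t) = a.eval M := by
      rw [h4 _ fun s hst h => by have := hs h; omega, h1]
    have e1 : scr t ≠ scr (t + 1) := fun h => by have := hs h; omega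
    have e2 : scr t ≠ scr (t + 2) := fun h => by have := hs h; omega
    have e3 : scr (t + 1) ≠ scr (t + 2) := fun h => by have := hs h; omega
    simp only [compile, runBlock_append, runBlock_cons, runBlock_nil, Instr.exec, eval, if_true,
      Op.eval, ← hM₁, h3, hb, ht, e1, e2, e3, e3.symm, if_false]
    constructor
    -- The code computes a + (b - a)·[a ≤ b].
    · split_ifs with h
      · rw [max_eq_right h]; ring
      · rw [max_eq_left (not_le.1 h).le]; ring
    · intro r' h
      rw [if_neg (h t le_rfl), if_neg (h (t + 1) (by omega)), if_neg (h (t + 1) (by omega)),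
        if_neg (h (t + 2) (by omega)), h4 r' fun s hst => h s (by omega), h2 r' h]

/-- Exponential. -/
def exp (a : Expr R) : Expr R := .un .exp a
/-- Logarithm. -/
def log (a : Expr R) : Expr R := .un .log a
/-- Square root. -/
def sqrt (a : Expr R) : Expr R := .un .sqrt a
/-- Comparison. -/
def le (a b : Expr R) : Expr R := .bin .le a b
/-- Absolute value. -/
def abs (a : Expr R) : Expr R := sqrt (a * a)
/-- Minimum. -/
def min (a b : Expr R) : Expr R := const 0 - max (const 0 - a) (const 0 - b)
/-- Sum of a family. -/
def sum : {N : ℕ} → (Fin N → Expr R) → Expr R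
  | 0, _ => const 0
  | _ + 1, f => f 0 + sum fun i => f i.succ
/-- Maximum of `0` and a family. -/
def maxs : {N : ℕ} → (Fin N → Expr R) → Expr R
  | 0, _ => const 0
  | _ + 1, f => max (f 0) (maxs fun i => f i.succ)
/-- Minimum of `1` and a family. -/
def mins : {N : ℕ} → (Fin N → Expr R) → Expr R
  | 0, _ => const 1
  | _ + 1, f => min (f 0) (mins fun i => f i.succ)

/-! ### Values of derived expressions -/

section eval
variable (M : R → ℝ) (a b : Expr R)

@[simp] theorem eval_reg (r : R) : (reg r).eval M = M r := rfl
@[simp] theorem eval_const (z : ℤ) : (const z : Expr R).eval M = z := rfl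
@[simp] theorem eval_add : (a + b).eval M = a.eval M + b.eval M := rfl
@[simp] theorem eval_sub : (a - b).eval M = a.eval M - b.eval M := rfl
@[simp] theorem eval_mul : (a * b).eval M = a.eval M * b.eval M := rfl
@[simp] theorem eval_div : (a / b).eval M = a.eval M / b.eval M := rfl
@[simp] theorem eval_exp : a.exp.eval M = Real.exp (a.eval M) := rfl
@[simp] theorem eval_log : a.log.eval M = Real.log (a.eval M) := rfl
@[simp] theorem eval_sqrt : a.sqrt.eval M = Real.sqrt (a.eval M) := rfl
@[simp] theorem eval_max : (a.max b).eval M = Max.max (a.eval M) (b.eval M) := rfl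
open Classical in
@[simp] theorem eval_le : (a.le b).eval M = if a.eval M ≤ b.eval M then 1 else 0 := rfl
@[simp] theorem eval_abs : a.abs.eval M = |a.eval M| := Real.sqrt_mul_self_eq_abs _
@[simp] theorem eval_min : (a.min b).eval M = Min.min (a.eval M) (b.eval M) := by
  simp only [min, eval_sub, eval_const, eval_max, Int.cast_zero, zero_sub]
  rw [max_neg_neg, neg_neg]

@[simp] theorem eval_sum {N : ℕ} (f : Fin N → Expr R) :
    (sum f).eval M = ∑ i, (f i).eval M := by
  induction N with
  | zero => simp [sum]
  | succ N ih => simp [sum, ih, Fin.sum_univ_succ]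

/-- The default 0 does not affect a nonnegative family, and it agrees with the real supremum over an
empty index set, so N = 0 needs no exclusion. -/
theorem eval_maxs {N : ℕ} (f : Fin N → Expr R) (h : ∀ i, 0 ≤ (f i).eval M) :
    (maxs f).eval M = ⨆ i, (f i).eval M := by
  induction N with
  | zero => simp [maxs]
  | succ N ih =>
    simp only [maxs, eval_max]
    rw [ih _ fun i => h i.succ]
    have hb : BddAbove (Set.range fun i : Fin (N + 1) => (f i).eval M) :=
      (Set.finite_range _).bddAbove
    have hb' : BddAbove (Set.range fun i : Fin N => (f i.succ).eval M) :=
      Set.finite_range _ |>.bddAbove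
    apply le_antisymm
    · refine max_le (le_ciSup hb 0) (Real.iSup_le (fun i => le_ciSup hb i.succ) ?_)
      exact (h 0).trans (le_ciSup hb 0)
    · refine ciSup_le fun i => ?_
      refine Fin.cases (le_max_left _ _) (fun i => ?_) i
      exact le_max_of_le_right (le_ciSup hb' i)

/-- The default 1 does not affect a family bounded by 1, such as the weights. The empty family is
excluded because the real infimum over it is 0. -/
theorem eval_mins {N : ℕ} (hN : 1 ≤ N) (f : Fin N → Expr R) (h : ∀ i, (f i).eval M ≤ 1) :
    (mins f).eval M = ⨅ i, (f i).eval M := by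
  induction N with
  | zero => omega
  | succ N ih =>
    simp only [mins, eval_min]
    have hb : BddBelow (Set.range fun i : Fin (N + 1) => (f i).eval M) :=
      (Set.finite_range _).bddBelow
    rcases Nat.eq_zero_or_pos N with rfl | hN
    · simp only [mins, eval_const, Int.cast_one, min_eq_left (h 0)]
      exact (ciInf_unique (ι := Fin 1) (s := fun i => (f i).eval M)).symm
    rw [ih hN _ fun i => h i.succ]
    have : Nonempty (Fin N) := ⟨⟨0, hN⟩⟩
    have hb' : BddBelow (Set.range fun i : Fin N => (f i.succ).eval M) :=
      Set.finite_range _ |>.bddBelow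
    apply le_antisymm
    · refine le_ciInf fun i => ?_
      refine Fin.cases (min_le_left _ _) (fun i => ?_) i
      exact (min_le_right _ _).trans (ciInf_le hb' i)
    · exact le_min (ciInf_le hb 0) (le_ciInf fun i => ciInf_le hb i.succ)

end eval

/-! ### Instruction counts of derived expressions -/

section cost
variable (a b : Expr R)

@[simp] theorem cost_reg (r : R) : (reg r).cost = 1 := rfl
@[simp] theorem cost_const (z : ℤ) : (const z : Expr R).cost = 1 := rfl
@[simp] theorem cost_add : (a + b).cost = a.cost + b.cost + 1 := rfl
@[simp] theorem cost_sub : (a - b).cost = a.cost + b.cost + 1 := rfl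
@[simp] theorem cost_mul : (a * b).cost = a.cost + b.cost + 1 := rfl
@[simp] theorem cost_div : (a / b).cost = a.cost + b.cost + 1 := rfl
@[simp] theorem cost_exp : a.exp.cost = a.cost + 1 := rfl
@[simp] theorem cost_log : a.log.cost = a.cost + 1 := rfl
@[simp] theorem cost_sqrt : a.sqrt.cost = a.cost + 1 := rfl
@[simp] theorem cost_max : (a.max b).cost = a.cost + b.cost + 4 := rfl
@[simp] theorem cost_le : (a.le b).cost = a.cost + b.cost + 1 := rfl
@[simp] theorem cost_abs : a.abs.cost = 2 * a.cost + 2 := by simp [abs]; ring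
@[simp] theorem cost_min : (a.min b).cost = a.cost + b.cost + 10 := by simp [min]; ring

@[simp] theorem cost_sum {N : ℕ} (f : Fin N → Expr R) :
    (sum f).cost = 1 + ∑ i, ((f i).cost + 1) := by
  induction N with
  | zero => simp [sum]
  | succ N ih => simp only [sum, cost_add, ih, Fin.sum_univ_succ]; ring

@[simp] theorem cost_maxs {N : ℕ} (f : Fin N → Expr R) :
    (maxs f).cost = 1 + ∑ i, ((f i).cost + 4) := by
  induction N with
  | zero => simp [maxs]
  | succ N ih => simp only [maxs, cost_max, ih, Fin.sum_univ_succ]; ring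

@[simp] theorem cost_mins {N : ℕ} (f : Fin N → Expr R) :
    (mins f).cost = 1 + ∑ i, ((f i).cost + 10) := by
  induction N with
  | zero => simp [mins]
  | succ N ih => simp only [mins, cost_min, ih, Fin.sum_univ_succ]; ring

end cost

/-! ### Registers read by derived expressions -/

section reads
variable (P : R → Prop) (a b : Expr R)

@[simp] theorem readsOnly_reg (r : R) : (reg r).ReadsOnly P ↔ P r := Iff.rfl
@[simp] theorem readsOnly_const (z : ℤ) : (const z : Expr R).ReadsOnly P := trivial
@[simp] theorem readsOnly_add : (a + b).ReadsOnly P ↔ a.ReadsOnly P ∧ b.ReadsOnly P := Iff.rfl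
@[simp] theorem readsOnly_sub : (a - b).ReadsOnly P ↔ a.ReadsOnly P ∧ b.ReadsOnly P := Iff.rfl
@[simp] theorem readsOnly_mul : (a * b).ReadsOnly P ↔ a.ReadsOnly P ∧ b.ReadsOnly P := Iff.rfl
@[simp] theorem readsOnly_div : (a / b).ReadsOnly P ↔ a.ReadsOnly P ∧ b.ReadsOnly P := Iff.rfl
@[simp] theorem readsOnly_exp : a.exp.ReadsOnly P ↔ a.ReadsOnly P := Iff.rfl
@[simp] theorem readsOnly_log : a.log.ReadsOnly P ↔ a.ReadsOnly P := Iff.rfl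
@[simp] theorem readsOnly_sqrt : a.sqrt.ReadsOnly P ↔ a.ReadsOnly P := Iff.rfl
@[simp] theorem readsOnly_max : (a.max b).ReadsOnly P ↔ a.ReadsOnly P ∧ b.ReadsOnly P := Iff.rfl
@[simp] theorem readsOnly_le : (a.le b).ReadsOnly P ↔ a.ReadsOnly P ∧ b.ReadsOnly P := Iff.rfl
@[simp] theorem readsOnly_abs : a.abs.ReadsOnly P ↔ a.ReadsOnly P := by simp [abs]
@[simp] theorem readsOnly_min : (a.min b).ReadsOnly P ↔ a.ReadsOnly P ∧ b.ReadsOnly P := by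
  simp [min]

@[simp] theorem readsOnly_sum {N : ℕ} (f : Fin N → Expr R) :
    (sum f).ReadsOnly P ↔ ∀ i, (f i).ReadsOnly P := by
  induction N with
  | zero => simp [sum]
  | succ N ih => simp [sum, ih, Fin.forall_fin_succ]

@[simp] theorem readsOnly_maxs {N : ℕ} (f : Fin N → Expr R) :
    (maxs f).ReadsOnly P ↔ ∀ i, (f i).ReadsOnly P := by
  induction N with
  | zero => simp [maxs]
  | succ N ih => simp [maxs, ih, Fin.forall_fin_succ]

@[simp] theorem readsOnly_mins {N : ℕ} (f : Fin N → Expr R) :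
    (mins f).ReadsOnly P ↔ ∀ i, (f i).ReadsOnly P := by
  induction N with
  | zero => simp [mins]
  | succ N ih => simp [mins, ih, Fin.forall_fin_succ]

end reads

end Expr

/-- Code for the simultaneous assignments `dst i := e i`. -/
noncomputable def assignAll {R : Type} (scr : ℕ → R) {ι : Type} [Fintype ι] (dst : ι → R)
    (e : ι → Expr R) : List (Instr R) :=
  (Finset.univ : Finset ι).toList.flatMap fun i =>
    (e i).compile scr 0 ++ [⟨dst i, .copy (scr 0)⟩]

theorem length_assignAll {R : Type} (scr : ℕ → R) {ι : Type} [Fintype ι] (dst : ι → R)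
    (e : ι → Expr R) : (assignAll scr dst e).length = ∑ i, ((e i).cost + 1) := by
  rw [← Finset.sum_map_toList, assignAll]
  generalize (Finset.univ : Finset ι).toList = L
  induction L with
  | nil => simp
  | cons i L ih => simp [Expr.length_compile, ih]; ring

/-- No right-hand side reads a destination or a stack register, so executing the assignments one by
one, in whatever order the list has, equals executing them simultaneously. -/
theorem run_assignAll {R : Type} {scr : ℕ → R} (hs : Function.Injective scr) {ι : Type}
    [Fintype ι] {dst : ι → R} (hd : Function.Injective dst) (hds : ∀ i s, dst i ≠ scr s)
    {e : ι → Expr R} (he : ∀ i, (e i).ReadsOnly fun r => (∀ s, r ≠ scr s) ∧ ∀ j, r ≠ dst j)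
    (M : R → ℝ) :
    (∀ i, runBlock (assignAll scr dst e) M (dst i) = (e i).eval M) ∧
      ∀ r, (∀ s, r ≠ scr s) → (∀ i, r ≠ dst i) → runBlock (assignAll scr dst e) M r = M r := by
  suffices H : ∀ L : List ι,
      let B := L.flatMap fun i => (e i).compile scr 0 ++ [⟨dst i, .copy (scr 0)⟩]
      ∀ M : R → ℝ, (∀ i ∈ L, runBlock B M (dst i) = (e i).eval M) ∧
      ∀ r, (∀ s, r ≠ scr s) → (∀ i ∈ L, r ≠ dst i) → runBlock B M r = M r by
    have := H (Finset.univ : Finset ι).toList M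
    simpa [assignAll] using this
  intro L
  induction L with
  | nil => simp [runBlock_nil]
  | cons i L ih =>
    intro B M
    obtain ⟨h1, h2⟩ := (e i).run_compile hs ((he i).mono fun r hr => hr.1) 0 M
    set M₁ : R → ℝ := runBlock ((e i).compile scr 0 ++ [⟨dst i, .copy (scr 0)⟩]) M with hM₁
    have g1 : M₁ (dst i) = (e i).eval M := by
      rw [hM₁, runBlock_append, runBlock_cons, runBlock_nil, ← h1]
      simp [Instr.exec, Op.eval]
    have g2 : ∀ r, (∀ s, r ≠ scr s) → r ≠ dst i → M₁ r = M r := by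
      intro r hr hri
      rw [hM₁, runBlock_append, runBlock_cons, runBlock_nil, ← h2 r fun s _ => hr s]
      simp [Instr.exec, hri]
    have hB : runBlock B M = runBlock (L.flatMap fun i =>
        (e i).compile scr 0 ++ [⟨dst i, .copy (scr 0)⟩]) M₁ := by
      simp only [B, List.flatMap_cons, runBlock_append, hM₁]
    obtain ⟨k1, k2⟩ := ih M₁
    rw [hB]
    constructor
    · intro j hj
      by_cases hjL : j ∈ L
      · rw [k1 j hjL]
        exact (he j).eval_eq fun r hr => g2 r hr.1 (hr.2 i)
      · obtain rfl : j = i := by simpa [hjL] using hj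
        rw [k2 _ (hds j) fun i' hi' h => hjL (hd h ▸ hi'), g1]
    · intro r hr hri
      rw [k2 r hr fun i' hi' => hri i' (List.mem_cons_of_mem _ hi'),
        g2 r hr (hri i List.mem_cons_self)]

/-! ### Renaming registers -/

/-- Renaming the registers of an operation. -/
def Op.map {R S : Type} (φ : R → S) : Op R → Op S
  | .const z => .const z
  | .copy a => .copy (φ a)
  | .add a b => .add (φ a) (φ b)
  | .sub a b => .sub (φ a) (φ b)
  | .mul a b => .mul (φ a) (φ b)
  | .div a b => .div (φ a) (φ b)
  | .exp a => .exp (φ a)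
  | .log a => .log (φ a)
  | .sqrt a => .sqrt (φ a)
  | .le a b => .le (φ a) (φ b)

/-- Renaming the registers of a block. -/
def mapBlock {R S : Type} (φ : R → S) (B : List (Instr R)) : List (Instr S) :=
  B.map fun c => ⟨φ c.dst, c.op.map φ⟩

theorem length_mapBlock {R S : Type} (φ : R → S) (B : List (Instr R)) :
    (mapBlock φ B).length = B.length := List.length_map _

/-- Under an injective renaming the pulled-back memory M ∘ φ evolves exactly as under the original
block. This lets an unknown retraction subroutine run inside the RBCD memory. -/
theorem run_mapBlock {R S : Type} {φ : R → S} (hφ : Function.Injective φ) (B : List (Instr R))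
    (M : S → ℝ) :
    (∀ r, runBlock (mapBlock φ B) M (φ r) = runBlock B (M ∘ φ) r) ∧
      ∀ s, (∀ r, s ≠ φ r) → runBlock (mapBlock φ B) M s = M s := by
  induction B generalizing M with
  | nil => exact ⟨fun _ => rfl, fun _ _ => rfl⟩
  | cons c B ih =>
    set c' : Instr S := ⟨φ c.dst, c.op.map φ⟩ with hc'
    have hB : mapBlock φ (c :: B) = c' :: mapBlock φ B := rfl
    have hop : (c.op.map φ).eval M = c.op.eval (M ∘ φ) := by
      cases c.op <;> rfl
    have h1 : c'.exec M ∘ φ = c.exec (M ∘ φ) := by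
      funext r
      simp only [Function.comp_apply, Instr.exec, hc']
      rw [hop]
      by_cases hr : r = c.dst
      · rw [if_pos (congrArg φ hr), if_pos hr]
      · rw [if_neg fun h => hr (hφ h), if_neg hr]
    rw [hB, runBlock_cons]
    obtain ⟨k1, k2⟩ := ih (c'.exec M)
    refine ⟨fun r => ?_, fun s hs => ?_⟩
    · rw [k1, h1, runBlock_cons]
    · rw [k2 s hs]
      simp [Instr.exec, hc', hs c.dst]

/-! ### The Frobenius norm -/

section frob
variable {d k : ℕ}

/-- A matrix as a vector of a Euclidean space. -/
noncomputable def vecE (A : Matrix (Fin d) (Fin k) ℝ) : EuclideanSpace ℝ (Fin d × Fin k) :=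
  WithLp.toLp 2 fun x => A x.1 x.2

theorem vecE_add (A B : Matrix (Fin d) (Fin k) ℝ) : vecE (A + B) = vecE A + vecE B := rfl
theorem vecE_sub (A B : Matrix (Fin d) (Fin k) ℝ) : vecE (A - B) = vecE A - vecE B := rfl
theorem vecE_smul (c : ℝ) (A : Matrix (Fin d) (Fin k) ℝ) : vecE (c • A) = c • vecE A := rfl

theorem frobNorm_eq (A : Matrix (Fin d) (Fin k) ℝ) : frobNorm A = ‖vecE A‖ := by
  rw [EuclideanSpace.norm_eq, Fintype.sum_prod_type, frobNorm]
  simp [vecE]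

theorem inner_vecE (A B : Matrix (Fin d) (Fin k) ℝ) :
    inner ℝ (vecE A) (vecE B) = ∑ a, ∑ b, A a b * B a b := by
  rw [PiLp.inner_apply, Fintype.sum_prod_type]
  simp [vecE, mul_comm]

theorem inner_vecE_eq_trace (A B : Matrix (Fin d) (Fin k) ℝ) :
    inner ℝ (vecE A) (vecE B) = (Aᵀ * B).trace := by
  rw [inner_vecE, Finset.sum_comm]
  simp [Matrix.trace, Matrix.mul_apply]

theorem frobNorm_nonneg (A : Matrix (Fin d) (Fin k) ℝ) : 0 ≤ frobNorm A := Real.sqrt_nonneg _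

theorem frobNorm_sq (A : Matrix (Fin d) (Fin k) ℝ) : frobNorm A ^ 2 = ∑ a, ∑ b, A a b ^ 2 :=
  Real.sq_sqrt (Finset.sum_nonneg fun _ _ => Finset.sum_nonneg fun _ _ => sq_nonneg _)

theorem frobNorm_add_le (A B : Matrix (Fin d) (Fin k) ℝ) :
    frobNorm (A + B) ≤ frobNorm A + frobNorm B := by
  simpa only [frobNorm_eq, vecE_add] using norm_add_le _ _

theorem frobNorm_smul (c : ℝ) (A : Matrix (Fin d) (Fin k) ℝ) :
    frobNorm (c • A) = |c| * frobNorm A := by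
  simp only [frobNorm_eq, vecE_smul, norm_smul, Real.norm_eq_abs]

theorem frobNorm_sum_le {ι : Type*} (s : Finset ι) (A : ι → Matrix (Fin d) (Fin k) ℝ) :
    frobNorm (∑ i ∈ s, A i) ≤ ∑ i ∈ s, frobNorm (A i) := by
  classical
  induction s using Finset.induction_on with
  | empty => simp [frobNorm]
  | insert i s hi ih =>
    rw [Finset.sum_insert hi, Finset.sum_insert hi]
    exact (frobNorm_add_le _ _).trans (by gcongr)

/-- A column of a matrix as a vector of a Euclidean space. -/
noncomputable def colE (A : Matrix (Fin d) (Fin k) ℝ) (j : Fin k) : EuclideanSpace ℝ (Fin d) :=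
  WithLp.toLp 2 fun a => A a j

theorem inner_colE (A B : Matrix (Fin d) (Fin k) ℝ) (i j : Fin k) :
    inner ℝ (colE A i) (colE B j) = ∑ a, A a i * B a j := by
  rw [PiLp.inner_apply]
  simp [colE, mul_comm]

theorem inner_colE_eq (A B : Matrix (Fin d) (Fin k) ℝ) (i j : Fin k) :
    inner ℝ (colE A i) (colE B j) = (Aᵀ * B) i j := by
  rw [inner_colE, Matrix.mul_apply]
  rfl

theorem frobNorm_sq_eq_colE (A : Matrix (Fin d) (Fin k) ℝ) :
    frobNorm A ^ 2 = ∑ j, ‖colE A j‖ ^ 2 := by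
  rw [frobNorm_sq, Finset.sum_comm]
  simp [EuclideanSpace.norm_sq_eq, colE]

theorem norm_colE_le (A : Matrix (Fin d) (Fin k) ℝ) (j : Fin k) : ‖colE A j‖ ≤ frobNorm A := by
  refine le_of_sq_le_sq ?_ (frobNorm_nonneg A)
  rw [frobNorm_sq_eq_colE]
  exact Finset.single_le_sum (f := fun j => ‖colE A j‖ ^ 2) (fun _ _ => sq_nonneg _)
    (Finset.mem_univ j)

theorem frobNorm_le_sum_colE (A : Matrix (Fin d) (Fin k) ℝ) : frobNorm A ≤ ∑ j, ‖colE A j‖ := by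
  refine le_of_sq_le_sq ?_ (Finset.sum_nonneg fun _ _ => norm_nonneg _)
  rw [frobNorm_sq_eq_colE]
  exact Finset.sum_sq_le_sq_sum_of_nonneg fun _ _ => norm_nonneg _

end frob

/-! ### The QR retraction -/

section gs
variable {E : Type*} [NormedAddCommGroup E] [InnerProductSpace ℝ E] {k : ℕ} {a x : Fin k → E}

/-- Gram–Schmidt is a unit triangular change of basis: the correction lies in the span of the
earlier vectors. -/
theorem exists_gramSchmidt_eq_sum (a : Fin k → E) (i : Fin k) :
    ∃ c : Fin k → ℝ, c i = 1 ∧ (∀ j, i < j → c j = 0) ∧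
      gramSchmidt ℝ a i = ∑ l, c l • a l := by
  have h : gramSchmidt ℝ a i - a i ∈ Submodule.span ℝ (a '' (Finset.Iio i : Set (Fin k))) := by
    rw [Finset.coe_Iio, ← span_gramSchmidt_Iio, gramSchmidt_def, sub_sub_cancel_left]
    refine Submodule.neg_mem _ (Submodule.sum_mem _ fun j hj => ?_)
    rw [Submodule.starProjection_singleton]
    exact Submodule.smul_mem _ _ (Submodule.subset_span ⟨j, Finset.mem_Iio.1 hj, rfl⟩)
  obtain ⟨c, hc⟩ := (Submodule.mem_span_image_finset_iff_exists_fun' ℝ).1 h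
  refine ⟨fun l => if l < i then c l else if l = i then 1 else 0, by simp, fun j hj => ?_, ?_⟩
  · simp [hj.le, hj.ne']
  · have h2 : ∀ l, (if l < i then c l else if l = i then 1 else 0) • a l =
        (if l < i then c l • a l else 0) + if l = i then a l else 0 := by
      intro l
      rcases lt_trichotomy l i with h | h | h
      · simp [h, h.ne]
      · simp [h]
      · simp [h.ne', h.not_gt]
    simp only [h2, Finset.sum_add_distrib, Finset.sum_ite_eq', Finset.mem_univ, if_true]
    rw [← Finset.sum_filter, Finset.filter_gt_eq_Iio, hc]
    abel

theorem inner_sum_smul_of_gram (hG : ∀ i j, inner ℝ (a i) (a j) =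
    (if i = j then 1 else 0) + inner ℝ (x i) (x j)) (c : Fin k → ℝ) (j : Fin k) :
    inner ℝ (∑ l, c l • a l) (a j) = c j + inner ℝ (∑ l, c l • x l) (x j) := by
  simp only [sum_inner, real_inner_smul_left, hG, mul_add, Finset.sum_add_distrib]
  simp

/-- A Gram matrix I + XᵀX dominates the identity, as the squared norm is Σ c² + ‖Σ c x‖². It yields
linear independence and bounds the triangular coefficients of Gram–Schmidt. -/
theorem sum_sq_le_norm_sq_of_gram (hG : ∀ i j, inner ℝ (a i) (a j) =
    (if i = j then 1 else 0) + inner ℝ (x i) (x j)) (c : Fin k → ℝ) :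
    ∑ l, c l ^ 2 ≤ ‖∑ l, c l • a l‖ ^ 2 := by
  have h : ‖∑ l, c l • a l‖ ^ 2 = ∑ l, c l ^ 2 + ‖∑ l, c l • x l‖ ^ 2 := by
    rw [← real_inner_self_eq_norm_sq, inner_sum]
    simp only [real_inner_smul_right, inner_sum_smul_of_gram hG, mul_add, Finset.sum_add_distrib]
    rw [← real_inner_self_eq_norm_sq, inner_sum]
    simp only [real_inner_smul_right, sq]
  rw [h]
  exact le_add_of_nonneg_right (sq_nonneg _)

theorem linearIndependent_of_gram (hG : ∀ i j, inner ℝ (a i) (a j) =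
    (if i = j then 1 else 0) + inner ℝ (x i) (x j)) : LinearIndependent ℝ a := by
  rw [Fintype.linearIndependent_iff]
  intro c hc i
  have h := sum_sq_le_norm_sq_of_gram hG c
  rw [hc, norm_zero, zero_pow two_ne_zero] at h
  have := (Finset.sum_eq_zero_iff_of_nonneg fun l _ => sq_nonneg (c l)).1
    (le_antisymm h (Finset.sum_nonneg fun l _ => sq_nonneg (c l))) i (Finset.mem_univ i)
  exact pow_eq_zero_iff two_ne_zero |>.1 this

theorem gramSchmidt_eq_smul_normed (a : Fin k → E) (i : Fin k) :
    gramSchmidt ℝ a i = ‖gramSchmidt ℝ a i‖ • gramSchmidtNormed ℝ a i := by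
  rw [gramSchmidtNormed]
  by_cases h : gramSchmidt ℝ a i = 0
  · simp [h]
  · simp [smul_smul, mul_inv_cancel₀ (norm_ne_zero_iff.2 h)]

theorem gramSchmidt_eq_sub_normed (a : Fin k → E) (j : Fin k) :
    gramSchmidt ℝ a j = a j - ∑ i ∈ Finset.Iio j,
      inner ℝ (gramSchmidtNormed ℝ a i) (a j) • gramSchmidtNormed ℝ a i := by
  rw [eq_sub_iff_add_eq]
  conv_rhs => rw [gramSchmidt_def'' ℝ a j]
  congr 1
  refine Finset.sum_congr rfl fun i _ => ?_
  rw [gramSchmidtNormed, real_inner_smul_left, smul_smul]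
  congr 1
  simp only [RCLike.ofReal_real_eq_id, id_eq]
  rw [div_eq_mul_inv, sq, mul_inv]
  ring

/-- Write g_i = Σ c_l a_l with c unit triangular. The Gram identity gives ⟨g_i, a_j⟩ = c_j + Σ c_l
⟨x_l, x_j⟩, and |c_l| ≤ ‖g_i‖, so ⟨g_i, a_j⟩ is within ‖g_i‖ k s² of c_j. For i < j, c_j = 0 and
dividing by ‖g_i‖ bounds the projection coefficients; for i = j, c_j = 1 and the length of g_j is
close to 1. One length error and at most k coefficients of size k s² add up to the bound, without
any smallness of s. -/
theorem norm_gramSchmidtNormed_sub_le (hG : ∀ i j, inner ℝ (a i) (a j) =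
    (if i = j then 1 else 0) + inner ℝ (x i) (x j)) {s : ℝ} (hx : ∀ i, ‖x i‖ ≤ s) (j : Fin k) :
    ‖gramSchmidtNormed ℝ a j - a j‖ ≤ (k + k * k) * s ^ 2 := by
  have hs : 0 ≤ s := (norm_nonneg _).trans (hx j)
  have hli := linearIndependent_of_gram hG
  have hq : ∀ i, ‖gramSchmidtNormed ℝ a i‖ = 1 := fun i => gramSchmidtNormed_unit_length i hli
  have key : ∀ i, ∃ c : Fin k → ℝ, c i = 1 ∧ (∀ j, i < j → c j = 0) ∧
      1 ≤ ‖gramSchmidt ℝ a i‖ ∧ ∀ j,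
        |inner ℝ (gramSchmidt ℝ a i) (a j) - c j| ≤ ‖gramSchmidt ℝ a i‖ * (k * s ^ 2) := by
    intro i
    obtain ⟨c, h1, h2, h3⟩ := exists_gramSchmidt_eq_sum a i
    have h4 := sum_sq_le_norm_sq_of_gram hG c
    rw [← h3] at h4
    have h5 : ∀ l, |c l| ≤ ‖gramSchmidt ℝ a i‖ := fun l => by
      refine abs_le_of_sq_le_sq ?_ (norm_nonneg _)
      exact (Finset.single_le_sum (f := fun l => c l ^ 2) (fun _ _ => sq_nonneg _)
        (Finset.mem_univ l)).trans h4
    refine ⟨c, h1, h2, by simpa [h1] using h5 i, fun j => ?_⟩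
    have h6 : inner ℝ (gramSchmidt ℝ a i) (a j) - c j = ∑ l, c l * inner ℝ (x l) (x j) := by
      rw [h3, inner_sum_smul_of_gram hG, sum_inner]
      simp only [real_inner_smul_left]
      ring
    rw [h6]
    calc |∑ l, c l * inner ℝ (x l) (x j)| ≤ ∑ l, |c l * inner ℝ (x l) (x j)| :=
          Finset.abs_sum_le_sum_abs _ _
      _ ≤ ∑ l : Fin k, ‖gramSchmidt ℝ a i‖ * s ^ 2 := by
          refine Finset.sum_le_sum fun l _ => ?_
          rw [abs_mul, sq]
          have := (abs_real_inner_le_norm (x l) (x j)).trans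
            (mul_le_mul (hx l) (hx j) (norm_nonneg _) hs)
          exact mul_le_mul (h5 l) this (abs_nonneg _) (norm_nonneg _)
      _ = _ := by simp; ring
  have hR : ∀ i, i < j → |inner ℝ (gramSchmidtNormed ℝ a i) (a j)| ≤ k * s ^ 2 := by
    intro i hij
    obtain ⟨c, -, h2, h3, h4⟩ := key i
    have h5 := h4 j
    rw [h2 j hij, sub_zero, gramSchmidt_eq_smul_normed, real_inner_smul_left, norm_smul, hq,
      mul_one, abs_mul, norm_norm, abs_norm] at h5
    exact le_of_mul_le_mul_left h5 (by linarith)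
  have hd : |1 - ‖gramSchmidt ℝ a j‖| ≤ k * s ^ 2 := by
    obtain ⟨c, h1, -, h3, h4⟩ := key j
    have h5 := h4 j
    have h6 : inner ℝ (gramSchmidt ℝ a j) (a j) = ‖gramSchmidt ℝ a j‖ ^ 2 := by
      conv_lhs => rw [gramSchmidt_def'' ℝ a j]
      rw [inner_add_right, real_inner_self_eq_norm_sq, inner_sum]
      rw [Finset.sum_eq_zero, add_zero]
      intro i hi
      rw [real_inner_smul_right, gramSchmidt_orthogonal ℝ a (Finset.mem_Iio.1 hi).ne', mul_zero]
    rw [h6, h1] at h5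
    have h7 := (abs_le.1 h5).2
    rw [abs_sub_comm, abs_of_nonneg (by linarith)]
    set N := ‖gramSchmidt ℝ a j‖
    -- Since N ≥ 1, N(N - 1) ≤ N² - 1, after which N cancels.
    have h8 : N * (N - 1) ≤ N * (k * s ^ 2) := by nlinarith
    exact le_of_mul_le_mul_left h8 (by linarith)
  have e : gramSchmidtNormed ℝ a j - a j = (1 - ‖gramSchmidt ℝ a j‖) • gramSchmidtNormed ℝ a j -
      ∑ i ∈ Finset.Iio j, inner ℝ (gramSchmidtNormed ℝ a i) (a j) • gramSchmidtNormed ℝ a i := by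
    rw [sub_smul, ← gramSchmidt_eq_smul_normed, one_smul]
    conv_rhs => rw [gramSchmidt_eq_sub_normed a j]
    abel
  rw [e]
  calc _ ≤ ‖(1 - ‖gramSchmidt ℝ a j‖) • gramSchmidtNormed ℝ a j‖ + ∑ i ∈ Finset.Iio j,
        ‖inner ℝ (gramSchmidtNormed ℝ a i) (a j) • gramSchmidtNormed ℝ a i‖ :=
        (norm_sub_le _ _).trans (add_le_add_right (norm_sum_le _ _) _)
    _ ≤ k * s ^ 2 + ∑ i ∈ Finset.Iio j, k * s ^ 2 := by
        gcongr with i hi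
        · rw [norm_smul, hq, mul_one]; exact hd
        · rw [norm_smul, hq, mul_one]; exact hR i (Finset.mem_Iio.1 hi)
    _ ≤ _ := by
        rw [Finset.sum_const, nsmul_eq_mul, Fin.card_Iio]
        have : (j : ℝ) ≤ k := by exact_mod_cast j.2.le
        have : (j : ℝ) * (k * s ^ 2) ≤ k * (k * s ^ 2) := by gcongr
        linarith

end gs

section retr
variable {d k : ℕ}

/-- The retraction that maps `(U, ξ)` to the orthonormal factor of `U + ξ`. -/
noncomputable def qrRetr (U ξ : Matrix (Fin d) (Fin k) ℝ) : Matrix (Fin d) (Fin k) ℝ :=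
  Matrix.of fun a j => gramSchmidtNormed ℝ (colE (U + ξ)) j a

theorem colE_qrRetr (U ξ : Matrix (Fin d) (Fin k) ℝ) (j : Fin k) :
    colE (qrRetr U ξ) j = gramSchmidtNormed ℝ (colE (U + ξ)) j := rfl

/-- The cross terms of (U + ξ)ᵀ(U + ξ) are precisely the expression that vanishes for tangent
vectors. -/
theorem gram_add_tangent {U ξ : Matrix (Fin d) (Fin k) ℝ} (hU : Stiefel U) (hξ : Tangent U ξ)
    (i j : Fin k) : inner ℝ (colE (U + ξ) i) (colE (U + ξ) j) =
      (if i = j then 1 else 0) + inner ℝ (colE ξ i) (colE ξ j) := by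
  have h : (U + ξ)ᵀ * (U + ξ) = 1 + ξᵀ * ξ := by
    unfold Stiefel at hU
    unfold Tangent at hξ
    rw [transpose_add, Matrix.add_mul, Matrix.mul_add, Matrix.mul_add, hU]
    calc 1 + Uᵀ * ξ + (ξᵀ * U + ξᵀ * ξ) = 1 + (ξᵀ * U + Uᵀ * ξ) + ξᵀ * ξ := by abel
      _ = _ := by rw [hξ, add_zero]
  rw [inner_colE_eq, inner_colE_eq, h, Matrix.add_apply, Matrix.one_apply]

theorem norm_colE_of_stiefel {U : Matrix (Fin d) (Fin k) ℝ} (hU : Stiefel U) (j : Fin k) :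
    ‖colE U j‖ = 1 := by
  have h : ‖colE U j‖ ^ 2 = 1 := by
    rw [← real_inner_self_eq_norm_sq, inner_colE_eq, show Uᵀ * U = 1 from hU, Matrix.one_apply_eq]
  exact (pow_eq_one_iff_of_nonneg (norm_nonneg _) two_ne_zero).1 h

theorem stiefel_qrRetr {U ξ : Matrix (Fin d) (Fin k) ℝ} (hU : Stiefel U) (hξ : Tangent U ξ) :
    Stiefel (qrRetr U ξ) := by
  have h := gramSchmidtNormed_orthonormal (𝕜 := ℝ)
    (linearIndependent_of_gram (gram_add_tangent hU hξ))
  ext i j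
  rw [← inner_colE_eq, colE_qrRetr, colE_qrRetr, orthonormal_iff_ite.1 h i j, Matrix.one_apply]

/-- The second-order bound holds for all tangent ξ. For ‖ξ‖ ≤ 1 it implies the first-order bound;
for larger ξ it suffices that two Stiefel matrices are at distance at most 2k, column by column. The
summand 1 in L₂ only ensures positivity when k = 0. -/
theorem isRetraction_qrRetr : IsRetraction (qrRetr (d := d) (k := k))
    (1 + 2 * k + k * (k + k * k)) (1 + k * (k + k * k)) := by
  have b₂ : ∀ U ξ : Matrix (Fin d) (Fin k) ℝ, Stiefel U → Tangent U ξ →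
      frobNorm (qrRetr U ξ - (U + ξ)) ≤ k * (k + k * k) * frobNorm ξ ^ 2 := by
    intro U ξ hU hξ
    refine (frobNorm_le_sum_colE _).trans ?_
    calc _ ≤ ∑ j : Fin k, ((k : ℝ) + k * k) * frobNorm ξ ^ 2 := by
          refine Finset.sum_le_sum fun j _ => ?_
          exact norm_gramSchmidtNormed_sub_le (gram_add_tangent hU hξ) (norm_colE_le ξ) j
      _ = _ := by simp; ring
  refine ⟨by positivity, by positivity, fun U ξ => stiefel_qrRetr, fun U ξ hU hξ => ?_,
    fun U ξ hU hξ => (b₂ U ξ hU hξ).trans ?_⟩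
  · have h0 := frobNorm_nonneg ξ
    rcases le_total (frobNorm ξ) 1 with h1 | h1
    · have h2 : frobNorm (qrRetr U ξ - U) ≤ frobNorm (qrRetr U ξ - (U + ξ)) + frobNorm ξ := by
        have := frobNorm_add_le (qrRetr U ξ - (U + ξ)) ξ
        rwa [show qrRetr U ξ - (U + ξ) + ξ = qrRetr U ξ - U by abel] at this
      have h3 := b₂ U ξ hU hξ
      have h4 : frobNorm ξ ^ 2 ≤ frobNorm ξ := by nlinarith
      have h5 : (k * (k + k * k) : ℝ) * frobNorm ξ ^ 2 ≤ k * (k + k * k) * frobNorm ξ := by gcongr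
      have h6 : 0 ≤ (k : ℝ) * frobNorm ξ := by positivity
      linarith
    · have h2 : frobNorm (qrRetr U ξ - U) ≤ 2 * k := by
        refine (frobNorm_le_sum_colE _).trans ?_
        calc _ ≤ ∑ j : Fin k, (2 : ℝ) := by
              refine Finset.sum_le_sum fun j _ => ?_
              have e : colE (qrRetr U ξ - U) j = colE (qrRetr U ξ) j - colE U j := rfl
              rw [e]
              refine (norm_sub_le _ _).trans ?_
              rw [norm_colE_of_stiefel hU, norm_colE_of_stiefel (stiefel_qrRetr hU hξ)]
              norm_num
          _ = _ := by simp; ring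
      have h6 : (2 * k : ℝ) * 1 ≤ 2 * k * frobNorm ξ := by gcongr
      have h7 : 0 ≤ (k * (k + k * k) : ℝ) * frobNorm ξ := by positivity
      linarith
  · have := sq_nonneg (frobNorm ξ)
    linarith

end retr

/-! ### A program for the QR retraction -/

section qrProgram
variable {d k : ℕ}

/-- Stack registers of the retraction subroutine. -/
def retrScr (t : ℕ) : RetrReg d k := .tmp 0 t 0 0

theorem retrScr_injective : Function.Injective (retrScr : ℕ → RetrReg d k) := fun s t h => by
  simpa [retrScr] using h

/-- The entry of `U + ξ`. -/
def qrEntry (a : Fin d) (j : Fin k) : Expr (RetrReg d k) := .reg (.U a j) + .reg (.xi a j)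

/-- The coefficients of column `j` with respect to the previous orthonormal columns. -/
noncomputable def qrCoef (j : Fin k) : List (Instr (RetrReg d k)) :=
  assignAll retrScr (fun i : Fin k => .tmp 1 i 0 0) fun i =>
    if i < j then .sum fun a => .reg (.out a i) * qrEntry a j else .const 0

/-- The component of column `j` orthogonal to the previous columns. -/
noncomputable def qrOrth (j : Fin k) : List (Instr (RetrReg d k)) :=
  assignAll retrScr (fun a : Fin d => .tmp 2 a 0 0) fun a =>
    qrEntry a j - .sum fun i : Fin k =>
      if i < j then .reg (.tmp 1 i 0 0) * .reg (.out a i) else .const 0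

/-- The norm of the orthogonal component. -/
noncomputable def qrNorm : List (Instr (RetrReg d k)) :=
  assignAll retrScr (fun _ : Unit => .tmp 3 0 0 0) fun _ =>
    .sqrt (.sum fun a : Fin d => .reg (.tmp 2 a 0 0) * .reg (.tmp 2 a 0 0))

/-- The normalized column `j`. -/
noncomputable def qrUnit (j : Fin k) : List (Instr (RetrReg d k)) :=
  assignAll retrScr (fun a : Fin d => .out a j) fun a => .reg (.tmp 2 a 0 0) / .reg (.tmp 3 0 0 0)

/-- One step of the orthonormalization. -/
noncomputable def qrColumn (j : Fin k) : List (Instr (RetrReg d k)) :=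
  qrCoef j ++ (qrOrth j ++ (qrNorm ++ qrUnit j))

/-- The orthonormalization of the first `t` columns. -/
noncomputable def qrUpTo : ℕ → List (Instr (RetrReg d k))
  | 0 => []
  | t + 1 => qrUpTo t ++ if h : t < k then qrColumn ⟨t, h⟩ else []

theorem length_qrColumn_le (hd : 1 ≤ d) (hk : 1 ≤ k) (j : Fin k) :
    (qrColumn (d := d) j).length ≤ 30 * (d * k) := by
  have c₁ : ∀ i : Fin k, Expr.cost (if i < j then .sum fun a : Fin d =>
      .reg (.out a i) * qrEntry a j else .const 0 : Expr (RetrReg d k)) ≤ 1 + d * 6 := fun i => by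
    split_ifs <;> simp [qrEntry]
  have c₂ : ∀ (a : Fin d) (i : Fin k), Expr.cost (if i < j then
      .reg (.tmp 1 i 0 0) * .reg (.out a i) else .const 0 : Expr (RetrReg d k)) ≤ 3 := fun a i => by
    split_ifs <;> simp
  have h1 : (qrCoef (d := d) j).length ≤ k * (1 + d * 6 + 1) := by
    rw [qrCoef, length_assignAll]
    exact (Finset.sum_le_sum fun i _ => Nat.add_le_add_right (c₁ i) 1).trans (by simp)
  have h2 : (qrOrth (d := d) j).length ≤ d * (3 + (1 + k * 4) + 1 + 1) := by
    rw [qrOrth, length_assignAll]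
    simp only [Expr.cost_sub, Expr.cost_sum, qrEntry, Expr.cost_add, Expr.cost_reg]
    refine (Finset.sum_le_sum fun a _ => Nat.add_le_add_right (Nat.add_le_add_right
      (Nat.add_le_add_left (Nat.add_le_add_left (Finset.sum_le_sum fun i _ =>
        Nat.add_le_add_right (c₂ a i) 1) _) _) _) _).trans (by simp)
  have h3 : (qrNorm (d := d) (k := k)).length ≤ 1 + d * 4 + 1 + 1 := by
    simp [qrNorm, length_assignAll]
  have h4 : (qrUnit (d := d) j).length ≤ d * (3 + 1) := by
    simp [qrUnit, length_assignAll]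
  have e1 : d ≤ d * k := Nat.le_mul_of_pos_right d hk
  have e2 : k ≤ d * k := Nat.le_mul_of_pos_left k hd
  simp only [qrColumn, List.length_append]
  nlinarith

theorem length_qrUpTo_le (hd : 1 ≤ d) (hk : 1 ≤ k) (t : ℕ) :
    (qrUpTo (d := d) (k := k) t).length ≤ t * (30 * (d * k)) := by
  induction t with
  | zero => simp [qrUpTo]
  | succ t ih =>
    simp only [qrUpTo, List.length_append]
    split_ifs with h
    · have := length_qrColumn_le (d := d) hd hk ⟨t, h⟩
      linarith
    · exact ih.trans (Nat.mul_le_mul_right _ (Nat.le_succ t))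

/-- The code follows `gramSchmidt_eq_sub_normed`, which needs only the normalized earlier columns
already present in the output registers. The final quotient agrees with `gramSchmidtNormed` even for
a zero vector, so no rank condition enters. -/
theorem run_qrColumn (U ξ : Matrix (Fin d) (Fin k) ℝ) (j : Fin k) (M : RetrReg d k → ℝ)
    (hU : ∀ a b, M (.U a b) = U a b) (hξ : ∀ a b, M (.xi a b) = ξ a b)
    (ho : ∀ i, i < j → ∀ a, M (.out a i) = qrRetr U ξ a i) :
    (∀ a, runBlock (qrColumn j) M (.out a j) = qrRetr U ξ a j) ∧
    (∀ a b, runBlock (qrColumn j) M (.U a b) = M (.U a b)) ∧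
    (∀ a b, runBlock (qrColumn j) M (.xi a b) = M (.xi a b)) ∧
    ∀ a i, i ≠ j → runBlock (qrColumn j) M (.out a i) = M (.out a i) := by
  simp only [qrColumn, runBlock_append]
  obtain ⟨v₁, f₁⟩ := run_assignAll (retrScr_injective (d := d) (k := k))
    (dst := fun i : Fin k => .tmp 1 i 0 0)
    (e := fun i => if i < j then .sum fun a => .reg (.out a i) * qrEntry a j else .const 0)
    (fun i i' h => by simpa [Fin.ext_iff] using h) (fun i s => by simp [retrScr])
    (fun i => by split_ifs <;> simp [qrEntry, retrScr]) M
  change (∀ i, runBlock (qrCoef j) M _ = _) at v₁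
  change ∀ r, _ → _ → runBlock (qrCoef j) M _ = _ at f₁
  generalize runBlock (qrCoef j) M = M₁ at *
  obtain ⟨v₂, f₂⟩ := run_assignAll (retrScr_injective (d := d) (k := k))
    (dst := fun a : Fin d => .tmp 2 a 0 0)
    (e := fun a => qrEntry a j - .sum fun i : Fin k =>
      if i < j then .reg (.tmp 1 i 0 0) * .reg (.out a i) else .const 0)
    (fun i i' h => by simpa [Fin.ext_iff] using h) (fun i s => by simp [retrScr])
    (fun a => by
      simp only [Expr.readsOnly_sub, Expr.readsOnly_sum]
      refine ⟨by simp [qrEntry, retrScr], fun i => ?_⟩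
      split_ifs <;> simp [retrScr]) M₁
  change (∀ i, runBlock (qrOrth j) M₁ _ = _) at v₂
  change ∀ r, _ → _ → runBlock (qrOrth j) M₁ _ = _ at f₂
  generalize runBlock (qrOrth j) M₁ = M₂ at *
  obtain ⟨v₃, f₃⟩ := run_assignAll (retrScr_injective (d := d) (k := k))
    (dst := fun _ : Unit => .tmp 3 0 0 0)
    (e := fun _ => .sqrt (.sum fun a : Fin d => .reg (.tmp 2 a 0 0) * .reg (.tmp 2 a 0 0)))
    (fun i i' h => rfl) (fun i s => by simp [retrScr]) (fun a => by simp [retrScr]) M₂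
  change (∀ i, runBlock qrNorm M₂ _ = _) at v₃
  change ∀ r, _ → _ → runBlock qrNorm M₂ _ = _ at f₃
  generalize runBlock qrNorm M₂ = M₃ at *
  obtain ⟨v₄, f₄⟩ := run_assignAll (retrScr_injective (d := d) (k := k))
    (dst := fun a : Fin d => .out a j)
    (e := fun a => .reg (.tmp 2 a 0 0) / .reg (.tmp 3 0 0 0))
    (fun i i' h => by simpa using h) (fun i s => by simp [retrScr])
    (fun a => by simp [retrScr]) M₃
  change (∀ i, runBlock (qrUnit j) M₃ _ = _) at v₄
  change ∀ r, _ → _ → runBlock (qrUnit j) M₃ _ = _ at f₄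
  generalize runBlock (qrUnit j) M₃ = M₄ at *
  have c : ∀ i : Fin k, i < j → M₁ (.tmp 1 i 0 0) =
      inner ℝ (gramSchmidtNormed ℝ (colE (U + ξ)) i) (colE (U + ξ) j) := by
    intro i hi
    rw [v₁ i, if_pos hi, ← colE_qrRetr, inner_colE]
    simp [qrEntry, hU, hξ, ho i hi]
  have g : ∀ a : Fin d, M₂ (.tmp 2 a 0 0) = gramSchmidt ℝ (colE (U + ξ)) j a := by
    intro a
    rw [v₂ a, gramSchmidt_eq_sub_normed, PiLp.sub_apply, WithLp.ofLp_sum, Finset.sum_apply,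
      Expr.eval_sub, Expr.eval_sum]
    congr 1
    · rw [qrEntry, Expr.eval_add, Expr.eval_reg, Expr.eval_reg, f₁ _ (by simp [retrScr]) (by simp),
        f₁ _ (by simp [retrScr]) (by simp), hU, hξ]
      rfl
    · rw [← Finset.filter_gt_eq_Iio, Finset.sum_filter]
      refine Finset.sum_congr rfl fun i _ => ?_
      split_ifs with hi
      · rw [Expr.eval_mul, Expr.eval_reg, Expr.eval_reg, c i hi,
          f₁ _ (by simp [retrScr]) (by simp), ho i hi]
        rfl
      · simp
  have N : M₃ (.tmp 3 0 0 0) = ‖gramSchmidt ℝ (colE (U + ξ)) j‖ := by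
    rw [v₃ (), EuclideanSpace.norm_eq]
    simp only [Expr.eval_sqrt, Expr.eval_sum, Expr.eval_mul, Expr.eval_reg, g]
    congr 1
    refine Finset.sum_congr rfl fun a _ => ?_
    rw [Real.norm_eq_abs, sq_abs, sq]
  refine ⟨fun a => ?_, fun a b => ?_, fun a b => ?_, fun a i hi => ?_⟩
  · rw [v₄ a, Expr.eval_div, Expr.eval_reg, Expr.eval_reg, N, f₃ _ (by simp [retrScr]) (by simp),
      g, qrRetr, Matrix.of_apply, gramSchmidtNormed, div_eq_inv_mul]
    rfl
  all_goals
    rw [f₄ _ (by simp [retrScr]) (by simp [Ne.symm, *]), f₃ _ (by simp [retrScr]) (by simp),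
      f₂ _ (by simp [retrScr]) (by simp), f₁ _ (by simp [retrScr]) (by simp)]

theorem computesRetr_qrUpTo : ComputesRetr (qrUpTo (d := d) (k := k) k) qrRetr := by
  intro U ξ M _ _ hU hξ a b
  suffices H : ∀ t, (∀ a b, runBlock (qrUpTo t) M (.U a b) = U a b) ∧
      (∀ a b, runBlock (qrUpTo t) M (.xi a b) = ξ a b) ∧
      ∀ b : Fin k, (b : ℕ) < t → ∀ a, runBlock (qrUpTo t) M (.out a b) = qrRetr U ξ a b from
    (H k).2.2 b b.2 a
  intro t
  induction t with
  | zero => exact ⟨hU, hξ, fun b hb => absurd hb (Nat.not_lt_zero _)⟩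
  | succ t ih =>
    obtain ⟨h1, h2, h3⟩ := ih
    rw [qrUpTo, runBlock_append]
    split_ifs with ht
    · obtain ⟨k1, k2, k3, k4⟩ := run_qrColumn U ξ ⟨t, ht⟩ _ h1 h2 fun i hi => h3 i hi
      refine ⟨fun a b => by rw [k2, h1], fun a b => by rw [k3, h2], fun b hb a => ?_⟩
      rcases Nat.lt_succ_iff_lt_or_eq.1 hb with hb | hb
      · rw [k4 a b fun h => by simp [h] at hb, h3 b hb]
      · rw [show b = ⟨t, ht⟩ from Fin.ext hb, k1]
    · exact ⟨h1, h2, fun b hb a => h3 b (by have := b.2; omega) a⟩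

theorem exists_retraction (d k : ℕ) (hk : 1 ≤ k) (hkd : k ≤ d) :
    ∃ (Retr : Matrix (Fin d) (Fin k) ℝ → Matrix (Fin d) (Fin k) ℝ → Matrix (Fin d) (Fin k) ℝ)
      (L₁ L₂ : ℝ) (Q : List (Instr (RetrReg d k))),
      IsRetraction Retr L₁ L₂ ∧ ComputesRetr Q Retr ∧
        (Q.length : ℝ) ≤ 30 * ((d : ℝ) * k ^ 2 + k ^ 3) := by
  refine ⟨qrRetr, _, _, qrUpTo k, isRetraction_qrRetr, computesRetr_qrUpTo, ?_⟩
  have h : ((qrUpTo (d := d) (k := k) k).length : ℝ) ≤ k * (30 * (d * k)) := by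
    exact_mod_cast length_qrUpTo_le (hk.trans hkd) hk k
  have : (0 : ℝ) ≤ (k : ℝ) ^ 3 := by positivity
  linarith

end qrProgram

variable {m n d k : ℕ}

/-! ### Tangent projections -/

theorem tangentProj_add (U A B : Matrix (Fin d) (Fin k) ℝ) :
    tangentProj U (A + B) = tangentProj U A + tangentProj U B := by
  simp only [tangentProj, Matrix.mul_add, transpose_add, Matrix.add_mul, smul_add]
  abel

theorem tangentProj_smul (U : Matrix (Fin d) (Fin k) ℝ) (c : ℝ) (A : Matrix (Fin d) (Fin k) ℝ) :
    tangentProj U (c • A) = c • tangentProj U A := by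
  simp only [tangentProj, Matrix.mul_smul, transpose_smul, Matrix.smul_mul, smul_sub,
    ← smul_add]
  rw [smul_comm c]

theorem Tangent.smul {U ξ : Matrix (Fin d) (Fin k) ℝ} (h : Tangent U ξ) (c : ℝ) :
    Tangent U (c • ξ) := by
  unfold Tangent at *
  rw [transpose_smul, Matrix.smul_mul, Matrix.mul_smul, ← smul_add, h, smul_zero]

/-- Used to replace the Euclidean gradient by the Riemannian one in the first-order term along a
tangent step. -/
theorem inner_tangentProj {U ξ : Matrix (Fin d) (Fin k) ℝ} (hξ : Tangent U ξ)
    (Z : Matrix (Fin d) (Fin k) ℝ) :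
    inner ℝ (vecE (tangentProj U Z)) (vecE ξ) = inner ℝ (vecE Z) (vecE ξ) := by
  have h := trace_sub_tangentProj hξ Z
  rw [← inner_vecE_eq_trace, vecE_sub, inner_sub_left] at h
  linarith

theorem frobNorm_tangentProj_le {U : Matrix (Fin d) (Fin k) ℝ} (hU : Stiefel U)
    (Z : Matrix (Fin d) (Fin k) ℝ) : frobNorm (tangentProj U Z) ≤ frobNorm Z := by
  have h := inner_tangentProj (tangent_tangentProj hU Z) Z
  rw [real_inner_self_eq_norm_sq] at h
  have h2 := real_inner_le_norm (vecE Z) (vecE (tangentProj U Z))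
  rw [← h, sq] at h2
  rw [frobNorm_eq, frobNorm_eq]
  rcases (norm_nonneg (vecE (tangentProj U Z))).eq_or_lt with h0 | h0
  · rw [← h0]; exact norm_nonneg _
  · exact le_of_mul_le_mul_right h2 h0

/-! ### Projected costs and their gradients -/

namespace Problem

variable (D : Problem m n d)

/-- The vector `Uᵀ (x^l_i - y_j)`. -/
noncomputable def projVec (U : Matrix (Fin d) (Fin k) ℝ) (l : Fin m) (i j : Fin n) :
    EuclideanSpace ℝ (Fin k) := WithLp.toLp 2 (Uᵀ *ᵥ (D.X l i - D.Y j))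

/-- The Euclidean gradient of the projected cost. -/
noncomputable def costGrad (U : Matrix (Fin d) (Fin k) ℝ) (l : Fin m) (i j : Fin n) :
    Matrix (Fin d) (Fin k) ℝ :=
  Matrix.of fun a b => 2 * (D.X l i a - D.Y j a) * D.projVec U l i j b

/-- The average of the gradients of the projected costs for a family of plans. -/
noncomputable def planGrad (π : Fin m → Fin n → Fin n → ℝ) (U : Matrix (Fin d) (Fin k) ℝ) :
    Matrix (Fin d) (Fin k) ℝ :=
  ∑ l, D.w l • ∑ i, ∑ j, π l i j • D.costGrad U l i j

theorem projCost_eq (U : Matrix (Fin d) (Fin k) ℝ) (l : Fin m) (i j : Fin n) :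
    D.projCost U l i j = ‖D.projVec U l i j‖ ^ 2 := by
  simp [EuclideanSpace.norm_sq_eq, projCost, projVec]

theorem projVec_apply (U : Matrix (Fin d) (Fin k) ℝ) (l : Fin m) (i j : Fin n) (b : Fin k) :
    D.projVec U l i j b = ∑ a, U a b * (D.X l i a - D.Y j a) := rfl

theorem projVec_add (U E : Matrix (Fin d) (Fin k) ℝ) (l : Fin m) (i j : Fin n) :
    D.projVec (U + E) l i j = D.projVec U l i j + D.projVec E l i j := by
  ext b
  simp [projVec_apply, add_mul, Finset.sum_add_distrib]

theorem projVec_smul (c : ℝ) (E : Matrix (Fin d) (Fin k) ℝ) (l : Fin m) (i j : Fin n) :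
    D.projVec (c • E) l i j = c • D.projVec E l i j := by
  ext b
  simp [projVec_apply, Finset.mul_sum, mul_assoc]

theorem inner_costGrad (U E : Matrix (Fin d) (Fin k) ℝ) (l : Fin m) (i j : Fin n) :
    inner ℝ (vecE (D.costGrad U l i j)) (vecE E) =
      2 * inner ℝ (D.projVec U l i j) (D.projVec E l i j) := by
  rw [inner_vecE, Finset.sum_comm, PiLp.inner_apply, Finset.mul_sum]
  refine Finset.sum_congr rfl fun b _ => ?_
  rw [D.projVec_apply E]
  simp only [costGrad, Matrix.of_apply, RCLike.inner_apply, conj_trivial, Finset.sum_mul,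
    Finset.mul_sum]
  exact Finset.sum_congr rfl fun a _ => by ring

theorem projCost_add (U E : Matrix (Fin d) (Fin k) ℝ) (l : Fin m) (i j : Fin n) :
    D.projCost (U + E) l i j = D.projCost U l i j +
      inner ℝ (vecE (D.costGrad U l i j)) (vecE E) + D.projCost E l i j := by
  rw [projCost_eq, projVec_add, norm_add_sq_real, ← projCost_eq, ← projCost_eq, inner_costGrad]

theorem projCost_smul (c : ℝ) (E : Matrix (Fin d) (Fin k) ℝ) (l : Fin m) (i j : Fin n) :
    D.projCost (c • E) l i j = c ^ 2 * D.projCost E l i j := by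
  rw [projCost_eq, projVec_smul, norm_smul, mul_pow, Real.norm_eq_abs, sq_abs, ← projCost_eq]

theorem projCost_nonneg (U : Matrix (Fin d) (Fin k) ℝ) (l : Fin m) (i j : Fin n) :
    0 ≤ D.projCost U l i j := Finset.sum_nonneg fun _ _ => sq_nonneg _

theorem cost_nonneg (l : Fin m) (i j : Fin n) : 0 ≤ D.cost l i j :=
  Finset.sum_nonneg fun _ _ => sq_nonneg _

theorem cost_le_cbar (l : Fin m) (i j : Fin n) : D.cost l i j ≤ D.cbar := by
  refine (le_abs_self _).trans ?_
  refine (le_ciSup (f := fun j => |D.cost l i j|) (Set.finite_range _).bddAbove j).trans ?_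
  refine (le_ciSup (f := fun i => ⨆ j, |D.cost l i j|) (Set.finite_range _).bddAbove i).trans ?_
  exact le_ciSup (f := fun l => ⨆ i, ⨆ j, |D.cost l i j|) (Set.finite_range _).bddAbove l

theorem cbar_nonneg : 0 ≤ D.cbar :=
  Real.iSup_nonneg fun _ => Real.iSup_nonneg fun _ => Real.iSup_nonneg fun _ => abs_nonneg _

theorem projCost_le_frobNorm (E : Matrix (Fin d) (Fin k) ℝ) (l : Fin m) (i j : Fin n) :
    D.projCost E l i j ≤ frobNorm E ^ 2 * D.cost l i j := by
  rw [frobNorm_sq, Finset.sum_comm, Finset.sum_mul]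
  refine Finset.sum_le_sum fun b _ => ?_
  change (∑ a, E a b * (D.X l i a - D.Y j a)) ^ 2 ≤ _ * ∑ a, (D.X l i a - D.Y j a) ^ 2
  exact Finset.sum_mul_sq_le_sq_mul_sq _ _ _

/-- Bessel's inequality for the orthonormal columns of U. -/
theorem projCost_le_cost {U : Matrix (Fin d) (Fin k) ℝ} (hU : Stiefel U) (l : Fin m)
    (i j : Fin n) : D.projCost U l i j ≤ D.cost l i j := by
  have ho : Orthonormal ℝ (colE U) := by
    rw [orthonormal_iff_ite]
    intro b b'
    rw [inner_colE_eq, show Uᵀ * U = 1 from hU, Matrix.one_apply]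
  have h := ho.sum_inner_products_le (s := Finset.univ)
    (WithLp.toLp 2 (D.X l i - D.Y j) : EuclideanSpace ℝ (Fin d))
  rw [EuclideanSpace.norm_sq_eq] at h
  have e : D.projCost U l i j = ∑ b, ‖inner ℝ (colE U b)
      (WithLp.toLp 2 (D.X l i - D.Y j) : EuclideanSpace ℝ (Fin d))‖ ^ 2 := by
    refine Finset.sum_congr rfl fun b _ => ?_
    rw [Real.norm_eq_abs, sq_abs, PiLp.inner_apply]
    congr 1
    change ∑ a, U a b * (D.X l i a - D.Y j a) = _
    exact Finset.sum_congr rfl fun a _ => by simp [colE, mul_comm]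
  rw [e]
  refine h.trans (le_of_eq ?_)
  simp [cost]

theorem projCost_le_cbar {U : Matrix (Fin d) (Fin k) ℝ} (hU : Stiefel U) (l : Fin m)
    (i j : Fin n) : D.projCost U l i j ≤ D.cbar :=
  (D.projCost_le_cost hU l i j).trans (D.cost_le_cbar l i j)

theorem norm_projVec_le {U : Matrix (Fin d) (Fin k) ℝ} (hU : Stiefel U) (l : Fin m)
    (i j : Fin n) : ‖D.projVec U l i j‖ ≤ √D.cbar := by
  refine Real.le_sqrt_of_sq_le ?_
  rw [← projCost_eq]
  exact D.projCost_le_cbar hU l i j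

theorem norm_projVec_le_frobNorm (E : Matrix (Fin d) (Fin k) ℝ) (l : Fin m) (i j : Fin n) :
    ‖D.projVec E l i j‖ ≤ frobNorm E * √D.cbar := by
  refine le_of_sq_le_sq ?_ (mul_nonneg (frobNorm_nonneg E) (Real.sqrt_nonneg _))
  rw [← projCost_eq, mul_pow, Real.sq_sqrt D.cbar_nonneg]
  exact (D.projCost_le_frobNorm E l i j).trans
    (mul_le_mul_of_nonneg_left (D.cost_le_cbar l i j) (sq_nonneg _))

/-- Factor the difference of squared norms: the sum of the norms is at most 2√c̄, and the reverse
triangle inequality bounds their difference by ‖V - U‖√c̄. -/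
theorem abs_projCost_sub_le {U V : Matrix (Fin d) (Fin k) ℝ} (hU : Stiefel U) (hV : Stiefel V)
    (l : Fin m) (i j : Fin n) :
    |D.projCost V l i j - D.projCost U l i j| ≤ 2 * D.cbar * frobNorm (V - U) := by
  have h1 := D.norm_projVec_le hU l i j
  have h2 := D.norm_projVec_le hV l i j
  have h3 := D.norm_projVec_le_frobNorm (V - U) l i j
  have h4 : D.projVec V l i j = D.projVec U l i j + D.projVec (V - U) l i j := by
    rw [← projVec_add, add_sub_cancel]
  have h5 : |‖D.projVec V l i j‖ - ‖D.projVec U l i j‖| ≤ ‖D.projVec (V - U) l i j‖ := by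
    have := abs_norm_sub_norm_le (D.projVec V l i j) (D.projVec U l i j)
    rwa [h4, add_sub_cancel_left, ← h4] at this
  rw [projCost_eq, projCost_eq, sq_sub_sq, abs_mul, abs_of_nonneg (by positivity)]
  calc _ ≤ (√D.cbar + √D.cbar) * (frobNorm (V - U) * √D.cbar) := by
        refine mul_le_mul (add_le_add h2 h1) (h5.trans h3) (abs_nonneg _) (by positivity)
    _ = 2 * (√D.cbar * √D.cbar) * frobNorm (V - U) := by ring
    _ = _ := by rw [Real.mul_self_sqrt D.cbar_nonneg]

theorem frobNorm_costGrad_le {U : Matrix (Fin d) (Fin k) ℝ} (hU : Stiefel U)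
    (l : Fin m) (i j : Fin n) : frobNorm (D.costGrad U l i j) ≤ 2 * D.cbar := by
  refine le_of_sq_le_sq ?_ (mul_nonneg two_pos.le D.cbar_nonneg)
  -- The gradient is the rank-one matrix 2(x - y)(Uᵀ(x - y))ᵀ, so its squared norm factors.
  have e : frobNorm (D.costGrad U l i j) ^ 2 = 4 * D.cost l i j * D.projCost U l i j := by
    rw [frobNorm_sq, projCost_eq, EuclideanSpace.norm_sq_eq, cost, mul_assoc, Finset.sum_mul_sum,
      Finset.mul_sum]
    refine Finset.sum_congr rfl fun a _ => ?_
    rw [Finset.mul_sum]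
    refine Finset.sum_congr rfl fun b _ => ?_
    rw [Real.norm_eq_abs, sq_abs, costGrad, Matrix.of_apply]
    ring
  rw [e]
  have h1 := D.projCost_le_cbar hU l i j
  have h2 := D.cost_le_cbar l i j
  have h3 := D.cost_nonneg l i j
  have h4 := D.projCost_nonneg U l i j
  have h5 := D.cbar_nonneg
  calc 4 * D.cost l i j * D.projCost U l i j ≤ 4 * D.cbar * D.cbar := by gcongr
    _ = _ := by ring

theorem frobNorm_planGrad_le {U : Matrix (Fin d) (Fin k) ℝ} (hU : Stiefel U)
    (hw : ∀ l, 0 ≤ D.w l) (π : Fin m → Fin n → Fin n → ℝ) :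
    frobNorm (D.planGrad π U) ≤ 2 * D.cbar * ∑ l, D.w l * ∑ i, ∑ j, |π l i j| := by
  refine (frobNorm_sum_le _ _).trans ?_
  rw [Finset.mul_sum]
  refine Finset.sum_le_sum fun l _ => ?_
  rw [frobNorm_smul, abs_of_nonneg (hw l), mul_left_comm]
  refine mul_le_mul_of_nonneg_left ?_ (hw l)
  refine (frobNorm_sum_le _ _).trans ?_
  rw [Finset.mul_sum]
  refine Finset.sum_le_sum fun i _ => ?_
  refine (frobNorm_sum_le _ _).trans ?_
  rw [Finset.mul_sum]
  refine Finset.sum_le_sum fun j _ => ?_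
  rw [frobNorm_smul, mul_comm]
  exact mul_le_mul_of_nonneg_right (D.frobNorm_costGrad_le hU l i j) (abs_nonneg _)

theorem planGrad_sub (π π' : Fin m → Fin n → Fin n → ℝ) (U : Matrix (Fin d) (Fin k) ℝ) :
    D.planGrad (π - π') U = D.planGrad π U - D.planGrad π' U := by
  simp only [planGrad, Pi.sub_apply, sub_smul, Finset.sum_sub_distrib, smul_sub]

theorem hasDerivAt_projCost (U E : Matrix (Fin d) (Fin k) ℝ) (l : Fin m) (i j : Fin n) :
    HasDerivAt (fun s : ℝ => D.projCost (U + s • E) l i j)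
      (inner ℝ (vecE (D.costGrad U l i j)) (vecE E)) 0 := by
  have e : (fun s : ℝ => D.projCost (U + s • E) l i j) = fun s : ℝ => D.projCost U l i j +
      s * inner ℝ (vecE (D.costGrad U l i j)) (vecE E) + s ^ 2 * D.projCost E l i j := by
    funext s
    rw [projCost_add, projCost_smul, vecE_smul, real_inner_smul_right]
  rw [e]
  have h1 := ((hasDerivAt_id (0 : ℝ)).mul_const
    (inner ℝ (vecE (D.costGrad U l i j)) (vecE E))).const_add (D.projCost U l i j)
  have h2 := ((hasDerivAt_id (0 : ℝ)).pow 2).mul_const (D.projCost E l i j)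
  simpa using h1.fun_add h2

theorem vecE_sum {ι : Type*} (s : Finset ι) (A : ι → Matrix (Fin d) (Fin k) ℝ) :
    vecE (∑ i ∈ s, A i) = ∑ i ∈ s, vecE (A i) := by
  ext x
  simp [vecE, Matrix.sum_apply]

theorem inner_planGrad (π : Fin m → Fin n → Fin n → ℝ) (U E : Matrix (Fin d) (Fin k) ℝ) :
    inner ℝ (vecE (D.planGrad π U)) (vecE E) =
      ∑ l, D.w l * ∑ i, ∑ j, π l i j * inner ℝ (vecE (D.costGrad U l i j)) (vecE E) := by
  simp only [planGrad, vecE_sum, vecE_smul, sum_inner, real_inner_smul_left]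

theorem hasDerivAt_f (π : Fin m → Fin n → Fin n → ℝ) (U E : Matrix (Fin d) (Fin k) ℝ) :
    HasDerivAt (fun s : ℝ => D.f π (U + s • E)) (inner ℝ (vecE (D.planGrad π U)) (vecE E)) 0 := by
  rw [inner_planGrad]
  unfold f
  refine HasDerivAt.fun_sum fun l _ => HasDerivAt.const_mul _ ?_
  refine HasDerivAt.fun_sum fun i _ => HasDerivAt.fun_sum fun j _ => ?_
  exact (D.hasDerivAt_projCost U E l i j).const_mul _

theorem zeta_pos (η : ℝ) (u v : Fin m → Fin n → ℝ) (U : Matrix (Fin d) (Fin k) ℝ) (l : Fin m)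
    (i j : Fin n) : 0 < D.zeta η u v U l i j := Real.exp_pos _

theorem sum_zeta_pos (hn : 0 < n) (η : ℝ) (u v : Fin m → Fin n → ℝ)
    (U : Matrix (Fin d) (Fin k) ℝ) (l : Fin m) : 0 < ∑ i, ∑ j, D.zeta η u v U l i j := by
  have : Nonempty (Fin n) := ⟨⟨0, hn⟩⟩
  exact Finset.sum_pos (fun i _ => Finset.sum_pos (fun j _ => D.zeta_pos ..)
    Finset.univ_nonempty) Finset.univ_nonempty

/-- Differentiating log ‖ζ‖₁ averages the derivatives of the exponents with the weights `plan`.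
Hence grad g is -1/η times the gradient of f at the current plans, the link between the stopping
test and stationarity. -/
theorem hasDerivAt_g (hn : 0 < n) (η : ℝ) (u v : Fin m → Fin n → ℝ)
    (U E : Matrix (Fin d) (Fin k) ℝ) :
    HasDerivAt (fun s : ℝ => D.g η u v (U + s • E))
      (inner ℝ (vecE (-(1 / η) • D.planGrad (D.plan η u v U) U)) (vecE E)) 0 := by
  rw [vecE_smul, real_inner_smul_left, inner_planGrad, Finset.mul_sum]
  unfold g
  refine HasDerivAt.fun_sum fun l _ => ?_
  rw [mul_left_comm]
  refine HasDerivAt.const_mul _ (HasDerivAt.sub_const _ ?_)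
  have h : HasDerivAt (fun s : ℝ => ∑ i, ∑ j, D.zeta η u v (U + s • E) l i j)
      (∑ i, ∑ j, D.zeta η u v U l i j *
        (-(inner ℝ (vecE (D.costGrad U l i j)) (vecE E)) / η)) 0 := by
    refine HasDerivAt.fun_sum fun i _ => HasDerivAt.fun_sum fun j _ => ?_
    have h1 := (((D.hasDerivAt_projCost U E l i j).neg.div_const η).add_const
      (u l i)).add_const (v l j)
    refine h1.exp.congr_deriv ?_
    simp only [Pi.neg_apply, zero_smul, add_zero]
    rfl
  have h0 : ∑ i, ∑ j, D.zeta η u v (U + (0 : ℝ) • E) l i j ≠ 0 := (D.sum_zeta_pos hn ..).ne'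
  refine (h.log h0).congr_deriv ?_
  rw [zero_smul, add_zero]
  simp only [Finset.sum_div, Finset.mul_sum, plan]
  refine Finset.sum_congr rfl fun i _ => Finset.sum_congr rfl fun j _ => ?_
  ring

theorem inner_vecE_single (A : Matrix (Fin d) (Fin k) ℝ) (a : Fin d) (b : Fin k) :
    inner ℝ (vecE A) (vecE (Matrix.single a b (1 : ℝ))) = A a b := by
  rw [inner_vecE, Finset.sum_eq_single a, Finset.sum_eq_single b]
  · simp
  · intro b' _ hb; simp [hb.symm]
  · simp
  · intro a' _ ha; simp [ha.symm]
  · simp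

theorem eucGrad_f (π : Fin m → Fin n → Fin n → ℝ) (U : Matrix (Fin d) (Fin k) ℝ) :
    eucGrad (fun V => D.f π V) U = D.planGrad π U := by
  ext a b
  rw [eucGrad, Matrix.of_apply, (D.hasDerivAt_f π U _).deriv, inner_vecE_single]

theorem eucGrad_g (hn : 0 < n) (η : ℝ) (u v : Fin m → Fin n → ℝ)
    (U : Matrix (Fin d) (Fin k) ℝ) :
    eucGrad (fun V => D.g η u v V) U = -(1 / η) • D.planGrad (D.plan η u v U) U := by
  ext a b
  rw [eucGrad, Matrix.of_apply, (D.hasDerivAt_g hn η u v U _).deriv, inner_vecE_single]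

end Problem

/-! ### Inequalities for finite distributions -/

section finite
variable {ι : Type*} [Fintype ι]

/-- Hoeffding's lemma for a finite distribution. -/
theorem sum_mul_exp_le {p δ : ι → ℝ} {B : ℝ} (hp : ∀ i, 0 ≤ p i) (hs : ∑ i, p i = 1)
    (hδ : ∀ i, |δ i| ≤ B) :
    ∑ i, p i * Real.exp (δ i) ≤ Real.exp (∑ i, p i * δ i + B ^ 2 / 2) := by
  let _ : MeasurableSpace ι := ⊤
  have hB : 0 ≤ B := by
    rcases isEmpty_or_nonempty ι with h | ⟨⟨i⟩⟩
    · simp at hs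
    · exact (abs_nonneg _).trans (hδ i)
  have hs' : ∑ i, ENNReal.ofReal (p i) = 1 := by
    rw [← ENNReal.ofReal_sum_of_nonneg fun i _ => hp i, hs, ENNReal.ofReal_one]
  set P : PMF ι := PMF.ofFintype (fun i => ENNReal.ofReal (p i)) hs' with hP
  have hint : ∀ f : ι → ℝ, ∫ i, f i ∂P.toMeasure = ∑ i, p i * f i := by
    intro f
    rw [PMF.integral_eq_sum]
    exact Finset.sum_congr rfl fun i _ => by
      rw [hP, PMF.ofFintype_apply, ENNReal.toReal_ofReal (hp i), smul_eq_mul]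
  have h := (ProbabilityTheory.hasSubgaussianMGF_of_mem_Icc (μ := P.toMeasure) (X := δ)
    (a := -B) (b := B) (measurable_from_top.aemeasurable)
    (Filter.Eventually.of_forall fun i => abs_le.1 (hδ i))).mgf_le 1
  rw [ProbabilityTheory.mgf, hint, hint] at h
  -- The interval [-B, B] has half-length B, so the sub-Gaussian bound at parameter 1 is exp(B²/2).
  have e : ((((‖B - -B‖₊ / 2) ^ 2 : NNReal) : ℝ)) * 1 ^ 2 / 2 = B ^ 2 / 2 := by
    push_cast
    rw [Real.norm_eq_abs, sub_neg_eq_add, abs_of_nonneg (by linarith)]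
    ring
  rw [e] at h
  rw [Real.exp_add, mul_comm (Real.exp _)]
  calc ∑ i, p i * Real.exp (δ i)
      = (∑ i, p i * Real.exp (1 * (δ i - ∑ j, p j * δ j))) * Real.exp (∑ j, p j * δ j) := by
        rw [Finset.sum_mul]
        refine Finset.sum_congr rfl fun i _ => ?_
        rw [mul_assoc, ← Real.exp_add]
        ring_nf
    _ ≤ _ := mul_le_mul_of_nonneg_right h (Real.exp_pos _).le

/-- Gibbs' inequality. -/
theorem sum_mul_log_sub_le {p r : ι → ℝ} (hp : ∀ i, 0 ≤ p i) (hr : ∀ i, 0 < r i) :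
    ∑ i, p i * Real.log (r i) - ∑ i, p i * Real.log (p i) ≤ ∑ i, r i - ∑ i, p i := by
  rw [← Finset.sum_sub_distrib, ← Finset.sum_sub_distrib]
  refine Finset.sum_le_sum fun i _ => ?_
  rcases (hp i).eq_or_lt with h | h
  · rw [← h]; simpa using (hr i).le
  · have h1 := Real.log_le_sub_one_of_pos (div_pos (hr i) h)
    rw [Real.log_div (hr i).ne' h.ne'] at h1
    have h2 := mul_le_mul_of_nonneg_left h1 h.le
    rw [mul_sub, mul_sub, mul_div_cancel₀ _ h.ne', mul_one] at h2
    exact h2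

/-- A weak form of Pinsker's inequality. -/
theorem sq_sum_abs_sub_le {p q : ι → ℝ} (hp : ∀ i, 0 < p i) (hq : ∀ i, 0 < q i)
    (hps : ∑ i, p i = 1) (hqs : ∑ i, q i = 1) :
    (∑ i, |p i - q i|) ^ 2 ≤ 4 * ∑ i, p i * (Real.log (p i) - Real.log (q i)) := by
  -- The squared Hellinger distance is at most the relative entropy, from log x ≤ x - 1 at x =
  -- √q/√p.
  have h1 : ∑ i, (√(p i) - √(q i)) ^ 2 ≤ ∑ i, p i * (Real.log (p i) - Real.log (q i)) := by
    have e : ∑ i, (√(p i) - √(q i)) ^ 2 = ∑ i, (2 * p i - 2 * (√(p i) * √(q i))) := by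
      have : ∑ i, (√(p i) - √(q i)) ^ 2 =
          ∑ i, p i + ∑ i, q i - ∑ i, 2 * (√(p i) * √(q i)) := by
        rw [← Finset.sum_add_distrib, ← Finset.sum_sub_distrib]
        refine Finset.sum_congr rfl fun i _ => ?_
        rw [sub_sq, Real.sq_sqrt (hp i).le, Real.sq_sqrt (hq i).le]
        ring
      have h2 : ∑ i, 2 * p i = 2 := by rw [← Finset.mul_sum, hps, mul_one]
      rw [this, Finset.sum_sub_distrib, hps, hqs, h2]
      norm_num
    rw [e]
    refine Finset.sum_le_sum fun i _ => ?_
    have hpi := hp i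
    have s1 := Real.sqrt_pos.2 (hp i)
    have s2 := Real.sqrt_pos.2 (hq i)
    have h := Real.log_le_sub_one_of_pos (div_pos s2 s1)
    rw [Real.log_div s2.ne' s1.ne', Real.log_sqrt (hq i).le, Real.log_sqrt (hp i).le] at h
    have h2 := mul_le_mul_of_nonneg_left h (by linarith : 0 ≤ 2 * p i)
    have h3 : p i * (√(q i) / √(p i)) = √(p i) * √(q i) := by
      rw [mul_div_assoc', div_eq_iff s1.ne']
      nth_rewrite 1 [← Real.mul_self_sqrt (hp i).le]
      ring
    nlinarith
  have h2 : ∑ i, (√(p i) + √(q i)) ^ 2 ≤ 4 := by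
    calc _ ≤ ∑ i, (2 * p i + 2 * q i) := by
          refine Finset.sum_le_sum fun i _ => ?_
          have e1 := Real.sq_sqrt (hp i).le
          have e2 := Real.sq_sqrt (hq i).le
          nlinarith [sq_nonneg (√(p i) - √(q i))]
      _ = _ := by
        rw [Finset.sum_add_distrib, ← Finset.mul_sum, ← Finset.mul_sum, hps, hqs]
        norm_num
  -- This factorization prepares Cauchy–Schwarz, where the second factor contributes the constant 4.
  have h3 : ∑ i, |p i - q i| = ∑ i, |√(p i) - √(q i)| * (√(p i) + √(q i)) := by
    refine Finset.sum_congr rfl fun i _ => ?_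
    rw [← abs_of_nonneg (by positivity : 0 ≤ √(p i) + √(q i)), ← abs_mul]
    congr 1
    nlinarith [Real.sq_sqrt (hp i).le, Real.sq_sqrt (hq i).le]
  rw [h3]
  calc _ ≤ (∑ i, |√(p i) - √(q i)| ^ 2) * ∑ i, (√(p i) + √(q i)) ^ 2 :=
        Finset.sum_mul_sq_le_sq_mul_sq _ _ _
    _ ≤ (∑ i, (√(p i) - √(q i)) ^ 2) * 4 := by
        simp only [sq_abs]
        exact mul_le_mul_of_nonneg_left h2 (Finset.sum_nonneg fun _ _ => sq_nonneg _)
    _ ≤ _ := by linarith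

/-- The square of a weighted mean is at most the weighted mean of the squares. -/
theorem sq_sum_mul_le {w x : ι → ℝ} (hw : ∀ i, 0 ≤ w i) (hs : ∑ i, w i = 1) :
    (∑ i, w i * x i) ^ 2 ≤ ∑ i, w i * x i ^ 2 := by
  have h := Finset.sum_mul_sq_le_sq_mul_sq Finset.univ (fun i => √(w i)) fun i => √(w i) * x i
  simp only [← mul_assoc, mul_pow, Real.mul_self_sqrt (hw _), Real.sq_sqrt (hw _), hs,
    one_mul] at h
  exact h

end finite

/-! ### Rounding -/

/-- The rows already have sums p, so the first scaling is trivial. Column scaling lowers each column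
sum r_j to min(q_j, r_j), removing total mass σ; the rank-one term restores the missing row and
column sums and adds mass σ. Since r and q have equal mass, 2σ = Σ |r_j - q_j|. -/
theorem roundPlan_spec {n : ℕ} {π : Fin n → Fin n → ℝ} {p q : Fin n → ℝ}
    (hπ : ∀ i j, 0 ≤ π i j) (hp : ∀ i, 0 < p i) (hrow : ∀ i, ∑ j, π i j = p i)
    (hcol : ∀ j, 0 < ∑ i, π i j) (hq : ∀ j, 0 < q j) (hps : ∑ i, p i = 1) (hqs : ∑ j, q j = 1) :
    (∀ i j, 0 ≤ roundPlan π p q i j) ∧ (∀ i, ∑ j, roundPlan π p q i j = p i) ∧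
      (∀ j, ∑ i, roundPlan π p q i j = q j) ∧
      ∑ i, ∑ j, |roundPlan π p q i j - π i j| ≤ ∑ j, |∑ i, π i j - q j| := by
  set r : Fin n → ℝ := fun j => ∑ i, π i j with hr
  set π₂ : Fin n → Fin n → ℝ := fun i j => π i j * min (q j / r j) 1 with hπ₂
  set ep : Fin n → ℝ := fun i => p i - ∑ j, π₂ i j with hep
  set eq : Fin n → ℝ := fun j => q j - ∑ i, π₂ i j with heq
  have hround : ∀ i j, roundPlan π p q i j = π₂ i j + ep i * eq j / ∑ i', |ep i'| := by
    intro i j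
    have : ∀ i, min (p i / p i) 1 = 1 := fun i => by rw [div_self (hp i).ne', min_self]
    simp only [roundPlan, hrow, this, one_mul, hπ₂, hep, heq, hr]
  have hβ0 : ∀ j, 0 ≤ min (q j / r j) 1 := fun j =>
    le_min (div_pos (hq j) (hcol j)).le zero_le_one
  have h20 : ∀ i j, 0 ≤ π₂ i j := fun i j => mul_nonneg (hπ i j) (hβ0 j)
  have h2π : ∀ i j, π₂ i j ≤ π i j := fun i j => mul_le_of_le_one_right (hπ i j) (min_le_right _ _)
  have hc2 : ∀ j, ∑ i, π₂ i j = min (q j) (r j) := by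
    intro j
    rw [hπ₂, ← Finset.sum_mul, mul_min_of_nonneg _ _ (hcol j).le, mul_one,
      mul_div_cancel₀ _ (hcol j).ne']
  have hep0 : ∀ i, 0 ≤ ep i := fun i => by
    rw [hep, sub_nonneg, ← hrow i]
    exact Finset.sum_le_sum fun j _ => h2π i j
  have heq0 : ∀ j, 0 ≤ eq j := fun j => by
    rw [heq, sub_nonneg, hc2]
    exact min_le_left _ _
  set σ := ∑ i, ep i with hσ
  have hσ' : ∑ i', |ep i'| = σ := Finset.sum_congr rfl fun i _ => abs_of_nonneg (hep0 i)
  have hσq : ∑ j, eq j = σ := by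
    rw [hσ, hep, heq, Finset.sum_sub_distrib, Finset.sum_sub_distrib, hps, hqs, Finset.sum_comm]
  simp only [hround, hσ']
  have hσ0 : 0 ≤ σ := Finset.sum_nonneg fun i _ => hep0 i
  have ht : ∀ i, ∑ j, ep i * eq j / σ = ep i := by
    intro i
    rw [← Finset.sum_div, ← Finset.mul_sum, hσq]
    -- If σ = 0, all errors vanish and division by zero yields 0, which matches returning π₂
    -- unchanged.
    rcases hσ0.eq_or_lt with h | h
    · have := (Finset.sum_eq_zero_iff_of_nonneg fun i _ => hep0 i).1 h.symm i (Finset.mem_univ i)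
      rw [this, zero_mul, zero_div]
    · exact mul_div_cancel_right₀ _ h.ne'
  have ht' : ∀ j, ∑ i, ep i * eq j / σ = eq j := by
    intro j
    rw [← Finset.sum_div, ← Finset.sum_mul, ← hσ]
    rcases hσ0.eq_or_lt with h | h
    · have := (Finset.sum_eq_zero_iff_of_nonneg fun i _ => heq0 i).1 (hσq.trans h.symm) j
        (Finset.mem_univ j)
      rw [this, mul_zero, zero_div]
    · exact mul_div_cancel_left₀ _ h.ne'
  have hnn : ∀ i j, 0 ≤ ep i * eq j / σ := fun i j =>
    div_nonneg (mul_nonneg (hep0 i) (heq0 j)) hσ0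
  refine ⟨fun i j => add_nonneg (h20 i j) (hnn i j), fun i => ?_, fun j => ?_, ?_⟩
  · rw [Finset.sum_add_distrib, ht, hep]; ring
  · rw [Finset.sum_add_distrib, ht', heq]; ring
  · calc _ ≤ ∑ i, ∑ j, ((π i j - π₂ i j) + ep i * eq j / σ) := by
          refine Finset.sum_le_sum fun i _ => Finset.sum_le_sum fun j _ => ?_
          have h1 := h2π i j
          have h2 := hnn i j
          exact abs_le.2 ⟨by linarith, by linarith⟩
      _ = ∑ i, (ep i + ep i) := by
          refine Finset.sum_congr rfl fun i _ => ?_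
          rw [Finset.sum_add_distrib, ht, Finset.sum_sub_distrib, hrow]
      _ = ∑ j, (eq j + eq j) + (∑ j, r j - ∑ j, q j) := by
          rw [Finset.sum_add_distrib, Finset.sum_add_distrib, hσq, hqs, hr, Finset.sum_comm]
          simp only [hrow, hps, sub_self, add_zero, hσ]
      _ = ∑ j, |r j - q j| := by
          rw [← Finset.sum_sub_distrib, ← Finset.sum_add_distrib]
          refine Finset.sum_congr rfl fun j _ => ?_
          rw [heq]
          simp only [hc2]
          rcases le_total (q j) (r j) with h | h
          · rw [min_eq_left h, abs_of_nonneg (by linarith)]; ring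
          · rw [min_eq_right h, abs_of_nonpos (by linarith)]; ring
      _ ≤ _ := le_rfl

/-! ### Block updates -/

namespace Problem

variable {D : Problem m n d}

theorem Valid.w_nonneg (hv : D.Valid) (l : Fin m) : 0 ≤ D.w l := (hv.w_pos l).le

theorem Valid.w_le_one (hv : D.Valid) (l : Fin m) : D.w l ≤ 1 := by
  rw [← hv.w_sum]
  exact Finset.single_le_sum (fun l _ => hv.w_nonneg l) (Finset.mem_univ l)

theorem wmin_le (D : Problem m n d) (l : Fin m) : D.wmin ≤ D.w l :=
  ciInf_le (Set.finite_range _).bddBelow l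

theorem Valid.wmin_pos (hv : D.Valid) (hm : 0 < m) : 0 < D.wmin := by
  have : Nonempty (Fin m) := ⟨⟨0, hm⟩⟩
  obtain ⟨l, hl⟩ := exists_eq_ciInf_of_finite (f := D.w)
  rw [wmin, ← hl]
  exact hv.w_pos l

theorem Valid.wmin_le_one (hv : D.Valid) (hm : 0 < m) : D.wmin ≤ 1 :=
  (D.wmin_le ⟨0, hm⟩).trans (hv.w_le_one _)

section step
variable (hv : D.Valid) (hn : 0 < n) (η : ℝ) (s : Iterate m n d k)
include hv hn

theorem zeta_uNext (l : Fin m) (i j : Fin n) :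
    D.zeta η (D.uNext η s) s.v s.U l i j =
      D.zeta η s.u s.v s.U l i j * (D.p l i / ∑ j, D.zeta η s.u s.v s.U l i j) := by
  have : Nonempty (Fin n) := ⟨⟨0, hn⟩⟩
  have h : 0 < D.p l i / ∑ j, D.zeta η s.u s.v s.U l i j :=
    div_pos (hv.p_pos l i) (Finset.sum_pos (fun j _ => D.zeta_pos ..) Finset.univ_nonempty)
  simp only [zeta, uNext] at h ⊢
  conv_rhs => rw [← Real.exp_log h]
  rw [← Real.exp_add]
  ring_nf

theorem sum_zeta_uNext_row (l : Fin m) (i : Fin n) :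
    ∑ j, D.zeta η (D.uNext η s) s.v s.U l i j = D.p l i := by
  have : Nonempty (Fin n) := ⟨⟨0, hn⟩⟩
  have h : 0 < ∑ j, D.zeta η s.u s.v s.U l i j :=
    Finset.sum_pos (fun j _ => D.zeta_pos ..) Finset.univ_nonempty
  simp only [zeta_uNext hv hn]
  rw [← Finset.sum_mul, mul_div_cancel₀ _ h.ne']

theorem sum_zeta_uNext (l : Fin m) : ∑ i, ∑ j, D.zeta η (D.uNext η s) s.v s.U l i j = 1 := by
  simp only [sum_zeta_uNext_row hv hn, hv.p_sum]

theorem plan_uNext : D.plan η (D.uNext η s) s.v s.U = D.zeta η (D.uNext η s) s.v s.U := by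
  funext l i j
  rw [plan, sum_zeta_uNext hv hn, div_one]

omit hv in
theorem qCol_pos (l : Fin m) (j : Fin n) : 0 < D.qCol η s l j := by
  have : Nonempty (Fin n) := ⟨⟨0, hn⟩⟩
  exact Finset.sum_pos (fun i _ => D.zeta_pos ..) Finset.univ_nonempty

theorem sum_qCol (l : Fin m) : ∑ j, D.qCol η s l j = 1 := by
  simp only [qCol]
  rw [Finset.sum_comm, sum_zeta_uNext hv hn]

theorem sum_qBar : ∑ j, D.qBar η s j = 1 := by
  simp only [qBar]
  rw [Finset.sum_comm]
  simp only [← Finset.mul_sum, sum_qCol hv hn, mul_one, hv.w_sum]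

theorem qBar_pos (j : Fin n) : 0 < D.qBar η s j := by
  have : Nonempty (Fin m) := by
    by_contra h
    rw [not_nonempty_iff] at h
    simpa using hv.w_sum
  exact Finset.sum_pos (fun l _ => mul_pos (hv.w_pos l) (qCol_pos hn ..)) Finset.univ_nonempty

omit hv hn in
theorem qGeo_pos (j : Fin n) : 0 < D.qGeo η s j := Real.exp_pos _

omit hv in
theorem qGeo_eq_prod (j : Fin n) : D.qGeo η s j = ∏ l, D.qCol η s l j ^ D.w l := by
  rw [qGeo, Real.exp_sum]
  refine Finset.prod_congr rfl fun l _ => ?_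
  rw [Real.rpow_def_of_pos (qCol_pos hn ..), mul_comm]

theorem qGeo_le_qBar (j : Fin n) : D.qGeo η s j ≤ D.qBar η s j := by
  rw [qGeo_eq_prod hn]
  exact Real.geom_mean_le_arith_mean_weighted _ _ _ (fun l _ => hv.w_nonneg l) hv.w_sum
    fun l _ => (qCol_pos hn ..).le

omit hv in
theorem sum_qGeo_pos : 0 < ∑ j, D.qGeo η s j := by
  have : Nonempty (Fin n) := ⟨⟨0, hn⟩⟩
  exact Finset.sum_pos (fun j _ => qGeo_pos ..) Finset.univ_nonempty

theorem sum_qGeo_le_one : ∑ j, D.qGeo η s j ≤ 1 := by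
  rw [← sum_qBar hv hn η s]
  exact Finset.sum_le_sum fun j _ => qGeo_le_qBar hv hn η s j

omit hv in
theorem zeta_vNext (l : Fin m) (i j : Fin n) :
    D.zeta η (D.uNext η s) (D.vNext η s) s.U l i j =
      D.zeta η (D.uNext η s) s.v s.U l i j * (D.qGeo η s j / D.qCol η s l j) := by
  have h : 0 < D.qGeo η s j / D.qCol η s l j := div_pos (qGeo_pos ..) (qCol_pos hn ..)
  simp only [zeta, vNext]
  conv_rhs => rw [← Real.exp_log h]
  rw [← Real.exp_add]
  ring_nf

omit hv in
theorem sum_zeta_vNext (l : Fin m) :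
    ∑ i, ∑ j, D.zeta η (D.uNext η s) (D.vNext η s) s.U l i j = ∑ j, D.qGeo η s j := by
  rw [Finset.sum_comm]
  refine Finset.sum_congr rfl fun j _ => ?_
  simp only [zeta_vNext hn]
  rw [← Finset.sum_mul]
  exact mul_div_cancel₀ _ (qCol_pos hn η s l j).ne'

theorem g_uNext : D.g η (D.uNext η s) s.v s.U = -∑ l, D.w l * ∑ i, D.uNext η s l i * D.p l i := by
  simp only [g, sum_zeta_uNext hv hn, Real.log_one, zero_sub, mul_neg, Finset.sum_neg_distrib]

/-- The v-update gives every ζ^l the same column sums, hence the same mass Q, and it does not touch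
the linear term in u. As the mass before was 1, only log Q is gained. -/
theorem g_vNext : D.g η (D.uNext η s) (D.vNext η s) s.U =
    D.g η (D.uNext η s) s.v s.U + Real.log (∑ j, D.qGeo η s j) := by
  rw [g_uNext hv hn]
  simp only [g, sum_zeta_vNext hn, mul_sub, Finset.sum_sub_distrib]
  rw [← Finset.sum_mul, hv.w_sum]
  ring

/-- The decrease is a weighted sum of relative entropies of p^l with respect to the normalized row
sums, nonnegative by Gibbs' inequality. -/
theorem g_uNext_le : D.g η (D.uNext η s) s.v s.U ≤ D.g η s.u s.v s.U := by
  rw [g_uNext hv hn, g, ← Finset.sum_neg_distrib]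
  refine Finset.sum_le_sum fun l _ => ?_
  rw [← mul_neg]
  refine mul_le_mul_of_nonneg_left ?_ (hv.w_nonneg l)
  have : Nonempty (Fin n) := ⟨⟨0, hn⟩⟩
  have hr : ∀ i, 0 < ∑ j, D.zeta η s.u s.v s.U l i j := fun i =>
    Finset.sum_pos (fun j _ => D.zeta_pos ..) Finset.univ_nonempty
  set Z := ∑ i, ∑ j, D.zeta η s.u s.v s.U l i j with hZ
  have hZ0 : 0 < Z := D.sum_zeta_pos hn ..
  have h := sum_mul_log_sub_le (p := D.p l) (r := fun i => (∑ j, D.zeta η s.u s.v s.U l i j) / Z)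
    (fun i => (hv.p_pos l i).le) fun i => div_pos (hr i) hZ0
  rw [← Finset.sum_div, ← hZ, div_self hZ0.ne', hv.p_sum, sub_self] at h
  have e : ∑ i, D.uNext η s l i * D.p l i = ∑ i, s.u l i * D.p l i +
      (∑ i, D.p l i * Real.log (D.p l i) -
        ∑ i, D.p l i * Real.log ((∑ j, D.zeta η s.u s.v s.U l i j) / Z)) - Real.log Z := by
    have e1 : Real.log Z = ∑ i, D.p l i * Real.log Z := by
      rw [← Finset.sum_mul, hv.p_sum, one_mul]
    rw [e1, ← Finset.sum_sub_distrib, ← Finset.sum_add_distrib, ← Finset.sum_sub_distrib]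
    refine Finset.sum_congr rfl fun i _ => ?_
    rw [uNext, Real.log_div (hv.p_pos l i).ne' (hr i).ne', Real.log_div (hr i).ne' hZ0.ne']
    ring
  rw [e]
  linarith

/-- The weighted distance of the column sums from their mean. -/
noncomputable def colGap (D : Problem m n d) (η : ℝ) (s : Iterate m n d k) : ℝ :=
  ∑ l, D.w l * ∑ j, |D.qCol η s l j - D.qBar η s j|

omit hn in
theorem colGap_nonneg : 0 ≤ D.colGap η s :=
  Finset.sum_nonneg fun l _ => mul_nonneg (hv.w_nonneg l)
    (Finset.sum_nonneg fun _ _ => abs_nonneg _)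

/-- Let r = q_{t+1}/Q. Because log q_{t+1} is the weighted mean of the log q^l, the weighted mean of
the relative entropies of r with respect to q^l is exactly -log Q. Pinsker and Jensen then bound the
mean distance from r to the q^l. -/
theorem log_sum_qGeo_le : Real.log (∑ j, D.qGeo η s j) ≤ -(D.colGap η s ^ 2 / 16) := by
  set Q := ∑ j, D.qGeo η s j with hQ
  have hQ0 : 0 < Q := sum_qGeo_pos hn η s
  set r : Fin n → ℝ := fun j => D.qGeo η s j / Q with hr
  have hr0 : ∀ j, 0 < r j := fun j => div_pos (qGeo_pos ..) hQ0
  have hrs : ∑ j, r j = 1 := by rw [hr, ← Finset.sum_div, ← hQ, div_self hQ0.ne']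
  set e : Fin m → ℝ := fun l => ∑ j, |r j - D.qCol η s l j| with he
  have h1 : ∀ l, e l ^ 2 ≤ 4 * ∑ j, r j * (Real.log (r j) - Real.log (D.qCol η s l j)) := fun l =>
    sq_sum_abs_sub_le hr0 (fun j => qCol_pos hn ..) hrs (sum_qCol hv hn η s l)
  have h2 : ∑ l, D.w l * ∑ j, r j * (Real.log (r j) - Real.log (D.qCol η s l j)) =
      -Real.log Q := by
    have e1 : ∀ j, ∑ l, D.w l * (r j * (Real.log (r j) - Real.log (D.qCol η s l j))) =
        r j * -Real.log Q := by
      intro j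
      have : Real.log (r j) = ∑ l, D.w l * Real.log (D.qCol η s l j) - Real.log Q := by
        rw [hr, Real.log_div (qGeo_pos ..).ne' hQ0.ne', qGeo, Real.log_exp]
      have e2 : ∑ l, D.w l * (r j * (Real.log (r j) - Real.log (D.qCol η s l j))) =
          r j * ((∑ l, D.w l) * Real.log (r j) - ∑ l, D.w l * Real.log (D.qCol η s l j)) := by
        rw [Finset.sum_mul, ← Finset.sum_sub_distrib, Finset.mul_sum]
        exact Finset.sum_congr rfl fun l _ => by ring
      rw [e2, hv.w_sum, this]
      ring
    simp only [Finset.mul_sum]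
    rw [Finset.sum_comm]
    simp only [e1]
    rw [← Finset.sum_mul, hrs, one_mul]
  have h3 : ∑ l, D.w l * e l ^ 2 ≤ 4 * -Real.log Q := by
    rw [← h2, Finset.mul_sum]
    refine Finset.sum_le_sum fun l _ => ?_
    rw [mul_left_comm]
    exact mul_le_mul_of_nonneg_left (h1 l) (hv.w_nonneg l)
  have h4 := (sq_sum_mul_le (x := e) hv.w_nonneg hv.w_sum).trans h3
  -- Passing from the centre r to the mean q̄ at most doubles the distance, which turns the Pinsker
  -- constant 4 into 16.
  have h5 : D.colGap η s ≤ 2 * ∑ l, D.w l * e l := by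
    have a1 : ∑ j, |r j - D.qBar η s j| ≤ ∑ l, D.w l * e l := by
      calc _ ≤ ∑ j, ∑ l, D.w l * |r j - D.qCol η s l j| := by
            refine Finset.sum_le_sum fun j _ => ?_
            have : r j - D.qBar η s j = ∑ l, D.w l * (r j - D.qCol η s l j) := by
              simp only [mul_sub, Finset.sum_sub_distrib, qBar]
              rw [← Finset.sum_mul, hv.w_sum, one_mul]
            rw [this]
            refine (Finset.abs_sum_le_sum_abs _ _).trans (Finset.sum_le_sum fun l _ => ?_)
            rw [abs_mul, abs_of_nonneg (hv.w_nonneg l)]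
        _ = _ := by
            rw [Finset.sum_comm]
            simp only [he, Finset.mul_sum]
    calc D.colGap η s ≤ ∑ l, D.w l * (e l + ∑ j, |r j - D.qBar η s j|) := by
          refine Finset.sum_le_sum fun l _ => mul_le_mul_of_nonneg_left ?_ (hv.w_nonneg l)
          rw [he, ← Finset.sum_add_distrib]
          refine Finset.sum_le_sum fun j _ => ?_
          rw [abs_sub_comm (r j)]
          exact abs_sub_le _ _ _
      _ = ∑ l, D.w l * e l + ∑ j, |r j - D.qBar η s j| := by
          simp only [mul_add, Finset.sum_add_distrib]
          rw [← Finset.sum_mul, hv.w_sum, one_mul]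
      _ ≤ _ := by linarith
  have h6 := colGap_nonneg hv η s
  nlinarith

end step

/-! ### The gradient step -/

section gradient
variable (hv : D.Valid) (hn : 0 < n) {η : ℝ} (hη : 0 < η) (u v : Fin m → Fin n → ℝ)
  {U V : Matrix (Fin d) (Fin k) ℝ}
include hn

theorem plan_nonneg (U : Matrix (Fin d) (Fin k) ℝ) (l : Fin m) (i j : Fin n) :
    0 ≤ D.plan η u v U l i j := (div_pos (D.zeta_pos ..) (D.sum_zeta_pos hn ..)).le

theorem sum_plan (U : Matrix (Fin d) (Fin k) ℝ) (l : Fin m) :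
    ∑ i, ∑ j, D.plan η u v U l i j = 1 := by
  simp only [plan, ← Finset.sum_div]
  exact div_self (D.sum_zeta_pos hn ..).ne'

include hv hη

/-- The quotient of the masses of ζ at V and at U is a mean of exp δ under the current plan.
Hoeffding's lemma with |δ| ≤ 2c̄‖V - U‖/η gives the quadratic term. In the linear term, the
second-order part of the projected cost is nonnegative and enters with a minus sign, so it is
dropped. -/
theorem g_le_add (hU : Stiefel U) (hV : Stiefel V) :
    D.g η u v V ≤ D.g η u v U +
      inner ℝ (vecE (-(1 / η) • D.planGrad (D.plan η u v U) U)) (vecE (V - U)) +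
      2 * D.cbar ^ 2 / η ^ 2 * frobNorm (V - U) ^ 2 := by
  have hl : ∀ l, Real.log (∑ i, ∑ j, D.zeta η u v V l i j) ≤
      Real.log (∑ i, ∑ j, D.zeta η u v U l i j) +
      -(1 / η) * ∑ i, ∑ j, D.plan η u v U l i j *
        inner ℝ (vecE (D.costGrad U l i j)) (vecE (V - U)) +
      2 * D.cbar ^ 2 / η ^ 2 * frobNorm (V - U) ^ 2 := by
    intro l
    set δ : Fin n × Fin n → ℝ := fun x =>
      -(D.projCost V l x.1 x.2 - D.projCost U l x.1 x.2) / η with hδ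
    have hB : ∀ x, |δ x| ≤ 2 * D.cbar * frobNorm (V - U) / η := fun x => by
      rw [hδ, abs_div, abs_neg, abs_of_pos hη]
      exact div_le_div_of_nonneg_right (D.abs_projCost_sub_le hU hV l x.1 x.2) hη.le
    have h := sum_mul_exp_le (p := fun x : Fin n × Fin n => D.plan η u v U l x.1 x.2)
      (fun x => plan_nonneg hn u v U l x.1 x.2)
      (by rw [Fintype.sum_prod_type]; exact sum_plan hn u v U l) hB
    rw [Fintype.sum_prod_type, Fintype.sum_prod_type] at h
    have hZ := D.sum_zeta_pos hn η u v U l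
    have e1 : ∑ i, ∑ j, D.plan η u v U l i j * Real.exp (δ (i, j)) =
        (∑ i, ∑ j, D.zeta η u v V l i j) / ∑ i, ∑ j, D.zeta η u v U l i j := by
      simp only [Finset.sum_div]
      refine Finset.sum_congr rfl fun i _ => Finset.sum_congr rfl fun j _ => ?_
      rw [plan, div_mul_eq_mul_div]
      congr 1
      simp only [zeta, hδ]
      rw [← Real.exp_add]
      congr 1
      ring
    rw [e1] at h
    have h2 := Real.log_le_log (div_pos (D.sum_zeta_pos hn η u v V l) hZ) h
    rw [Real.log_exp, Real.log_div (D.sum_zeta_pos hn η u v V l).ne' hZ.ne'] at h2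
    have h3 : ∑ i, ∑ j, D.plan η u v U l i j * δ (i, j) ≤ -(1 / η) *
        ∑ i, ∑ j, D.plan η u v U l i j * inner ℝ (vecE (D.costGrad U l i j)) (vecE (V - U)) := by
      rw [Finset.mul_sum]
      refine Finset.sum_le_sum fun i _ => ?_
      rw [Finset.mul_sum]
      refine Finset.sum_le_sum fun j _ => ?_
      have e2 := D.projCost_add U (V - U) l i j
      rw [add_sub_cancel] at e2
      have e3 := D.projCost_nonneg (V - U) l i j
      rw [mul_left_comm]
      refine mul_le_mul_of_nonneg_left ?_ (plan_nonneg hn u v U l i j)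
      simp only [hδ]
      rw [e2, div_le_iff₀ hη]
      have : -(1 / η) * inner ℝ (vecE (D.costGrad U l i j)) (vecE (V - U)) * η =
          -inner ℝ (vecE (D.costGrad U l i j)) (vecE (V - U)) := by
        field_simp
      rw [this]
      linarith
    have e4 : (2 * D.cbar * frobNorm (V - U) / η) ^ 2 / 2 =
        2 * D.cbar ^ 2 / η ^ 2 * frobNorm (V - U) ^ 2 := by
      field_simp
    rw [e4] at h2
    linarith
  have hc : 2 * D.cbar ^ 2 / η ^ 2 * frobNorm (V - U) ^ 2 =
      ∑ l, D.w l * (2 * D.cbar ^ 2 / η ^ 2 * frobNorm (V - U) ^ 2) := by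
    rw [← Finset.sum_mul, hv.w_sum, one_mul]
  rw [hc, vecE_smul, real_inner_smul_left, inner_planGrad, Finset.mul_sum, g, g,
    ← Finset.sum_add_distrib, ← Finset.sum_add_distrib]
  refine Finset.sum_le_sum fun l _ => ?_
  rw [mul_left_comm, ← mul_add, ← mul_add]
  refine mul_le_mul_of_nonneg_left ?_ (hv.w_nonneg l)
  linarith [hl l]

theorem frobNorm_grad_le (hU : Stiefel U) :
    frobNorm (-(1 / η) • D.planGrad (D.plan η u v U) U) ≤ 2 * D.cbar / η := by
  have h := D.frobNorm_planGrad_le hU hv.w_nonneg (D.plan η u v U)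
  simp only [abs_of_nonneg (plan_nonneg hn u v U _ _ _), sum_plan hn, mul_one, hv.w_sum] at h
  rw [frobNorm_smul, abs_neg, abs_of_pos (by positivity), one_div, inv_mul_eq_div]
  exact div_le_div_of_nonneg_right h hη.le

/-- Write V - U as the tangent step -τG plus a remainder. The step contributes -τ‖G‖²; the remainder
is paired with a gradient of norm at most 2c̄/η and controlled by L₂; the quadratic term is
controlled by L₁. The choice of τ makes these errors at most half the gain. -/
theorem g_retr_le {Retr : Matrix (Fin d) (Fin k) ℝ → Matrix (Fin d) (Fin k) ℝ →
    Matrix (Fin d) (Fin k) ℝ} {L₁ L₂ : ℝ} (hR : IsRetraction Retr L₁ L₂) (hU : Stiefel U)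
    (hc : 0 < D.cbar) {τ : ℝ} (hτ : τ = 1 / (4 * L₂ * D.cbar / η +
      (2 * D.cbar / η + 4 * D.cbar ^ 2 / η ^ 2) * L₁ ^ 2)) :
    D.g η u v (Retr U (-τ • riemGrad (fun V => D.g η u v V) U)) ≤
      D.g η u v U - τ / 2 * frobNorm (riemGrad (fun V => D.g η u v V) U) ^ 2 := by
  have h1 := hR.L₁_pos
  have h2 := hR.L₂_pos
  set Z := -(1 / η) • D.planGrad (D.plan η u v U) U with hZ
  have hG : riemGrad (fun V => D.g η u v V) U = tangentProj U Z := by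
    rw [riemGrad, D.eucGrad_g hn]
  rw [hG]
  set G := tangentProj U Z with hGd
  have hGt : Tangent U G := tangent_tangentProj hU Z
  have hξ : Tangent U (-τ • G) := hGt.smul _
  have hτ0 : 0 < τ := by rw [hτ]; positivity
  set V := Retr U (-τ • G) with hV
  have hVS : Stiefel V := hR.mem _ _ hU hξ
  have a1 := g_le_add hv hn hη u v hU hVS
  have b1 : frobNorm (V - U) ≤ L₁ * (τ * frobNorm G) := by
    have := hR.bound₁ _ _ hU hξ
    rwa [frobNorm_smul, abs_neg, abs_of_pos hτ0] at this
  have b2 : frobNorm (V - (U + -τ • G)) ≤ L₂ * (τ * frobNorm G) ^ 2 := by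
    have := hR.bound₂ _ _ hU hξ
    rwa [frobNorm_smul, abs_neg, abs_of_pos hτ0] at this
  have a2 : inner ℝ (vecE Z) (vecE (V - U)) ≤
      -τ * frobNorm G ^ 2 + 2 * D.cbar / η * (L₂ * (τ * frobNorm G) ^ 2) := by
    have e : V - U = -τ • G + (V - (U + -τ • G)) := by abel
    rw [e, vecE_add, inner_add_right, vecE_smul (-τ) G, real_inner_smul_right,
      ← inner_tangentProj hGt Z, ← hGd, real_inner_self_eq_norm_sq, ← frobNorm_eq]
    refine add_le_add_right ((real_inner_le_norm _ _).trans ?_) _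
    rw [← frobNorm_eq, ← frobNorm_eq]
    exact mul_le_mul (frobNorm_grad_le hv hn hη u v hU) b2 (frobNorm_nonneg _) (by positivity)
  have a3 : frobNorm (V - U) ^ 2 ≤ (L₁ * (τ * frobNorm G)) ^ 2 :=
    pow_le_pow_left₀ (frobNorm_nonneg _) b1 2
  have a4 : 2 * D.cbar ^ 2 / η ^ 2 * frobNorm (V - U) ^ 2 ≤
      2 * D.cbar ^ 2 / η ^ 2 * (L₁ * (τ * frobNorm G)) ^ 2 :=
    mul_le_mul_of_nonneg_left a3 (by positivity)
  set A := 4 * L₂ * D.cbar / η + (2 * D.cbar / η + 4 * D.cbar ^ 2 / η ^ 2) * L₁ ^ 2 with hA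
  have hA0 : 0 < A := by positivity
  have hτA : τ * A = 1 := by rw [hτ]; exact one_div_mul_cancel hA0.ne'
  have e5 : 2 * D.cbar / η * (L₂ * (τ * frobNorm G) ^ 2) +
      2 * D.cbar ^ 2 / η ^ 2 * (L₁ * (τ * frobNorm G)) ^ 2 ≤
      τ / 2 * frobNorm G ^ 2 := by
    -- The part 2c̄/η of ρ is slack here; only 4c̄²/η² is used.
    have e6 : 2 * D.cbar / η * L₂ + 2 * D.cbar ^ 2 / η ^ 2 * L₁ ^ 2 ≤ A / 2 := by
      have : 0 ≤ D.cbar / η * L₁ ^ 2 := by positivity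
      have e7 : A / 2 = 2 * D.cbar / η * L₂ + 2 * D.cbar ^ 2 / η ^ 2 * L₁ ^ 2 +
          D.cbar / η * L₁ ^ 2 := by rw [hA]; ring
      linarith
    calc _ = (2 * D.cbar / η * L₂ + 2 * D.cbar ^ 2 / η ^ 2 * L₁ ^ 2) *
          (τ * frobNorm G) ^ 2 := by ring
      _ ≤ A / 2 * (τ * frobNorm G) ^ 2 := mul_le_mul_of_nonneg_right e6 (sq_nonneg _)
      _ = (τ * A) * (τ / 2 * frobNorm G ^ 2) := by ring
      _ = _ := by rw [hτA, one_mul]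
  linarith

end gradient

end Problem

namespace Problem

variable {D : Problem m n d}

/-! ### Invariants of the iteration -/

/-- The properties of the iterates that the analysis uses. -/
structure Inv (D : Problem m n d) (η : ℝ) (s : Iterate m n d k) : Prop where
  stiefel : Stiefel s.U
  sum_v : ∀ j, ∑ l, D.w l * s.v l j = 0
  range_v : ∀ l j j', s.v l j - s.v l j' ≤ 2 * D.cbar / η

section inv
variable (hv : D.Valid) (hn : 0 < n) {η : ℝ} (hη : 0 < η) (s : Iterate m n d k)
include hv hn

theorem sum_vNext (hs : D.Inv η s) (j : Fin n) : ∑ l, D.w l * D.vNext η s l j = 0 := by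
  have h : ∀ l, D.w l * D.vNext η s l j = D.w l * s.v l j +
      D.w l * Real.log (D.qGeo η s j) - D.w l * Real.log (D.qCol η s l j) := fun l => by
    rw [vNext, Real.log_div (qGeo_pos ..).ne' (qCol_pos hn ..).ne']
    ring
  simp only [h, Finset.sum_sub_distrib, Finset.sum_add_distrib]
  rw [hs.sum_v, ← Finset.sum_mul, hv.w_sum, qGeo, Real.log_exp]
  ring

include hη

/-- As the weighted sum of the v^l is zero, v_{t+1}^l equals Σ ω log K - log K_l, in which the old v
has cancelled. Each log K oscillates by at most c̄/η, because the projected costs lie in [0, c̄].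
The bound therefore does not grow with t. -/
theorem range_vNext (hs : D.Inv η s) (l : Fin m) (j j' : Fin n) :
    D.vNext η s l j - D.vNext η s l j' ≤ 2 * D.cbar / η := by
  have : Nonempty (Fin n) := ⟨⟨0, hn⟩⟩
  set K : Fin m → Fin n → ℝ := fun l j =>
    ∑ i, Real.exp (-(D.projCost s.U l i j) / η + D.uNext η s l i) with hK
  have hK0 : ∀ l j, 0 < K l j := fun l j =>
    Finset.sum_pos (fun i _ => Real.exp_pos _) Finset.univ_nonempty
  have hq : ∀ l j, Real.log (D.qCol η s l j) = s.v l j + Real.log (K l j) := by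
    intro l j
    have e : D.qCol η s l j = Real.exp (s.v l j) * K l j := by
      rw [qCol, hK, Finset.mul_sum]
      refine Finset.sum_congr rfl fun i _ => ?_
      rw [zeta, ← Real.exp_add]
      ring_nf
    rw [e, Real.log_mul (Real.exp_pos _).ne' (hK0 l j).ne', Real.log_exp]
  have hg : ∀ j, Real.log (D.qGeo η s j) = ∑ l, D.w l * Real.log (K l j) := by
    intro j
    rw [qGeo, Real.log_exp]
    simp only [hq, mul_add, Finset.sum_add_distrib]
    rw [hs.sum_v, zero_add]
  have hvn : ∀ j, D.vNext η s l j = ∑ l', D.w l' * Real.log (K l' j) - Real.log (K l j) := by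
    intro j
    rw [vNext, Real.log_div (qGeo_pos ..).ne' (qCol_pos hn ..).ne', hq, hg]
    ring
  have hb : ∀ l j j', Real.log (K l j) - Real.log (K l j') ≤ D.cbar / η := by
    intro l j j'
    have h1 : K l j ≤ Real.exp (D.cbar / η) * K l j' := by
      rw [hK, Finset.mul_sum]
      refine Finset.sum_le_sum fun i _ => ?_
      rw [← Real.exp_add]
      refine Real.exp_le_exp.2 ?_
      have h2 := D.projCost_nonneg s.U l i j
      have h3 := D.projCost_le_cbar hs.stiefel l i j'
      have h4 : -(D.projCost s.U l i j) / η ≤ D.cbar / η + -(D.projCost s.U l i j') / η := by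
        rw [← add_div]
        exact div_le_div_of_nonneg_right (by linarith) hη.le
      linarith
    have h2 := Real.log_le_log (hK0 l j) h1
    rw [Real.log_mul (Real.exp_pos _).ne' (hK0 l j').ne', Real.log_exp] at h2
    linarith
  rw [hvn, hvn]
  have h1 : ∑ l', D.w l' * Real.log (K l' j) - ∑ l', D.w l' * Real.log (K l' j') ≤
      D.cbar / η := by
    rw [← Finset.sum_sub_distrib]
    calc _ ≤ ∑ l', D.w l' * (D.cbar / η) := by
          refine Finset.sum_le_sum fun l' _ => ?_
          rw [← mul_sub]
          exact mul_le_mul_of_nonneg_left (hb l' j j') (hv.w_nonneg l')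
      _ = _ := by rw [← Finset.sum_mul, hv.w_sum, one_mul]
  have h2 := hb l j' j
  have h3 : 2 * D.cbar / η = D.cbar / η + D.cbar / η := by ring
  linarith

omit hη in
/-- The minimal value over the first dual variables. -/
theorem g_uNext_eq : D.g η (D.uNext η s) s.v s.U = ∑ l, D.w l * ∑ i, D.p l i *
    (Real.log (∑ j, Real.exp (-(D.projCost s.U l i j) / η + s.v l j)) - Real.log (D.p l i)) := by
  have : Nonempty (Fin n) := ⟨⟨0, hn⟩⟩
  rw [g_uNext hv hn, ← Finset.sum_neg_distrib]
  refine Finset.sum_congr rfl fun l _ => ?_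
  rw [← mul_neg, ← Finset.sum_neg_distrib]
  congr 1
  refine Finset.sum_congr rfl fun i _ => ?_
  set κ := ∑ j, Real.exp (-(D.projCost s.U l i j) / η + s.v l j) with hκ
  have hκ0 : 0 < κ := Finset.sum_pos (fun i _ => Real.exp_pos _) Finset.univ_nonempty
  have e : ∑ j, D.zeta η s.u s.v s.U l i j = Real.exp (s.u l i) * κ := by
    rw [hκ, Finset.mul_sum]
    refine Finset.sum_congr rfl fun j _ => ?_
    rw [zeta, ← Real.exp_add]
    ring_nf
  rw [uNext, e, Real.log_div (hv.p_pos l i).ne' (mul_pos (Real.exp_pos _) hκ0).ne',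
    Real.log_mul (Real.exp_pos _).ne' hκ0.ne', Real.log_exp]
  ring

/-- The part of the dual objective that does not depend on the iterate. -/
noncomputable def entropyTerm (D : Problem m n d) : ℝ :=
  ∑ l, D.w l * ∑ i, D.p l i * -Real.log (D.p l i)

omit hη hn in
theorem sum_mul_le_of_log_le {κ : Fin m → Fin n → ℝ} {b : Fin m → ℝ}
    (h : ∀ l i, κ l i ≤ b l) :
    ∑ l, D.w l * ∑ i, D.p l i * (κ l i - Real.log (D.p l i)) ≤
      ∑ l, D.w l * b l + D.entropyTerm := by
  rw [entropyTerm, ← Finset.sum_add_distrib]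
  refine Finset.sum_le_sum fun l _ => ?_
  rw [← mul_add]
  refine mul_le_mul_of_nonneg_left ?_ (hv.w_nonneg l)
  have e : b l = ∑ i, D.p l i * b l := by rw [← Finset.sum_mul, hv.p_sum, one_mul]
  rw [e, ← Finset.sum_add_distrib]
  refine Finset.sum_le_sum fun i _ => ?_
  rw [← mul_add]
  exact mul_le_mul_of_nonneg_left (by linarith [h l i]) (hv.p_pos l i).le

omit hη hn in
theorem le_sum_mul_of_le_log {κ : Fin m → Fin n → ℝ} {b : Fin m → ℝ}
    (h : ∀ l i, b l ≤ κ l i) :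
    ∑ l, D.w l * b l + D.entropyTerm ≤
      ∑ l, D.w l * ∑ i, D.p l i * (κ l i - Real.log (D.p l i)) := by
  rw [entropyTerm, ← Finset.sum_add_distrib]
  refine Finset.sum_le_sum fun l _ => ?_
  rw [← mul_add]
  refine mul_le_mul_of_nonneg_left ?_ (hv.w_nonneg l)
  have e : b l = ∑ i, D.p l i * b l := by rw [← Finset.sum_mul, hv.p_sum, one_mul]
  rw [e, ← Finset.sum_add_distrib]
  refine Finset.sum_le_sum fun i _ => ?_
  rw [← mul_add]
  exact mul_le_mul_of_nonneg_left (by linarith [h l i]) (hv.p_pos l i).le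

/-- All n exponentials are compared with the one at a fixed j₀, using the oscillation of v. The
values v^l_{j₀} then disappear by the weighted-sum condition, and u is absent from the closed form,
so the initial u may be arbitrary. -/
theorem g_uNext_upper (hs : D.Inv η s) :
    D.g η (D.uNext η s) s.v s.U ≤ D.entropyTerm + Real.log n + 2 * D.cbar / η := by
  have : Nonempty (Fin n) := ⟨⟨0, hn⟩⟩
  set j₀ : Fin n := ⟨0, hn⟩
  rw [g_uNext_eq hv hn]
  refine (sum_mul_le_of_log_le hv (b := fun l => Real.log n + (s.v l j₀ + 2 * D.cbar / η))
    fun l i => ?_).trans ?_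
  · have h : ∑ j, Real.exp (-(D.projCost s.U l i j) / η + s.v l j) ≤
        n * Real.exp (s.v l j₀ + 2 * D.cbar / η) := by
      calc _ ≤ ∑ j : Fin n, Real.exp (s.v l j₀ + 2 * D.cbar / η) := by
            refine Finset.sum_le_sum fun j _ => Real.exp_le_exp.2 ?_
            have h1 := hs.range_v l j j₀
            have h2 : -(D.projCost s.U l i j) / η ≤ 0 :=
              div_nonpos_of_nonpos_of_nonneg (by linarith [D.projCost_nonneg s.U l i j]) hη.le
            linarith
        _ = _ := by simp
    have h2 := Real.log_le_log
      (Finset.sum_pos (fun j _ => Real.exp_pos _) Finset.univ_nonempty) h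
    rwa [Real.log_mul (by exact_mod_cast hn.ne') (Real.exp_pos _).ne', Real.log_exp] at h2
  · simp only [mul_add, Finset.sum_add_distrib]
    rw [hs.sum_v, ← Finset.sum_mul, ← Finset.sum_mul, hv.w_sum]
    linarith

/-- A single summand j₀ is kept; again the weighted sum removes v^l_{j₀}. -/
theorem g_uNext_lower (hs : D.Inv η s) :
    D.entropyTerm - D.cbar / η ≤ D.g η (D.uNext η s) s.v s.U := by
  set j₀ : Fin n := ⟨0, hn⟩
  rw [g_uNext_eq hv hn]
  refine le_trans ?_ (le_sum_mul_of_le_log hv (b := fun l => -D.cbar / η + s.v l j₀)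
    fun l i => ?_)
  · simp only [mul_add, Finset.sum_add_distrib]
    rw [hs.sum_v, ← Finset.sum_mul, hv.w_sum]
    linarith [neg_div η D.cbar]
  · have h : Real.exp (-D.cbar / η + s.v l j₀) ≤
        ∑ j, Real.exp (-(D.projCost s.U l i j) / η + s.v l j) := by
      refine le_trans (Real.exp_le_exp.2 ?_) (Finset.single_le_sum
        (f := fun j => Real.exp (-(D.projCost s.U l i j) / η + s.v l j))
        (fun j _ => (Real.exp_pos _).le) (Finset.mem_univ j₀))
      refine add_le_add_left (div_le_div_of_nonneg_right ?_ hη.le) _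
      linarith [D.projCost_le_cbar hs.stiefel l i j₀]
    have h2 := Real.log_le_log (Real.exp_pos _) h
    rwa [Real.log_exp] at h2

end inv

/-! ### Stationarity of the output -/

section stationary
variable (hv : D.Valid) (hn : 0 < n) {η : ℝ} (hη : 0 < η) (s : Iterate m n d k)
include hv hn

/-- Each q^l_j is at least q̄_j - S_j/ω, where S_j is the weighted deviation in column j and ω the
smallest weight. A geometric mean inherits a positive lower bound; a nonpositive one is trivial. -/
theorem one_sub_sum_qGeo_le (hm : 0 < m) :
    1 - ∑ j, D.qGeo η s j ≤ D.colGap η s / D.wmin := by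
  have hw0 := hv.wmin_pos hm
  rw [← sum_qBar hv hn η s, ← Finset.sum_sub_distrib]
  have e : D.colGap η s / D.wmin =
      ∑ j, (∑ l, D.w l * |D.qCol η s l j - D.qBar η s j|) / D.wmin := by
    rw [colGap, ← Finset.sum_div, Finset.sum_comm]
    simp only [Finset.mul_sum]
  rw [e]
  refine Finset.sum_le_sum fun j _ => ?_
  set S := ∑ l, D.w l * |D.qCol η s l j - D.qBar η s j| with hS
  have h1 : ∀ l, D.qBar η s j - S / D.wmin ≤ D.qCol η s l j := by
    intro l
    have h2 : D.w l * |D.qCol η s l j - D.qBar η s j| ≤ S :=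
      Finset.single_le_sum (f := fun l => D.w l * |D.qCol η s l j - D.qBar η s j|)
        (fun l _ => mul_nonneg (hv.w_nonneg l) (abs_nonneg _)) (Finset.mem_univ l)
    have h3 : |D.qCol η s l j - D.qBar η s j| ≤ S / D.wmin := by
      rw [le_div_iff₀ hw0, mul_comm]
      exact (mul_le_mul_of_nonneg_right (D.wmin_le l) (abs_nonneg _)).trans h2
    linarith [(abs_le.1 h3).1]
  rcases le_or_gt (D.qBar η s j - S / D.wmin) 0 with hb | hb
  · linarith [qGeo_pos (D := D) η s j]
  · have h2 : D.qBar η s j - S / D.wmin ≤ D.qGeo η s j := by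
      rw [qGeo, ← Real.log_le_iff_le_exp hb]
      calc _ = ∑ l, D.w l * Real.log (D.qBar η s j - S / D.wmin) := by
            rw [← Finset.sum_mul, hv.w_sum, one_mul]
        _ ≤ _ := Finset.sum_le_sum fun l _ =>
            mul_le_mul_of_nonneg_left (Real.log_le_log hb (h1 l)) (hv.w_nonneg l)
    linarith

/-- The plans after the update of the second dual variables are close to those before it. -/
theorem sum_abs_plan_sub_le (hm : 0 < m) :
    ∑ l, D.w l * ∑ i, ∑ j, |D.zeta η (D.uNext η s) s.v s.U l i j -
      D.plan η (D.uNext η s) (D.vNext η s) s.U l i j| ≤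
      D.colGap η s + 2 * (D.colGap η s / D.wmin) := by
  set Q := ∑ j, D.qGeo η s j with hQ
  have hQ0 : 0 < Q := sum_qGeo_pos hn η s
  have hQ1 : Q ≤ 1 := sum_qGeo_le_one hv hn η s
  have hl : ∀ l, ∑ i, ∑ j, |D.zeta η (D.uNext η s) s.v s.U l i j -
      D.plan η (D.uNext η s) (D.vNext η s) s.U l i j| ≤
      ∑ j, |D.qCol η s l j - D.qBar η s j| + 2 * (1 - Q) := by
    intro l
    rw [Finset.sum_comm]
    -- The v-update and the normalization multiply whole columns by constants, so the ℓ¹ distance is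
    -- that of the column sums.
    have e1 : ∀ j, ∑ i, |D.zeta η (D.uNext η s) s.v s.U l i j -
        D.plan η (D.uNext η s) (D.vNext η s) s.U l i j| =
        |D.qCol η s l j - D.qGeo η s j / Q| := by
      intro j
      have hq := qCol_pos (D := D) hn η s l j
      have e2 : ∀ i, D.zeta η (D.uNext η s) s.v s.U l i j -
          D.plan η (D.uNext η s) (D.vNext η s) s.U l i j =
          D.zeta η (D.uNext η s) s.v s.U l i j *
            (1 - D.qGeo η s j / D.qCol η s l j / Q) := by
        intro i
        rw [plan, sum_zeta_vNext hn, zeta_vNext hn, ← hQ]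
        ring
      simp only [e2, abs_mul, abs_of_pos (D.zeta_pos ..)]
      rw [← Finset.sum_mul]
      change D.qCol η s l j * _ = _
      nth_rewrite 1 [← abs_of_pos hq]
      rw [← abs_mul]
      congr 1
      field_simp
    simp only [e1]
    calc _ ≤ ∑ j, (|D.qCol η s l j - D.qBar η s j| + (D.qBar η s j - D.qGeo η s j) +
          (D.qGeo η s j / Q - D.qGeo η s j)) := by
          refine Finset.sum_le_sum fun j _ => ?_
          have h1 := qGeo_le_qBar hv hn η s j
          have h2 : D.qGeo η s j ≤ D.qGeo η s j / Q := by
            rw [le_div_iff₀ hQ0]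
            exact mul_le_of_le_one_right (qGeo_pos ..).le hQ1
          have h3 := abs_le.1 (le_refl |D.qCol η s l j - D.qBar η s j|)
          exact abs_le.2 ⟨by linarith, by linarith⟩
      _ = _ := by
          rw [Finset.sum_add_distrib, Finset.sum_add_distrib, Finset.sum_sub_distrib,
            Finset.sum_sub_distrib, ← Finset.sum_div, ← hQ, div_self hQ0.ne', sum_qBar hv hn]
          ring
  calc _ ≤ ∑ l, D.w l * (∑ j, |D.qCol η s l j - D.qBar η s j| + 2 * (1 - Q)) :=
        Finset.sum_le_sum fun l _ => mul_le_mul_of_nonneg_left (hl l) (hv.w_nonneg l)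
    _ = D.colGap η s + 2 * (1 - Q) := by
        simp only [mul_add, Finset.sum_add_distrib]
        rw [← Finset.sum_mul, hv.w_sum, one_mul, colGap]
    _ ≤ _ := by linarith [one_sub_sum_qGeo_le hv hn (η := η) s hm]

theorem rounded_spec (l : Fin m) :
    let R := roundPlan (D.plan η (D.uNext η s) s.v s.U l) (D.p l) (D.qBar η s)
    (∀ i j, 0 ≤ R i j) ∧ (∀ i, ∑ j, R i j = D.p l i) ∧ (∀ j, ∑ i, R i j = D.qBar η s j) ∧
      ∑ i, ∑ j, |R i j - D.zeta η (D.uNext η s) s.v s.U l i j| ≤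
        ∑ j, |D.qCol η s l j - D.qBar η s j| := by
  rw [plan_uNext hv hn]
  exact roundPlan_spec (fun i j => (D.zeta_pos ..).le) (hv.p_pos l)
    (sum_zeta_uNext_row hv hn η s l) (qCol_pos hn η s l) (qBar_pos hv hn η s) (hv.p_sum l)
    (sum_qBar hv hn η s)

theorem feasible_rounded : D.Feasible fun l =>
    roundPlan (D.plan η (D.uNext η s) s.v s.U l) (D.p l) (D.qBar η s) :=
  ⟨fun l => (rounded_spec hv hn s l).1, fun l => (rounded_spec hv hn s l).2.1,
    fun l l' j => ((rounded_spec hv hn s l).2.2.1 j).trans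
      ((rounded_spec hv hn s l').2.2.1 j).symm⟩

theorem sum_abs_rounded_sub_le :
    ∑ l, D.w l * ∑ i, ∑ j, |roundPlan (D.plan η (D.uNext η s) s.v s.U l) (D.p l) (D.qBar η s) i j -
      D.zeta η (D.uNext η s) s.v s.U l i j| ≤ D.colGap η s :=
  Finset.sum_le_sum fun l _ =>
    mul_le_mul_of_nonneg_left (rounded_spec hv hn s l).2.2.2 (hv.w_nonneg l)

theorem f_rounded_sub_le (hU : Stiefel s.U) :
    D.f (fun l => roundPlan (D.plan η (D.uNext η s) s.v s.U l) (D.p l) (D.qBar η s)) s.U -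
      D.f (D.zeta η (D.uNext η s) s.v s.U) s.U ≤ D.cbar * D.colGap η s := by
  refine le_trans ?_ (mul_le_mul_of_nonneg_left (sum_abs_rounded_sub_le hv hn (η := η) s)
    D.cbar_nonneg)
  rw [f, f, ← Finset.sum_sub_distrib, Finset.mul_sum]
  refine Finset.sum_le_sum fun l _ => ?_
  rw [← mul_sub, mul_left_comm]
  refine mul_le_mul_of_nonneg_left ?_ (hv.w_nonneg l)
  rw [← Finset.sum_sub_distrib, Finset.mul_sum]
  refine Finset.sum_le_sum fun i _ => ?_
  rw [← Finset.sum_sub_distrib, Finset.mul_sum]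
  refine Finset.sum_le_sum fun j _ => ?_
  rw [← sub_mul, mul_comm]
  have h1 := D.projCost_nonneg s.U l i j
  exact (mul_le_mul_of_nonneg_left (le_abs_self _) h1).trans
    (mul_le_mul_of_nonneg_right (D.projCost_le_cbar hU l i j) (abs_nonneg _))

include hη

/-- Express the cost as η(u + v - log ζ). The u-part cancels because the row sums agree. In the
v-part any common column marginal is annihilated by Σ ω v = 0, leaving only the deviation from q̄.
The entropy part is at most 2 log n: π against ζ by Gibbs' inequality, ζ against the uniform
distribution on n² points. -/
theorem f_zeta_sub_le (hm : 0 < m) (hs : D.Inv η s) {π : Fin m → Fin n → Fin n → ℝ}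
    (hπ : D.Feasible π) :
    D.f (D.zeta η (D.uNext η s) s.v s.U) s.U - D.f π s.U ≤
      2 * D.cbar * D.colGap η s + η * (2 * Real.log n) := by
  obtain ⟨p0, prow, pcol⟩ := hπ
  have hn0 : (0 : ℝ) < n := by exact_mod_cast hn
  set ζ := D.zeta η (D.uNext η s) s.v s.U with hζ
  have hζ0 : ∀ l i j, 0 < ζ l i j := fun l i j => D.zeta_pos ..
  set j₀ : Fin n := ⟨0, hn⟩
  set l₀ : Fin m := ⟨0, hm⟩
  have hC : ∀ l i j, D.projCost s.U l i j =
      η * (D.uNext η s l i + s.v l j - Real.log (ζ l i j)) := by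
    intro l i j
    rw [hζ, zeta, Real.log_exp]
    field_simp
    ring
  have hps : ∀ l, ∑ i, ∑ j, π l i j = 1 := fun l => by simp only [prow, hv.p_sum]
  have hp1 : ∀ l i j, π l i j ≤ 1 := fun l i j => by
    rw [← hps l]
    exact (Finset.single_le_sum (fun j _ => p0 l i j) (Finset.mem_univ j)).trans
      (Finset.single_le_sum (f := fun i => ∑ j, π l i j)
        (fun i _ => Finset.sum_nonneg fun j _ => p0 l i j) (Finset.mem_univ i))
  have hent : ∀ l, ∑ i, ∑ j, π l i j * Real.log (ζ l i j) ≤ 0 := by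
    intro l
    have h := sum_mul_log_sub_le (p := fun x : Fin n × Fin n => π l x.1 x.2)
      (r := fun x => ζ l x.1 x.2) (fun x => p0 l x.1 x.2) fun x => hζ0 l x.1 x.2
    simp only [Fintype.sum_prod_type] at h
    rw [hps, hζ, sum_zeta_uNext hv hn, sub_self, ← hζ] at h
    have h2 : ∑ i, ∑ j, π l i j * Real.log (π l i j) ≤ 0 :=
      Finset.sum_nonpos fun i _ => Finset.sum_nonpos fun j _ =>
        mul_nonpos_of_nonneg_of_nonpos (p0 l i j) (Real.log_nonpos (p0 l i j) (hp1 l i j))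
    linarith
  have hent2 : ∀ l, -∑ i, ∑ j, ζ l i j * Real.log (ζ l i j) ≤ 2 * Real.log n := by
    intro l
    have h := sum_mul_log_sub_le (p := fun x : Fin n × Fin n => ζ l x.1 x.2)
      (r := fun _ => 1 / ((n : ℝ) * n)) (fun x => (hζ0 l x.1 x.2).le) fun x => by positivity
    simp only [Fintype.sum_prod_type, ← Finset.sum_mul] at h
    rw [hζ, sum_zeta_uNext hv hn, ← hζ, one_mul, one_div, Real.log_inv,
      Real.log_mul hn0.ne' hn0.ne'] at h
    simp only [Finset.sum_const, Finset.card_univ, Fintype.card_fin, nsmul_eq_mul] at h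
    have e : (n : ℝ) * (n * ((n : ℝ) * n)⁻¹) - 1 = 0 := by field_simp; ring
    rw [e] at h
    linarith
  have hu : ∀ l, ∑ i, ∑ j, (ζ l i j - π l i j) * D.uNext η s l i = 0 := by
    intro l
    refine Finset.sum_eq_zero fun i _ => ?_
    rw [← Finset.sum_mul, Finset.sum_sub_distrib, prow, hζ, sum_zeta_uNext_row hv hn, sub_self,
      zero_mul]
  have hvv : ∀ l, ∑ i, ∑ j, (ζ l i j - π l i j) * s.v l j =
      ∑ j, (D.qCol η s l j - D.qBar η s j) * s.v l j + (∑ j, s.v l j * D.qBar η s j -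
        ∑ j, s.v l j * ∑ i, π l₀ i j) := by
    intro l
    rw [Finset.sum_comm, ← Finset.sum_sub_distrib, ← Finset.sum_add_distrib]
    refine Finset.sum_congr rfl fun j _ => ?_
    rw [← Finset.sum_mul, Finset.sum_sub_distrib, pcol l l₀ j, hζ]
    change (D.qCol η s l j - _) * _ = _
    ring
  have hzero : ∀ q : Fin n → ℝ, ∑ l, D.w l * ∑ j, s.v l j * q j = 0 := by
    intro q
    simp only [Finset.mul_sum]
    rw [Finset.sum_comm]
    refine Finset.sum_eq_zero fun j _ => ?_
    simp only [← mul_assoc]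
    rw [← Finset.sum_mul, hs.sum_v, zero_mul]
  have hr : ∀ l, η * ∑ j, (D.qCol η s l j - D.qBar η s j) * s.v l j ≤
      2 * D.cbar * ∑ j, |D.qCol η s l j - D.qBar η s j| := by
    intro l
    -- Both column vectors have mass 1, so v may be shifted by a constant and only its oscillation
    -- matters.
    have e : ∑ j, (D.qCol η s l j - D.qBar η s j) * s.v l j =
        ∑ j, (D.qCol η s l j - D.qBar η s j) * (s.v l j - s.v l j₀) := by
      simp only [mul_sub, Finset.sum_sub_distrib]
      rw [← Finset.sum_mul, Finset.sum_sub_distrib, sum_qCol hv hn, sum_qBar hv hn]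
      ring
    rw [e, Finset.mul_sum, Finset.mul_sum]
    refine Finset.sum_le_sum fun j _ => ?_
    have h1 : |s.v l j - s.v l j₀| ≤ 2 * D.cbar / η := by
      have := hs.range_v l j₀ j
      exact abs_le.2 ⟨by linarith, hs.range_v l j j₀⟩
    calc _ ≤ η * (|D.qCol η s l j - D.qBar η s j| * (2 * D.cbar / η)) := by
          refine mul_le_mul_of_nonneg_left ((le_abs_self _).trans ?_) hη.le
          rw [abs_mul]
          exact mul_le_mul_of_nonneg_left h1 (abs_nonneg _)
      _ = _ := by field_simp
  have hmain : D.f ζ s.U - D.f π s.U = ∑ l, D.w l * (η *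
      ((∑ j, (D.qCol η s l j - D.qBar η s j) * s.v l j + (∑ j, s.v l j * D.qBar η s j -
        ∑ j, s.v l j * ∑ i, π l₀ i j)) +
        (∑ i, ∑ j, π l i j * Real.log (ζ l i j) - ∑ i, ∑ j, ζ l i j * Real.log (ζ l i j)))) := by
    rw [f, f, ← Finset.sum_sub_distrib]
    refine Finset.sum_congr rfl fun l _ => ?_
    rw [← mul_sub, ← hvv]
    congr 1
    have : ∑ i, ∑ j, (ζ l i j - π l i j) * s.v l j =
      ∑ i, ∑ j, (ζ l i j - π l i j) * D.uNext η s l i +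
        ∑ i, ∑ j, (ζ l i j - π l i j) * s.v l j := by rw [hu, zero_add]
    rw [this]
    simp only [← Finset.sum_sub_distrib, ← Finset.sum_add_distrib, Finset.mul_sum, hC]
    exact Finset.sum_congr rfl fun i _ => Finset.sum_congr rfl fun j _ => by ring
  rw [hmain]
  calc _ ≤ ∑ l, D.w l * (2 * D.cbar * ∑ j, |D.qCol η s l j - D.qBar η s j| +
        η * (∑ j, s.v l j * D.qBar η s j - ∑ j, s.v l j * ∑ i, π l₀ i j) +
        η * (2 * Real.log n)) := by
        refine Finset.sum_le_sum fun l _ => mul_le_mul_of_nonneg_left ?_ (hv.w_nonneg l)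
        have h1 := hr l
        have h2 : η * (∑ i, ∑ j, π l i j * Real.log (ζ l i j) -
            ∑ i, ∑ j, ζ l i j * Real.log (ζ l i j)) ≤ η * (2 * Real.log n) :=
          mul_le_mul_of_nonneg_left (by linarith [hent l, hent2 l]) hη.le
        linarith
    _ = 2 * D.cbar * ∑ l, D.w l * ∑ j, |D.qCol η s l j - D.qBar η s j| +
        η * (∑ l, D.w l * ∑ j, s.v l j * D.qBar η s j -
          ∑ l, D.w l * ∑ j, s.v l j * ∑ i, π l₀ i j) + (∑ l, D.w l) * (η * (2 * Real.log n)) := by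
        rw [Finset.sum_mul, ← Finset.sum_sub_distrib, Finset.mul_sum, Finset.mul_sum,
          ← Finset.sum_add_distrib, ← Finset.sum_add_distrib]
        exact Finset.sum_congr rfl fun l _ => by ring
    _ = _ := by
        rw [hzero, hzero, hv.w_sum, colGap]
        ring

end stationary

theorem etaPar_pos {n : ℕ} {ε : ℝ} (hε : 0 < ε) : 0 < etaPar n ε :=
  div_pos hε (by have := Real.log_natCast_nonneg n; linarith)

/-- The gradient of f is linear in the plans and equals -η grad g at the plans P after the v-update,
where the test evaluates it. The output R is built from the plans before that update, so R - P
consists of the rounding error and the effect of the v-update. -/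
theorem frobNorm_grad_rounded_le (hv : D.Valid) (hn : 0 < n) (hm : 0 < m) {η : ℝ} (hη : 0 < η)
    (s : Iterate m n d k) (hU : Stiefel s.U) :
    frobNorm (riemGrad (fun V => D.f (fun l =>
      roundPlan (D.plan η (D.uNext η s) s.v s.U l) (D.p l) (D.qBar η s)) V) s.U) ≤
      2 * D.cbar * (2 * D.colGap η s + 2 * (D.colGap η s / D.wmin)) +
        η * frobNorm (D.gradStep η s) := by
  set R : Fin m → Fin n → Fin n → ℝ :=
    fun l => roundPlan (D.plan η (D.uNext η s) s.v s.U l) (D.p l) (D.qBar η s) with hR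
  set P := D.plan η (D.uNext η s) (D.vNext η s) s.U with hP
  have e1 : riemGrad (fun V => D.f R V) s.U =
      tangentProj s.U (D.planGrad (R - P) s.U) + -η • D.gradStep η s := by
    rw [gradStep, riemGrad, riemGrad, eucGrad_f, D.eucGrad_g hn, ← tangentProj_smul,
      ← tangentProj_add, planGrad_sub, smul_smul]
    have : -η * -(1 / η) = 1 := by field_simp
    rw [this, one_smul, sub_add_cancel]
  rw [e1]
  refine (frobNorm_add_le _ _).trans ?_
  rw [frobNorm_smul, abs_neg, abs_of_pos hη]
  refine add_le_add_left ((frobNorm_tangentProj_le hU _).trans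
    ((D.frobNorm_planGrad_le hU hv.w_nonneg _).trans ?_)) _
  refine mul_le_mul_of_nonneg_left ?_ (mul_nonneg two_pos.le D.cbar_nonneg)
  have h1 := sum_abs_rounded_sub_le hv hn (η := η) s
  have h2 := sum_abs_plan_sub_le hv hn (η := η) s hm
  calc _ ≤ ∑ l, D.w l * (∑ i, ∑ j, |R l i j - D.zeta η (D.uNext η s) s.v s.U l i j| +
        ∑ i, ∑ j, |D.zeta η (D.uNext η s) s.v s.U l i j - P l i j|) := by
        refine Finset.sum_le_sum fun l _ => mul_le_mul_of_nonneg_left ?_ (hv.w_nonneg l)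
        simp only [← Finset.sum_add_distrib]
        exact Finset.sum_le_sum fun i _ => Finset.sum_le_sum fun j _ => abs_sub_le _ _ _
    _ ≤ _ := by
        simp only [mul_add, Finset.sum_add_distrib]
        linarith

theorem rpow_three_halves {x : ℝ} (hx : 0 ≤ x) : x ^ (3 / 2 : ℝ) = x * √x := by
  rw [Real.sqrt_eq_rpow, show (3 / 2 : ℝ) = 1 + 1 / 2 by norm_num,
    Real.rpow_add' hx (by norm_num), Real.rpow_one]

/-- The test makes both c̄ `colGap` and c̄ `colGap`/ω at most ε/12; the further factor √ω of the
threshold is not needed here. The gradient bound is then 8·ε/12 + ε/3 = ε, and the gap is at most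
ε/12 + 2·ε/12 + ε/2. -/
theorem epsStationary_of_stop (hv : D.Valid) (hn : 0 < n) (hm : 0 < m) {ε : ℝ} (hε : 0 < ε)
    (hc : 0 < D.cbar) (s : Iterate m n d k) (hs : D.Inv (etaPar n ε) s) (h : D.Stop ε s) :
    D.EpsStationary ε (D.planOut ε s) s.U := by
  have hη : 0 < etaPar n ε := etaPar_pos hε
  obtain ⟨h1, h2⟩ := h
  change D.colGap (etaPar n ε) s ≤ _ at h1
  have hw0 := hv.wmin_pos hm
  have hw1 := hv.wmin_le_one hm
  have hs1 : √D.wmin ≤ 1 := Real.sqrt_le_one.2 hw1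
  have hb : D.cbar * (D.colGap (etaPar n ε) s / D.wmin) ≤ ε / 12 := by
    rw [rpow_three_halves hw0.le] at h1
    have h3 : D.colGap (etaPar n ε) s / D.wmin ≤ √D.wmin * ε / (12 * D.cbar) := by
      rw [div_le_iff₀ hw0]
      refine h1.trans (le_of_eq ?_)
      ring
    calc _ ≤ D.cbar * (√D.wmin * ε / (12 * D.cbar)) := by gcongr
      _ = √D.wmin * (ε / 12) := by field_simp
      _ ≤ _ := mul_le_of_le_one_left (by positivity) hs1
  have ha : D.cbar * D.colGap (etaPar n ε) s ≤ ε / 12 := by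
    refine le_trans ?_ hb
    refine mul_le_mul_of_nonneg_left ?_ hc.le
    exact le_div_self (colGap_nonneg hv _ s) hw0 hw1
  refine ⟨feasible_rounded hv hn s, hs.stiefel, ?_, fun π hπ => ?_⟩
  · have h3 := frobNorm_grad_rounded_le hv hn hm hη s hs.stiefel
    refine h3.trans ?_
    linarith
  · have h3 := f_rounded_sub_le hv hn (η := etaPar n ε) s hs.stiefel
    have h4 := f_zeta_sub_le hv hn hη s hm hs hπ
    have h5 : etaPar n ε * (2 * Real.log n) ≤ ε / 2 := by
      have h6 := Real.log_natCast_nonneg n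
      rw [etaPar, div_mul_eq_mul_div, div_le_iff₀ (by linarith)]
      nlinarith
    change D.f (fun l => roundPlan (D.plan (etaPar n ε) (D.uNext (etaPar n ε) s) s.v s.U l)
      (D.p l) (D.qBar (etaPar n ε) s)) s.U - _ ≤ _
    linarith

end Problem

namespace Problem

variable {D : Problem m n d}

/-! ### The number of iterations -/

section count
variable (hv : D.Valid) (hn : 0 < n) {ε L₁ L₂ : ℝ} (hε : 0 < ε)
  {Retr : Matrix (Fin d) (Fin k) ℝ → Matrix (Fin d) (Fin k) ℝ → Matrix (Fin d) (Fin k) ℝ}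
  (hR : IsRetraction Retr L₁ L₂) {s : Iterate m n d k}

theorem tangent_gradStep {η : ℝ} (hU : Stiefel s.U) (c : ℝ) : Tangent s.U (c • D.gradStep η s) :=
  (tangent_tangentProj hU _).smul c

include hv hn hε hR

theorem Inv.step (hs : D.Inv (etaPar n ε) s) : D.Inv (etaPar n ε) (D.step Retr ε L₁ L₂ s) :=
  ⟨hR.mem _ _ hs.stiefel (tangent_gradStep hs.stiefel _), sum_vNext hv hn s hs,
    range_vNext hv hn (etaPar_pos hε) s hs⟩

theorem Inv.iter (hs : D.Inv (etaPar n ε) s) (t : ℕ) :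
    D.Inv (etaPar n ε) (D.iter Retr ε L₁ L₂ s t) := by
  induction t with
  | zero => exact hs
  | succ t ih => exact ih.step hv hn hε hR

/-- The dual objective after the update of the first dual variables. -/
noncomputable def potential (D : Problem m n d) (ε : ℝ) (s : Iterate m n d k) : ℝ :=
  D.g (etaPar n ε) (D.uNext (etaPar n ε) s) s.v s.U

/-- From one potential to the next, the v-update, the retraction step and the next u-update are
performed in this order, and none of them increases `g`. -/
theorem potential_step_le (hc : 0 < D.cbar) (hs : D.Inv (etaPar n ε) s) :
    D.potential ε (D.step Retr ε L₁ L₂ s) ≤ D.potential ε s -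
      D.colGap (etaPar n ε) s ^ 2 / 16 -
      D.tau ε L₁ L₂ / 2 * frobNorm (D.gradStep (etaPar n ε) s) ^ 2 := by
  have h1 := g_uNext_le hv hn (etaPar n ε) (D.step Retr ε L₁ L₂ s)
  have h2 := g_retr_le hv hn (etaPar_pos hε) (D.uNext (etaPar n ε) s) (D.vNext (etaPar n ε) s) hR
    hs.stiefel hc (τ := D.tau ε L₁ L₂) rfl
  have h3 := g_vNext hv hn (etaPar n ε) s
  have h4 := log_sum_qGeo_le hv hn (etaPar n ε) s
  change D.potential ε (D.step Retr ε L₁ L₂ s) ≤ _ at h1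
  change D.g (etaPar n ε) (D.uNext (etaPar n ε) s) (D.vNext (etaPar n ε) s)
    (D.step Retr ε L₁ L₂ s).U ≤ _ - _ * frobNorm (D.gradStep (etaPar n ε) s) ^ 2 at h2
  refine h1.trans (h2.trans ?_)
  rw [h3, potential]
  linarith

/-- Telescoping: N decreases of at least δ fit between the upper bound at the start and the lower
bound at time N. The entropy term cancels. -/
theorem mul_le_of_not_stop (hc : 0 < D.cbar) (hs : D.Inv (etaPar n ε) s) {δ : ℝ}
    (hδ : ∀ s : Iterate m n d k, ¬ D.Stop ε s → δ ≤ D.colGap (etaPar n ε) s ^ 2 / 16 +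
      D.tau ε L₁ L₂ / 2 * frobNorm (D.gradStep (etaPar n ε) s) ^ 2) {N : ℕ}
    (hN : ∀ t, t < N → ¬ D.Stop ε (D.iter Retr ε L₁ L₂ s t)) :
    N * δ ≤ Real.log n + 3 * D.cbar / etaPar n ε := by
  have key : ∀ t, t ≤ N → D.potential ε (D.iter Retr ε L₁ L₂ s t) ≤ D.potential ε s - t * δ := by
    intro t
    induction t with
    | zero => intro _; simp [iter]
    | succ t ih =>
      intro ht
      have h1 := ih (by omega)
      have h2 := potential_step_le hv hn hε hR hc (hs.iter hv hn hε hR t)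
      have h3 := hδ _ (hN t (by omega))
      change D.potential ε (D.step Retr ε L₁ L₂ _) ≤ _
      push_cast
      linarith
  have h1 := key N le_rfl
  have h2 := g_uNext_upper hv hn (etaPar_pos hε) s hs
  have h3 := g_uNext_lower hv hn (etaPar_pos hε) _ (hs.iter hv hn hε hR N)
  have h4 : 3 * D.cbar / etaPar n ε = 2 * D.cbar / etaPar n ε + D.cbar / etaPar n ε := by ring
  change D.potential ε s ≤ _ at h2
  change _ ≤ D.potential ε _ at h3
  linarith

end count

/-- The constant in the minimal decrease per iteration. -/
noncomputable def decreaseConst (K : ℝ) : ℝ := 2304 * K ^ 4 + 18 * K ^ 2 * (2 * K + K ^ 2 + 4)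

/-- The constant in the bound for the number of iterations. -/
noncomputable def iterConst (K : ℝ) : ℝ := (K ^ 2 + 21) * decreaseConst K + 2 * K ^ 10

theorem two_thirds_le_log {n : ℕ} (hn : 2 ≤ n) : 2 / 3 ≤ Real.log n := by
  have h1 : Real.log 2 ≤ Real.log n := Real.log_le_log two_pos (by exact_mod_cast hn)
  have := Real.log_two_gt_d9
  linarith

theorem le_decrease_of_not_stop (hv : D.Valid) (hm : 0 < m) {ε L₁ L₂ K : ℝ} (hε : 0 < ε)
    (hL₁ : 0 < L₁) (hL₂ : 0 < L₂) (hc : 0 < D.cbar) (hK : 0 < K) (hεK : ε ≤ K)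
    (hcK : 1 ≤ K * D.cbar) (hLK : 1 ≤ K * L₁) (hL : L₂ * ε ≤ K * (L₁ ^ 2 * D.cbar))
    (s : Iterate m n d k) (hs : ¬ D.Stop ε s) :
    D.wmin ^ 3 * ε ^ 2 / (decreaseConst K * (D.cbar ^ 4 * L₁ ^ 2)) ≤
      D.colGap (etaPar n ε) s ^ 2 / 16 +
      D.tau ε L₁ L₂ / 2 * frobNorm (D.gradStep (etaPar n ε) s) ^ 2 := by
  have hη : 0 < etaPar n ε := etaPar_pos hε
  have hw0 := hv.wmin_pos hm
  have hw1 := hv.wmin_le_one hm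
  have hM : 0 < decreaseConst K := by unfold decreaseConst; positivity
  have hc2 : 1 ≤ K ^ 2 * D.cbar ^ 2 := by
    rw [← mul_pow]; exact one_le_pow₀ hcK
  have hL2 : 1 ≤ K ^ 2 * L₁ ^ 2 := by
    rw [← mul_pow]; exact one_le_pow₀ hLK
  have hτ : 0 < D.tau ε L₁ L₂ := by
    unfold tau rho; positivity
  rw [Stop, not_and_or, not_le, not_le] at hs
  rcases hs with hs | hs
  · change _ < D.colGap (etaPar n ε) s at hs
    refine le_trans ?_ (le_add_of_nonneg_right (by positivity))
    have h1 : (D.wmin ^ (3 / 2 : ℝ) * ε / (12 * D.cbar)) ^ 2 ≤ D.colGap (etaPar n ε) s ^ 2 :=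
      pow_le_pow_left₀ (by positivity) hs.le 2
    have e : (D.wmin ^ (3 / 2 : ℝ) * ε / (12 * D.cbar)) ^ 2 =
        D.wmin ^ 3 * ε ^ 2 / (144 * D.cbar ^ 2) := by
      rw [rpow_three_halves hw0.le, div_pow, mul_pow, mul_pow, Real.sq_sqrt hw0.le]
      ring
    rw [e] at h1
    refine le_trans ?_ (div_le_div_of_nonneg_right h1 (by norm_num))
    rw [div_div]
    refine div_le_div_of_nonneg_left (by positivity) (by positivity) ?_
    -- The squared threshold involves only c̄²; these factors, each at least 1, bring it to the
    -- common form c̄⁴L₁².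
    have h2 : 1 ≤ (K ^ 2 * D.cbar ^ 2) * (K ^ 2 * L₁ ^ 2) := one_le_mul_of_one_le_of_one_le hc2 hL2
    have h3 : 2304 * K ^ 4 ≤ decreaseConst K := by
      unfold decreaseConst
      have : 0 ≤ 18 * K ^ 2 * (2 * K + K ^ 2 + 4) := by positivity
      linarith
    calc 144 * D.cbar ^ 2 * 16 = 2304 * D.cbar ^ 2 * 1 := by ring
      _ ≤ 2304 * D.cbar ^ 2 * ((K ^ 2 * D.cbar ^ 2) * (K ^ 2 * L₁ ^ 2)) := by gcongr
      _ = 2304 * K ^ 4 * (D.cbar ^ 4 * L₁ ^ 2) := by ring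
      _ ≤ _ := by gcongr
  · refine le_trans ?_ (le_add_of_nonneg_left (by positivity))
    have hη2 : etaPar n ε ≤ ε / 2 := by
      have := Real.log_natCast_nonneg n
      unfold etaPar
      exact div_le_div_of_nonneg_left hε.le two_pos (by linarith)
    set η := etaPar n ε with hηd
    set G := frobNorm (D.gradStep η s) with hG
    have h1 : (ε / 3) ^ 2 ≤ (η * G) ^ 2 := pow_le_pow_left₀ (by positivity) hs.le 2
    set A := 4 * L₂ * D.cbar * η + (2 * D.cbar * η + 4 * D.cbar ^ 2) * L₁ ^ 2 with hA
    have hA0 : 0 < A := by positivity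
    have hAτ : D.tau ε L₁ L₂ = η ^ 2 / A := by
      rw [tau, rho, ← hηd, hA]
      field_simp
    -- With 1/τ = A/η², the three summands come from L₂ε ≤ K L₁²c̄, from ε ≤ K with 1 ≤ K c̄, and
    -- from the leading term of ρ.
    have hAle : A ≤ (2 * K + K ^ 2 + 4) * (D.cbar ^ 2 * L₁ ^ 2) := by
      have a1 : 4 * L₂ * D.cbar * η ≤ 2 * K * (D.cbar ^ 2 * L₁ ^ 2) := by
        calc 4 * L₂ * D.cbar * η ≤ 4 * L₂ * D.cbar * (ε / 2) := by gcongr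
          _ = 2 * D.cbar * (L₂ * ε) := by ring
          _ ≤ 2 * D.cbar * (K * (L₁ ^ 2 * D.cbar)) := by gcongr
          _ = _ := by ring
      have a2 : 2 * D.cbar * η ≤ K ^ 2 * D.cbar ^ 2 := by
        calc 2 * D.cbar * η ≤ 2 * D.cbar * (ε / 2) := by gcongr
          _ = ε * D.cbar * 1 := by ring
          _ ≤ K * D.cbar * (K * D.cbar) := by gcongr
          _ = _ := by ring
      have a3 : 2 * D.cbar * η * L₁ ^ 2 ≤ K ^ 2 * D.cbar ^ 2 * L₁ ^ 2 := by gcongr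
      rw [hA]
      linarith
    rw [hAτ]
    have h2 : ε ^ 2 / (18 * A) ≤ η ^ 2 / A / 2 * G ^ 2 := by
      calc ε ^ 2 / (18 * A) = (ε / 3) ^ 2 / (2 * A) := by field_simp; norm_num
        _ ≤ (η * G) ^ 2 / (2 * A) := by gcongr
        _ = _ := by field_simp
    refine le_trans ?_ h2
    rw [div_le_div_iff₀ (by positivity) (by positivity)]
    have h3 : 18 * K ^ 2 * (2 * K + K ^ 2 + 4) ≤ decreaseConst K := by
      unfold decreaseConst
      have : 0 ≤ 2304 * K ^ 4 := by positivity
      linarith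
    have hw3 : D.wmin ^ 3 ≤ 1 := pow_le_one₀ hw0.le hw1
    calc D.wmin ^ 3 * ε ^ 2 * (18 * A) ≤ 1 * ε ^ 2 *
          (18 * ((2 * K + K ^ 2 + 4) * (D.cbar ^ 2 * L₁ ^ 2))) := by gcongr
      _ = ε ^ 2 * (18 * (2 * K + K ^ 2 + 4) * D.cbar ^ 2 * L₁ ^ 2 * 1) := by ring
      _ ≤ ε ^ 2 * (18 * (2 * K + K ^ 2 + 4) * D.cbar ^ 2 * L₁ ^ 2 * (K ^ 2 * D.cbar ^ 2)) := by
          gcongr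
      _ = ε ^ 2 * ((18 * K ^ 2 * (2 * K + K ^ 2 + 4)) * (D.cbar ^ 4 * L₁ ^ 2)) := by ring
      _ ≤ _ := by gcongr

/-- Absorbs the additional iteration in T + 1. The exponent 10 is 2 + 5 + 3 from L₁, c̄ and ε, and
the factor 2 comes from 2 log n ≥ 1. -/
theorem one_le_iter_bound (hv : D.Valid) (hm : 0 < m) (hn : 2 ≤ n) {ε L₁ K : ℝ} (hε : 0 < ε)
    (hK : 0 < K) (hεK : ε ≤ K) (hcK : 1 ≤ K * D.cbar) (hLK : 1 ≤ K * L₁) :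
    1 ≤ 2 * K ^ 10 * (Real.log n * L₁ ^ 2 * D.cbar ^ 5 / (D.wmin ^ 3 * ε ^ 3)) := by
  have hw0 := hv.wmin_pos hm
  have hw1 := hv.wmin_le_one hm
  have hl := two_thirds_le_log hn
  rw [mul_div_assoc', le_div_iff₀ (by positivity), one_mul]
  have h1 : D.wmin ^ 3 * ε ^ 3 ≤ 1 * K ^ 3 := by
    have := pow_le_one₀ (n := 3) hw0.le hw1
    gcongr
  have h2 : 1 ≤ (2 * Real.log n) * ((K * L₁) ^ 2 * (K * D.cbar) ^ 5) :=
    one_le_mul_of_one_le_of_one_le (by linarith)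
      (one_le_mul_of_one_le_of_one_le (one_le_pow₀ hLK) (one_le_pow₀ hcK))
  calc _ ≤ 1 * K ^ 3 := h1
    _ ≤ (2 * Real.log n) * ((K * L₁) ^ 2 * (K * D.cbar) ^ 5) * K ^ 3 := by gcongr
    _ = _ := by ring

theorem exists_stop (hv : D.Valid) (hm : 0 < m) (hn : 2 ≤ n) {ε L₁ L₂ K : ℝ} (hε : 0 < ε)
    {Retr : Matrix (Fin d) (Fin k) ℝ → Matrix (Fin d) (Fin k) ℝ → Matrix (Fin d) (Fin k) ℝ}
    (hR : IsRetraction Retr L₁ L₂) (hc : 0 < D.cbar) (hK : 0 < K) (hεK : ε ≤ K)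
    (hcK : 1 ≤ K * D.cbar) (hLK : 1 ≤ K * L₁) (hL : L₂ * ε ≤ K * (L₁ ^ 2 * D.cbar))
    {s : Iterate m n d k} (hs : D.Inv (etaPar n ε) s) :
    ∃ T : ℕ, (∀ t, t < T → ¬ D.Stop ε (D.iter Retr ε L₁ L₂ s t)) ∧
      D.Stop ε (D.iter Retr ε L₁ L₂ s T) ∧
      (T : ℝ) + 1 ≤ iterConst K * (Real.log n * L₁ ^ 2 * D.cbar ^ 5 / (D.wmin ^ 3 * ε ^ 3)) := by
  have hn0 : 0 < n := by omega
  have hw0 := hv.wmin_pos hm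
  have hl := two_thirds_le_log hn
  have hL₁ := hR.L₁_pos
  have hM : 0 < decreaseConst K := by unfold decreaseConst; positivity
  set X := Real.log n * L₁ ^ 2 * D.cbar ^ 5 / (D.wmin ^ 3 * ε ^ 3) with hX
  set δ := D.wmin ^ 3 * ε ^ 2 / (decreaseConst K * (D.cbar ^ 4 * L₁ ^ 2)) with hδ
  have hδ0 : 0 < δ := by positivity
  have hgap : Real.log n + 3 * D.cbar / etaPar n ε ≤
      (K ^ 2 + 21) * (D.cbar * Real.log n / ε) := by
    have h1 : Real.log n ≤ K ^ 2 * (D.cbar * Real.log n / ε) := by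
      rw [mul_div_assoc', le_div_iff₀ hε]
      calc Real.log n * ε ≤ Real.log n * K * 1 := by rw [mul_one]; gcongr
        _ ≤ Real.log n * K * (K * D.cbar) := by gcongr
        _ = _ := by ring
    -- 3(4 log n + 2) ≤ 21 log n, as log n ≥ 2/3.
    have h2 : 3 * D.cbar / etaPar n ε ≤ 21 * (D.cbar * Real.log n / ε) := by
      have e : 3 * D.cbar / etaPar n ε = 3 * D.cbar * (4 * Real.log n + 2) / ε := by
        rw [etaPar]; field_simp
      rw [e, mul_div_assoc']
      refine div_le_div_of_nonneg_right ?_ hε.le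
      nlinarith
    linarith
  have hbound : ∀ N : ℕ, (∀ t, t < N → ¬ D.Stop ε (D.iter Retr ε L₁ L₂ s t)) →
      (N : ℝ) ≤ (K ^ 2 + 21) * decreaseConst K * X := by
    intro N hN
    have h1 := (mul_le_of_not_stop hv hn0 hε hR hc hs
      (le_decrease_of_not_stop hv hm hε hL₁ hR.L₂_pos hc hK hεK hcK hLK hL) hN).trans hgap
    rw [← le_div_iff₀ hδ0] at h1
    refine h1.trans (le_of_eq ?_)
    rw [hδ, hX]
    field_simp
  have hex : ∃ T, D.Stop ε (D.iter Retr ε L₁ L₂ s T) := by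
    by_contra h
    push Not at h
    obtain ⟨N, hN⟩ := exists_nat_gt ((K ^ 2 + 21) * decreaseConst K * X)
    exact absurd (hbound N fun t _ => h t) (not_le.2 hN)
  classical
  refine ⟨Nat.find hex, fun t ht => Nat.find_min hex ht, Nat.find_spec hex, ?_⟩
  have h1 := hbound (Nat.find hex) fun t ht => Nat.find_min hex ht
  have h2 := one_le_iter_bound (L₁ := L₁) hv hm hn hε hK hεK hcK hLK
  rw [iterConst, add_mul]
  linarith

end Problem

/-! ### Single-assignment programs -/

/-- The position of a register in the order in which a program writes its arrays. -/
def Reg.tag : Reg m n d k → ℕ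
  | .X .. => 0
  | .Y .. => 1
  | .p .. => 2
  | .w .. => 3
  | .eps => 4
  | .L₁ => 5
  | .L₂ => 6
  | .u .. => 7
  | .v .. => 8
  | .U .. => 9
  | .qOut .. => 100
  | .UOut .. => 101
  | .planOut .. => 102
  | .flag => 60
  | .tmp name .. => name + 10

/-- Stack registers. -/
def regScr (t : ℕ) : Reg m n d k := .tmp 1000 t 0 0

theorem regScr_injective : Function.Injective (regScr : ℕ → Reg m n d k) := fun s t h => by
  simpa [regScr] using h

theorem ne_regScr_of_tag {r : Reg m n d k} (h : r.tag ≠ 1010) (s : ℕ) : r ≠ regScr s := by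
  rintro rfl
  exact h rfl

/-- The block writes only registers with tag at least `N`, and its final memory, as far as tags
below `N'` are concerned, satisfies `E`. -/
def Computes (B : List (Instr (Reg m n d k))) (N N' : ℕ) (E : (Reg m n d k → ℝ) → Prop) : Prop :=
  ∀ M, (∀ r : Reg m n d k, r.tag < N → runBlock B M r = M r) ∧
    ∀ M', (∀ r : Reg m n d k, r.tag < N' → M' r = runBlock B M r) → E M'

/-- The second block writes only tags from N₂ on, while E₁ depends only on tags below N₁ ≤ N₂, so
what the first block established survives. -/
theorem Computes.append {B₁ B₂ : List (Instr (Reg m n d k))} {N N₁ N₂ N' : ℕ}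
    {E₁ E₂ : (Reg m n d k → ℝ) → Prop} (h₁ : Computes B₁ N N₁ E₁) (h₂ : Computes B₂ N₂ N' E₂)
    (h : N ≤ N₂ := by norm_num) (h' : N₁ ≤ N₂ := by norm_num) (h'' : N₁ ≤ N' := by norm_num) :
    Computes (B₁ ++ B₂) N N' fun M => E₁ M ∧ E₂ M := by
  intro M
  rw [runBlock_append]
  obtain ⟨a₁, a₂⟩ := h₁ M
  obtain ⟨b₁, b₂⟩ := h₂ (runBlock B₁ M)
  refine ⟨fun r hr => ?_, fun M' hM' => ⟨a₂ M' fun r hr => ?_, b₂ M' hM'⟩⟩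
  · rw [b₁ r (by omega), a₁ r hr]
  · rw [hM' r (by omega), b₁ r (by omega)]

theorem Computes.mono {B : List (Instr (Reg m n d k))} {N N' : ℕ}
    {E E' : (Reg m n d k → ℝ) → Prop} (h : Computes B N N' E) (h' : ∀ M, E M → E' M) :
    Computes B N N' E' := fun M => ⟨(h M).1, fun M' hM' => h' _ ((h M).2 M' hM')⟩

theorem run_assignAll_of_tag {ι : Type} [Fintype ι] {dst : ι → Reg m n d k}
    {e : ι → Expr (Reg m n d k)} {N : ℕ}
    (hd : Function.Injective dst) (ht : ∀ i, (dst i).tag = N) (hN : N ≠ 1010)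
    (he : ∀ i, (e i).ReadsOnly fun r => r.tag ≠ 1010 ∧ r.tag ≠ N) (M : Reg m n d k → ℝ) :
    (∀ i, runBlock (assignAll regScr dst e) M (dst i) = (e i).eval M) ∧
      ∀ r : Reg m n d k, r.tag ≠ 1010 → r.tag ≠ N →
        runBlock (assignAll regScr dst e) M r = M r := by
  obtain ⟨h1, h2⟩ := run_assignAll regScr_injective hd
    (fun i => ne_regScr_of_tag (by rw [ht]; exact hN))
    (fun i => (he i).mono fun r hr => ⟨ne_regScr_of_tag hr.1, fun j h => hr.2 (by rw [h, ht])⟩) M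
  exact ⟨h1, fun r hr hr' => h2 r (ne_regScr_of_tag hr) fun i h => hr' (by rw [h, ht])⟩

/-- Because the expressions read only lower tags, which later blocks do not overwrite, the
assignment can be stated as an equation of the final memory on both sides. -/
theorem computes_assignAll {ι : Type} [Fintype ι] {dst : ι → Reg m n d k}
    {e : ι → Expr (Reg m n d k)} {N : ℕ}
    (hd : Function.Injective dst) (ht : ∀ i, (dst i).tag = N) (hN : N < 1010)
    (he : ∀ i, (e i).ReadsOnly fun r => r.tag < N) :
    Computes (assignAll regScr dst e) N (N + 1) fun M => ∀ i, M (dst i) = (e i).eval M := by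
  intro M
  obtain ⟨h1, h2⟩ := run_assignAll_of_tag hd ht hN.ne
    (fun i => (he i).mono fun r hr => ⟨by omega, by omega⟩) M
  refine ⟨fun r hr => h2 r (by omega) (by omega), fun M' hM' i => ?_⟩
  rw [hM' _ (by rw [ht]; omega), h1]
  exact (he i).eval_eq fun r hr => by rw [hM' r (by omega), h2 r (by omega) (by omega)]

section arrays
variable (name : ℕ)

/-- Assignment to a scratch register. -/
noncomputable def arr0 (e : Expr (Reg m n d k)) : List (Instr (Reg m n d k)) :=
  assignAll regScr (fun _ : Unit => .tmp name 0 0 0) fun _ => e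

/-- Assignment to a scratch vector. -/
noncomputable def arr1 {a : ℕ} (e : Fin a → Expr (Reg m n d k)) : List (Instr (Reg m n d k)) :=
  assignAll regScr (fun i : Fin a => .tmp name i 0 0) e

/-- Assignment to a scratch matrix. -/
noncomputable def arr2 {a b : ℕ} (e : Fin a → Fin b → Expr (Reg m n d k)) :
    List (Instr (Reg m n d k)) :=
  assignAll regScr (fun x : Fin a × Fin b => .tmp name x.1 x.2 0) fun x => e x.1 x.2

/-- Assignment to a scratch array with three indices. -/
noncomputable def arr3 {a b c : ℕ} (e : Fin a → Fin b → Fin c → Expr (Reg m n d k)) :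
    List (Instr (Reg m n d k)) :=
  assignAll regScr (fun x : Fin a × Fin b × Fin c => .tmp name x.1 x.2.1 x.2.2)
    fun x => e x.1 x.2.1 x.2.2

theorem length_arr0 (e : Expr (Reg m n d k)) : (arr0 name e).length = e.cost + 1 := by
  simp [arr0, length_assignAll]

theorem length_arr1 {a : ℕ} (e : Fin a → Expr (Reg m n d k)) :
    (arr1 name e).length = ∑ i, ((e i).cost + 1) := length_assignAll _ _ _

theorem length_arr2 {a b : ℕ} (e : Fin a → Fin b → Expr (Reg m n d k)) :
    (arr2 name e).length = ∑ i, ∑ j, ((e i j).cost + 1) := by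
  rw [arr2, length_assignAll, Fintype.sum_prod_type]

theorem length_arr3 {a b c : ℕ} (e : Fin a → Fin b → Fin c → Expr (Reg m n d k)) :
    (arr3 name e).length = ∑ i, ∑ j, ∑ l, ((e i j l).cost + 1) := by
  rw [arr3, length_assignAll, Fintype.sum_prod_type]
  simp only [Fintype.sum_prod_type]

variable {name} {N : ℕ} (hN : name + 10 = N) (hname : N < 1010)
include hN hname

theorem computes_arr0 {e : Expr (Reg m n d k)} (he : e.ReadsOnly fun r => r.tag < N) :
    Computes (arr0 name e) N (N + 1) fun M => M (.tmp name 0 0 0) = e.eval M :=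
  (computes_assignAll (dst := fun _ : Unit => .tmp name 0 0 0) (fun _ _ _ => rfl) (fun _ => hN)
    hname fun _ => he).mono fun _ h => h ()

theorem computes_arr1 {a : ℕ} {e : Fin a → Expr (Reg m n d k)}
    (he : ∀ i, (e i).ReadsOnly fun r => r.tag < N) :
    Computes (arr1 name e) N (N + 1) fun M => ∀ i : Fin a, M (.tmp name i 0 0) = (e i).eval M :=
  computes_assignAll (fun i j h => by simpa [Fin.ext_iff] using h) (fun _ => hN) hname he

theorem computes_arr2 {a b : ℕ} {e : Fin a → Fin b → Expr (Reg m n d k)}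
    (he : ∀ i j, (e i j).ReadsOnly fun r => r.tag < N) :
    Computes (arr2 name e) N (N + 1)
      fun M => ∀ (i : Fin a) (j : Fin b), M (.tmp name i j 0) = (e i j).eval M :=
  (computes_assignAll (dst := fun x : Fin a × Fin b => .tmp name x.1 x.2 0)
    (fun i j h => by simpa [Prod.ext_iff, Fin.ext_iff] using h) (fun _ => hN)
    hname fun x => he x.1 x.2).mono fun _ h i j => h (i, j)

theorem computes_arr3 {a b c : ℕ} {e : Fin a → Fin b → Fin c → Expr (Reg m n d k)}
    (he : ∀ i j l, (e i j l).ReadsOnly fun r => r.tag < N) :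
    Computes (arr3 name e) N (N + 1)
      fun M => ∀ (i : Fin a) (j : Fin b) (l : Fin c), M (.tmp name i j l) = (e i j l).eval M :=
  (computes_assignAll (dst := fun x : Fin a × Fin b × Fin c => .tmp name x.1 x.2.1 x.2.2)
    (fun i j h => by simpa [Prod.ext_iff, Fin.ext_iff] using h) (fun _ => hN)
    hname fun x => he x.1 x.2.1 x.2.2).mono fun _ h i j l => h (i, j, l)

end arrays

/-! ### Embedding of the retraction subroutine -/

/-- The registers of the retraction subroutine among the scratch registers. -/
def retrReg : RetrReg d k → Reg m n d k
  | .U a b => .tmp 51 0 a b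
  | .xi a b => .tmp 51 1 a b
  | .out a b => .tmp 51 2 a b
  -- One of the four indices is spent on the common name 51, so two others are paired; the shift by
  -- 3 avoids the numbers of `U`, `xi` and `out`.
  | .tmp name i j l => .tmp 51 (name + 3) (Nat.pair i j) l

theorem retrReg_injective : Function.Injective (retrReg : RetrReg d k → Reg m n d k) := by
  intro r s h
  cases r <;> cases s <;>
    simp only [retrReg, Reg.tmp.injEq, RetrReg.U.injEq, RetrReg.xi.injEq, RetrReg.out.injEq,
      RetrReg.tmp.injEq, Fin.val_inj, Nat.pair_eq_pair, Nat.add_right_cancel_iff,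
      reduceCtorEq] at h ⊢ <;> first | tauto | omega

theorem tag_retrReg (r : RetrReg d k) : (retrReg r : Reg m n d k).tag = 61 := by
  cases r <;> rfl

/-- Copying the point and the tangent vector to the subroutine and running it. -/
noncomputable def retrCall (U xi : Fin d → Fin k → Reg m n d k) (Q : List (Instr (RetrReg d k))) :
    List (Instr (Reg m n d k)) :=
  assignAll regScr (fun x : Fin d × Fin k => retrReg (.U x.1 x.2)) (fun x => .reg (U x.1 x.2)) ++
  (assignAll regScr (fun x : Fin d × Fin k => retrReg (.xi x.1 x.2))
      (fun x => .reg (xi x.1 x.2)) ++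
    mapBlock retrReg Q)

theorem length_retrCall (U xi : Fin d → Fin k → Reg m n d k) (Q : List (Instr (RetrReg d k))) :
    (retrCall U xi Q).length = 4 * (d * k) + Q.length := by
  simp [retrCall, length_assignAll, length_mapBlock]
  ring

/-- The subroutine is specified only on Stiefel points with tangent vectors, so these conditions
stay inside the claim until the gradient code has been shown to supply them. -/
theorem computes_retrCall {U xi : Fin d → Fin k → Reg m n d k} {Q : List (Instr (RetrReg d k))}
    {Retr : Matrix (Fin d) (Fin k) ℝ → Matrix (Fin d) (Fin k) ℝ → Matrix (Fin d) (Fin k) ℝ}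
    (hQ : ComputesRetr Q Retr) (hU : ∀ a b, (U a b).tag < 61) (hxi : ∀ a b, (xi a b).tag < 61) :
    Computes (retrCall U xi Q) 61 62 fun M => ∀ V ξ : Matrix (Fin d) (Fin k) ℝ, Stiefel V →
      Tangent V ξ → (∀ a b, M (U a b) = V a b) → (∀ a b, M (xi a b) = ξ a b) →
      ∀ (a : Fin d) (b : Fin k), M (.tmp 51 2 a b) = Retr V ξ a b := by
  intro M
  have hs : ∀ (r : RetrReg d k) s, (retrReg r : Reg m n d k) ≠ regScr s := fun r s =>
    ne_regScr_of_tag (by rw [tag_retrReg]; norm_num) s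
  have hr : ∀ r : Reg m n d k, r.tag < 61 → (∀ s, r ≠ regScr s) ∧ ∀ r', r ≠ retrReg r' := by
    intro r hr
    refine ⟨ne_regScr_of_tag (by omega), ?_⟩
    rintro r' rfl
    rw [tag_retrReg] at hr
    omega
  obtain ⟨a₁, a₂⟩ := run_assignAll (scr := regScr) regScr_injective
    (dst := fun x : Fin d × Fin k => (retrReg (.U x.1 x.2) : Reg m n d k))
    (e := fun x => .reg (U x.1 x.2))
    (fun x y h => by simpa [Prod.ext_iff] using retrReg_injective h) (fun x => hs _)
    (fun x => ⟨(hr _ (hU _ _)).1, fun y => (hr _ (hU _ _)).2 _⟩) M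
  set M₁ := runBlock (assignAll regScr (fun x : Fin d × Fin k =>
    (retrReg (.U x.1 x.2) : Reg m n d k)) (fun x => .reg (U x.1 x.2))) M with hM₁
  obtain ⟨b₁, b₂⟩ := run_assignAll (scr := regScr) regScr_injective
    (dst := fun x : Fin d × Fin k => (retrReg (.xi x.1 x.2) : Reg m n d k))
    (e := fun x => .reg (xi x.1 x.2))
    (fun x y h => by simpa [Prod.ext_iff] using retrReg_injective h) (fun x => hs _)
    (fun x => ⟨(hr _ (hxi _ _)).1, fun y => (hr _ (hxi _ _)).2 _⟩) M₁
  set M₂ := runBlock (assignAll regScr (fun x : Fin d × Fin k =>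
    (retrReg (.xi x.1 x.2) : Reg m n d k)) (fun x => .reg (xi x.1 x.2))) M₁ with hM₂
  obtain ⟨c₁, c₂⟩ := run_mapBlock (retrReg_injective (m := m) (n := n)) Q M₂
  have hrun : runBlock (retrCall U xi Q) M = runBlock (mapBlock retrReg Q) M₂ := by
    rw [retrCall, runBlock_append, runBlock_append]
  have hfr : ∀ r : Reg m n d k, r.tag < 61 → runBlock (retrCall U xi Q) M r = M r := by
    intro r h
    rw [hrun, c₂ r (hr r h).2, b₂ r (hr r h).1 fun _ => (hr r h).2 _,
      a₂ r (hr r h).1 fun _ => (hr r h).2 _]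
  refine ⟨hfr, fun M' hM' V ξ hV hξ h1 h2 a b => ?_⟩
  have h1' : ∀ a b, M (U a b) = V a b := fun a b => by
    rw [← h1, hM' _ ((hU a b).trans (by norm_num)), hfr _ (hU a b)]
  have h2' : ∀ a b, M (xi a b) = ξ a b := fun a b => by
    rw [← h2, hM' _ ((hxi a b).trans (by norm_num)), hfr _ (hxi a b)]
  rw [hM' _ (by simp [Reg.tag]), hrun]
  refine (c₁ (.out a b)).trans (hQ V ξ _ hV hξ (fun a b => ?_) (fun a b => ?_) a b)
  · rw [Function.comp_apply, b₂ _ (hs _) fun x h => by simpa using retrReg_injective h]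
    rw [a₁ (a, b), Expr.eval_reg, h1']
  · rw [Function.comp_apply, b₁ (a, b), Expr.eval_reg,
      a₂ _ (hr _ (hxi _ _)).1 fun _ => (hr _ (hxi _ _)).2 _, h2']

/-! ### The RBCD program -/

/-- An integer constant. -/
def lit (z : ℤ) : Expr (Reg m n d k) := .const z

/-- The value of a register. -/
def rd (r : Reg m n d k) : Expr (Reg m n d k) := .reg r

/-- The value of a scratch register. -/
def tmp (name i j l : ℕ) : Expr (Reg m n d k) := .reg (.tmp name i j l)

/-- The code for the entries of `ζ`, with dual variables from the given registers. -/
noncomputable def zetaCode (name : ℕ) (u v : Fin m → Fin n → Expr (Reg m n d k)) :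
    List (Instr (Reg m n d k)) :=
  arr3 name fun (l : Fin m) (i j : Fin n) =>
    ((lit 0 - tmp 3 l i j) / tmp 6 0 0 0 + u l i + v l j).exp

/-- The code for the projected points, the projected costs, and the parameters. -/
noncomputable def setupCode : List (Instr (Reg m n d k)) :=
  -- A copy of U_t, which the output needs after the register has been overwritten by U_{t+1}.
  arr2 0 (fun (a : Fin d) (b : Fin k) => rd (.U a b)) ++
  (arr3 1 (fun (l : Fin m) (i : Fin n) (b : Fin k) =>
    .sum fun a : Fin d => rd (.U a b) * rd (.X l i a)) ++
  (arr2 2 (fun (j : Fin n) (b : Fin k) => .sum fun a : Fin d => rd (.U a b) * rd (.Y j a)) ++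
  (arr3 3 (fun (l : Fin m) (i j : Fin n) => .sum fun b : Fin k =>
    (tmp 1 l i b - tmp 2 j b 0) * (tmp 1 l i b - tmp 2 j b 0)) ++
  -- This computation of c̄ is the source of the term mn²d.
  (arr0 4 (.maxs fun l : Fin m => .maxs fun i : Fin n => .maxs fun j : Fin n =>
    .sum fun a : Fin d => (rd (.X l i a) - rd (.Y j a)) * (rd (.X l i a) - rd (.Y j a))) ++
  (arr0 5 (.mins fun l : Fin m => rd (.w l)) ++
  arr0 6 (rd .eps / (lit 4 * (lit n).log + lit 2)))))))

/-- The code for the new dual variables. -/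
noncomputable def dualCode : List (Instr (Reg m n d k)) :=
  zetaCode 7 (fun l i => rd (.u l i)) (fun l j => rd (.v l j)) ++
  (arr2 8 (fun (l : Fin m) (i : Fin n) =>
    rd (.u l i) + (rd (.p l i) / Expr.sum fun j : Fin n => tmp 7 l i j).log) ++
  (zetaCode 9 (fun l i => tmp 8 l i 0) (fun l j => rd (.v l j)) ++
  (arr2 10 (fun (l : Fin m) (j : Fin n) => .sum fun i : Fin n => tmp 9 l i j) ++
  (arr1 11 (fun j : Fin n => (Expr.sum fun l : Fin m => rd (.w l) * (tmp 10 l j 0).log).exp) ++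
  (arr1 12 (fun j : Fin n => .sum fun l : Fin m => rd (.w l) * tmp 10 l j 0) ++
  (arr2 13 (fun (l : Fin m) (j : Fin n) => rd (.v l j) + (tmp 11 j 0 0 / tmp 10 l j 0).log) ++
  zetaCode 14 (fun l i => tmp 8 l i 0) (fun l j => tmp 13 l j 0)))))))

/-- The code for the Riemannian gradient. -/
noncomputable def gradCode : List (Instr (Reg m n d k)) :=
  arr1 15 (fun l : Fin m => .sum fun i : Fin n => .sum fun j : Fin n => tmp 14 l i j) ++
  (arr3 16 (fun (l : Fin m) (i j : Fin n) => rd (.w l) * (tmp 14 l i j / tmp 15 l 0 0)) ++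
  -- The weighted projected differences are summed over j for each x, and below over (l, i) for each
  -- y, in O(mn²k). Only these sums are multiplied by the d-dimensional points, in O(mndk).
  (arr3 17 (fun (l : Fin m) (i : Fin n) (b : Fin k) => .sum fun j : Fin n =>
    tmp 16 l i j * (tmp 1 l i b - tmp 2 j b 0)) ++
  (arr2 18 (fun (j : Fin n) (b : Fin k) => .sum fun l : Fin m => .sum fun i : Fin n =>
    tmp 16 l i j * (tmp 1 l i b - tmp 2 j b 0)) ++
  (arr2 19 (fun (a : Fin d) (b : Fin k) => (lit 0 - lit 2 / tmp 6 0 0 0) *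
    ((Expr.sum fun l : Fin m => .sum fun i : Fin n => rd (.X l i a) * tmp 17 l i b) -
      Expr.sum fun j : Fin n => rd (.Y j a) * tmp 18 j b 0)) ++
  (arr2 20 (fun (b c : Fin k) => (Expr.sum fun a : Fin d => rd (.U a b) * tmp 19 a c 0) +
    Expr.sum fun a : Fin d => tmp 19 a b 0 * rd (.U a c)) ++
  arr2 21 (fun (a : Fin d) (b : Fin k) => tmp 19 a b 0 -
    lit 1 / lit 2 * Expr.sum fun c : Fin k => rd (.U a c) * tmp 20 c b 0))))))

/-- The code for the step size, the tangent vector, and the stopping test. -/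
noncomputable def testCode : List (Instr (Reg m n d k)) :=
  arr0 22 (lit 1 / (lit 4 * rd .L₂ * tmp 4 0 0 0 / tmp 6 0 0 0 +
    (lit 2 * tmp 4 0 0 0 / tmp 6 0 0 0 +
      lit 4 * (tmp 4 0 0 0 * tmp 4 0 0 0) / (tmp 6 0 0 0 * tmp 6 0 0 0)) *
      (rd .L₁ * rd .L₁))) ++
  (arr2 23 (fun (a : Fin d) (b : Fin k) => (lit 0 - tmp 22 0 0 0) * tmp 21 a b 0) ++
  (arr0 24 (Expr.sum fun l : Fin m => rd (.w l) * Expr.sum fun j : Fin n =>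
    (tmp 10 l j 0 - tmp 12 j 0 0).abs) ++
  (arr0 25 (Expr.sum fun a : Fin d => .sum fun b : Fin k => tmp 21 a b 0 * tmp 21 a b 0).sqrt ++
  assignAll regScr (fun _ : Unit => .flag) fun _ =>
    (tmp 24 0 0 0).le
      (tmp 5 0 0 0 * (tmp 5 0 0 0).sqrt * rd .eps / (lit 12 * tmp 4 0 0 0)) *
    (tmp 6 0 0 0 * tmp 25 0 0 0).le (rd .eps / lit 3))))

/-- The code of one iteration up to the update of the iterate. -/
noncomputable def evalCode (Q : List (Instr (RetrReg d k))) : List (Instr (Reg m n d k)) :=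
  setupCode ++ (dualCode ++ (gradCode ++ (testCode ++
    retrCall (fun a b => .U a b) (fun a b => .tmp 23 a b 0) Q)))

/-- The update of the iterate. -/
noncomputable def updateCode : List (Instr (Reg m n d k)) :=
  assignAll regScr (fun x : Fin m × Fin n => .u x.1 x.2) (fun x => tmp 8 x.1 x.2 0) ++
  (assignAll regScr (fun x : Fin m × Fin n => .v x.1 x.2) (fun x => tmp 13 x.1 x.2 0) ++
  assignAll regScr (fun x : Fin d × Fin k => .U x.1 x.2) (fun x => tmp 51 2 x.1 x.2))

/-- The rounding and the output. -/
noncomputable def outputCode : List (Instr (Reg m n d k)) :=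
  arr1 60 (fun l : Fin m => .sum fun i : Fin n => .sum fun j : Fin n => tmp 9 l i j) ++
  (arr3 61 (fun (l : Fin m) (i j : Fin n) => tmp 9 l i j / tmp 60 l 0 0) ++
  (arr2 62 (fun (l : Fin m) (i : Fin n) => .sum fun j : Fin n => tmp 61 l i j) ++
  (arr3 63 (fun (l : Fin m) (i j : Fin n) =>
    (rd (.p l i) / tmp 62 l i 0).min (lit 1) * tmp 61 l i j) ++
  (arr2 64 (fun (l : Fin m) (j : Fin n) => .sum fun i : Fin n => tmp 63 l i j) ++
  (arr3 65 (fun (l : Fin m) (i j : Fin n) =>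
    tmp 63 l i j * (tmp 12 j 0 0 / tmp 64 l j 0).min (lit 1)) ++
  (arr2 66 (fun (l : Fin m) (i : Fin n) =>
    rd (.p l i) - Expr.sum fun j : Fin n => tmp 65 l i j) ++
  (arr2 67 (fun (l : Fin m) (j : Fin n) => tmp 12 j 0 0 - Expr.sum fun i : Fin n => tmp 65 l i j) ++
  (arr1 68 (fun l : Fin m => .sum fun i : Fin n => (tmp 66 l i 0).abs) ++
  (assignAll regScr (fun j : Fin n => .qOut j) (fun j => tmp 12 j 0 0) ++
  (assignAll regScr (fun x : Fin d × Fin k => .UOut x.1 x.2) (fun x => tmp 0 x.1 x.2 0) ++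
  assignAll regScr (fun x : Fin m × Fin n × Fin n => .planOut x.1 x.2.1 x.2.2) (fun x =>
    tmp 65 x.1 x.2.1 x.2.2 + tmp 66 x.1 x.2.1 0 * tmp 67 x.1 x.2.2 0 / tmp 68 x.1 0 0)))))))))))

/-- The RBCD program with the retraction subroutine `Q`. -/
noncomputable def rbcdProgram (Q : List (Instr (RetrReg d k))) : LoopProgram (Reg m n d k) where
  -- The input registers already hold the initial iterate, and all parameters are recomputed in the
  -- body.
  init := []
  body := evalCode Q ++ updateCode
  final := outputCode

/-! ### Operation counts -/

section length

/-- Every monomial in the operation counts is dominated by one of the four leading ones. -/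
theorem monomial_le (hm : 1 ≤ m) (hn : 1 ≤ n) (hk : 1 ≤ k) (hd : 1 ≤ d) {a₁ a₂ a₃ a₄ : ℕ}
    (h₁ : a₁ ≤ 1) (h₂ : a₂ ≤ 1) (h₃ : a₃ ≤ 1) (h₄ : a₄ ≤ 1) :
    m ^ a₁ * n ^ a₂ * d ^ a₃ * k ^ a₄ ≤ m * n * d * k := by
  have h : ∀ {x a : ℕ}, 1 ≤ x → a ≤ 1 → x ^ a ≤ x := fun hx ha => by
    simpa using Nat.pow_le_pow_right hx ha
  exact Nat.mul_le_mul (Nat.mul_le_mul (Nat.mul_le_mul (h hm h₁) (h hn h₂)) (h hd h₃)) (h hk h₄)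

/-- The four monomials come from projecting the points, pairing them, computing c̄, and the tangent
projection. Once lower monomials are dominated, the estimate is linear in the monomials. -/
theorem length_rbcd_body_le (hm : 1 ≤ m) (hn : 1 ≤ n) (hk : 1 ≤ k) (hd : 1 ≤ d)
    (Q : List (Instr (RetrReg d k))) :
    (rbcdProgram (m := m) (n := n) Q).body.length + 1 ≤
      1000 * (m * n * d * k + m * n ^ 2 * k + m * n ^ 2 * d + d * k ^ 2) + Q.length := by
  have M : ∀ {a₁ a₂ a₃ a₄ : ℕ}, a₁ ≤ 1 → a₂ ≤ 1 → a₃ ≤ 1 → a₄ ≤ 1 →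
      m ^ a₁ * n ^ a₂ * d ^ a₃ * k ^ a₄ ≤ m * n * d * k := monomial_le hm hn hk hd
  have e₀ : 1 ≤ m * n * d * k := by simpa using @M 0 0 0 0
  have e₁ : m ≤ m * n * d * k := by simpa using @M 1 0 0 0
  have e₂ : n ≤ m * n * d * k := by simpa using @M 0 1 0 0
  have e₃ : m * n ≤ m * n * d * k := by simpa using @M 1 1 0 0
  have e₄ : d * k ≤ m * n * d * k := by simpa using @M 0 0 1 1
  have e₅ : d ≤ m * n * d * k := by simpa using @M 0 0 1 0
  have e₆ : n * k ≤ m * n * d * k := by simpa using @M 0 1 0 1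
  have e₇ : m * n * k ≤ m * n * d * k := by simpa using @M 1 1 0 1
  have e₈ : n * d * k ≤ m * n * d * k := by simpa using @M 0 1 1 1
  have e₉ : m * n ^ 2 ≤ m * n ^ 2 * k := Nat.le_mul_of_pos_right _ hk
  have e₁₀ : k ^ 2 ≤ d * k ^ 2 := Nat.le_mul_of_pos_left _ hd
  have e₁₁ : m * d * k ≤ m * n * d * k := by simpa using @M 1 0 1 1
  simp only [rbcdProgram, evalCode, updateCode, setupCode, dualCode, gradCode, testCode, zetaCode,
    length_arr0, length_arr1, length_arr2, length_arr3, length_assignAll, length_retrCall, lit, tmp,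
    rd, List.length_append, Expr.cost_reg, Expr.cost_const, Expr.cost_add, Expr.cost_sub,
    Expr.cost_mul, Expr.cost_div, Expr.cost_exp, Expr.cost_log, Expr.cost_sqrt, Expr.cost_le,
    Expr.cost_abs, Expr.cost_sum, Expr.cost_maxs, Expr.cost_mins, Finset.sum_const,
    Finset.card_univ, Fintype.card_fin, Fintype.card_prod, Fintype.card_unit, smul_eq_mul]
  ring_nf at *
  omega

theorem length_rbcd_final_le (hm : 1 ≤ m) (hn : 1 ≤ n) (hk : 1 ≤ k) (hd : 1 ≤ d)
    (Q : List (Instr (RetrReg d k))) :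
    (rbcdProgram (m := m) (n := n) Q).final.length ≤
      1000 * (m * n * d * k + m * n ^ 2 * k + m * n ^ 2 * d + d * k ^ 2) := by
  have M : ∀ {a₁ a₂ a₃ a₄ : ℕ}, a₁ ≤ 1 → a₂ ≤ 1 → a₃ ≤ 1 → a₄ ≤ 1 →
      m ^ a₁ * n ^ a₂ * d ^ a₃ * k ^ a₄ ≤ m * n * d * k := monomial_le hm hn hk hd
  have e₁ : m ≤ m * n * d * k := by simpa using @M 1 0 0 0
  have e₂ : n ≤ m * n * d * k := by simpa using @M 0 1 0 0
  have e₃ : m * n ≤ m * n * d * k := by simpa using @M 1 1 0 0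
  have e₄ : d * k ≤ m * n * d * k := by simpa using @M 0 0 1 1
  have e₉ : m * n ^ 2 ≤ m * n ^ 2 * k := Nat.le_mul_of_pos_right _ hk
  simp only [rbcdProgram, outputCode,
    length_arr1, length_arr2, length_arr3, length_assignAll, lit, tmp,
    rd, List.length_append, Expr.cost_reg, Expr.cost_const, Expr.cost_add, Expr.cost_sub,
    Expr.cost_mul, Expr.cost_div, Expr.cost_min,
    Expr.cost_abs, Expr.cost_sum, Finset.sum_const,
    Finset.card_univ, Fintype.card_fin, Fintype.card_prod, smul_eq_mul]
  ring_nf at *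
  omega

end length

/-! ### Correctness of the program -/

/-- The memory holds the input data and the iterate `s`. -/
structure HoldsInput (D : Problem m n d) (ε L₁ L₂ : ℝ) (s : Iterate m n d k)
    (M : Reg m n d k → ℝ) : Prop where
  X : ∀ l i a, M (.X l i a) = D.X l i a
  Y : ∀ j a, M (.Y j a) = D.Y j a
  p : ∀ l i, M (.p l i) = D.p l i
  w : ∀ l, M (.w l) = D.w l
  eps : M .eps = ε
  L₁ : M .L₁ = L₁
  L₂ : M .L₂ = L₂
  u : ∀ l i, M (.u l i) = s.u l i
  v : ∀ l j, M (.v l j) = s.v l j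
  U : ∀ a b, M (.U a b) = s.U a b

/-- The memory holds the projected points, the projected costs, and the parameters. -/
structure HoldsSetup (D : Problem m n d) (ε : ℝ) (s : Iterate m n d k)
    (M : Reg m n d k → ℝ) : Prop where
  U : ∀ (a : Fin d) (b : Fin k), M (.tmp 0 a b 0) = s.U a b
  diff : ∀ (l : Fin m) (i j : Fin n) (b : Fin k),
    M (.tmp 1 l i b) - M (.tmp 2 j b 0) = D.projVec s.U l i j b
  cost : ∀ (l : Fin m) (i j : Fin n), M (.tmp 3 l i j) = D.projCost s.U l i j
  cbar : M (.tmp 4 0 0 0) = D.cbar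
  wmin : M (.tmp 5 0 0 0) = D.wmin
  eta : M (.tmp 6 0 0 0) = etaPar n ε

/-- The memory holds the new dual variables and the vectors used for them. -/
structure HoldsDual (D : Problem m n d) (η : ℝ) (s : Iterate m n d k)
    (M : Reg m n d k → ℝ) : Prop where
  u : ∀ (l : Fin m) (i : Fin n), M (.tmp 8 l i 0) = D.uNext η s l i
  zeta : ∀ (l : Fin m) (i j : Fin n), M (.tmp 9 l i j) = D.zeta η (D.uNext η s) s.v s.U l i j
  qCol : ∀ (l : Fin m) (j : Fin n), M (.tmp 10 l j 0) = D.qCol η s l j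
  qBar : ∀ (j : Fin n), M (.tmp 12 j 0 0) = D.qBar η s j
  v : ∀ (l : Fin m) (j : Fin n), M (.tmp 13 l j 0) = D.vNext η s l j
  zeta' : ∀ (l : Fin m) (i j : Fin n),
    M (.tmp 14 l i j) = D.zeta η (D.uNext η s) (D.vNext η s) s.U l i j

theorem computes_setupCode {D : Problem m n d} (hv : D.Valid) (hm : 1 ≤ m) {ε L₁ L₂ : ℝ}
    {s : Iterate m n d k} : Computes setupCode 10 17 fun M =>
      HoldsInput D ε L₁ L₂ s M → HoldsSetup D ε s M := by
  unfold setupCode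
  refine Computes.mono (Computes.append (computes_arr2 rfl (by norm_num) ?_)
    (Computes.append (computes_arr3 rfl (by norm_num) ?_)
    (Computes.append (computes_arr2 rfl (by norm_num) ?_)
    (Computes.append (computes_arr3 rfl (by norm_num) ?_)
    (Computes.append (computes_arr0 rfl (by norm_num) ?_)
    (Computes.append (computes_arr0 rfl (by norm_num) ?_)
    (computes_arr0 rfl (by norm_num) ?_))))))) fun M ⟨h0, h1, h2, h3, h4, h5, h6⟩ hI => ?_
  all_goals try simp [Reg.tag, rd, tmp, lit]
  have hd : ∀ (l : Fin m) (i j : Fin n) (b : Fin k),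
      M (.tmp 1 l i b) - M (.tmp 2 j b 0) = D.projVec s.U l i j b := by
    intro l i j b
    rw [h1, h2, D.projVec_apply]
    simp [rd, hI.U, hI.X, hI.Y, mul_sub]
  refine ⟨fun a b => ?_, hd, fun l i j => ?_, ?_, ?_, ?_⟩
  · rw [h0, rd, Expr.eval_reg, hI.U]
  · rw [h3, D.projCost_eq, EuclideanSpace.norm_sq_eq]
    simp only [tmp, Expr.eval_sum, Expr.eval_mul, Expr.eval_sub, Expr.eval_reg, hd,
      Real.norm_eq_abs, sq_abs]
    exact Finset.sum_congr rfl fun b _ => (sq _).symm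
  · have e : ∀ l i j, Expr.eval M (.sum fun a : Fin d =>
        (rd (.X l i a) - rd (.Y j a)) * (rd (.X l i a) - rd (.Y j a))) = |D.cost l i j| := by
      intro l i j
      rw [abs_of_nonneg (D.cost_nonneg l i j)]
      simp [rd, hI.X, hI.Y, Problem.cost, sq]
    have e2 : ∀ l i, Expr.eval M (.maxs fun j => .sum fun a : Fin d =>
        (rd (.X l i a) - rd (.Y j a)) * (rd (.X l i a) - rd (.Y j a))) =
        ⨆ j, |D.cost l i j| := by
      intro l i
      rw [Expr.eval_maxs _ _ fun j => by rw [e]; exact abs_nonneg _]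
      simp only [e]
    have e3 : ∀ l, Expr.eval M (.maxs fun i => .maxs fun j => .sum fun a : Fin d =>
        (rd (.X l i a) - rd (.Y j a)) * (rd (.X l i a) - rd (.Y j a))) =
        ⨆ i, ⨆ j, |D.cost l i j| := by
      intro l
      rw [Expr.eval_maxs _ _ fun i => by
        rw [e2]; exact Real.iSup_nonneg fun _ => abs_nonneg _]
      simp only [e2]
    rw [h4, Expr.eval_maxs _ _ fun l => by
      rw [e3]; exact Real.iSup_nonneg fun _ => Real.iSup_nonneg fun _ => abs_nonneg _]
    simp only [e3, Problem.cbar]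
  · rw [h5, Expr.eval_mins _ hm _ fun l => by
      rw [rd, Expr.eval_reg, hI.w]; exact hv.w_le_one l]
    simp only [rd, Expr.eval_reg, hI.w, Problem.wmin]
  · rw [h6]
    simp [rd, lit, hI.eps, etaPar]

theorem computes_dualCode {D : Problem m n d} {ε L₁ L₂ : ℝ} {s : Iterate m n d k} :
    Computes dualCode 17 25 fun M => HoldsInput D ε L₁ L₂ s M → HoldsSetup D ε s M →
      HoldsDual D (etaPar n ε) s M := by
  unfold dualCode zetaCode
  refine Computes.mono (Computes.append (computes_arr3 rfl (by norm_num) ?_)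
    (Computes.append (computes_arr2 rfl (by norm_num) ?_)
    (Computes.append (computes_arr3 rfl (by norm_num) ?_)
    (Computes.append (computes_arr2 rfl (by norm_num) ?_)
    (Computes.append (computes_arr1 rfl (by norm_num) ?_)
    (Computes.append (computes_arr1 rfl (by norm_num) ?_)
    (Computes.append (computes_arr2 rfl (by norm_num) ?_)
    (computes_arr3 rfl (by norm_num) ?_))))))))
    fun M ⟨h7, h8, h9, h10, h11, h12, h13, h14⟩ hI hS => ?_
  all_goals try simp [Reg.tag, rd, tmp, lit]
  have u : ∀ (l : Fin m) (i : Fin n), M (.tmp 8 l i 0) = D.uNext (etaPar n ε) s l i := by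
    intro l i
    rw [h8]
    simp [rd, tmp, lit, hI.u, hI.v, hI.p, h7, hS.cost, hS.eta, Problem.uNext, Problem.zeta]
  have z : ∀ (l : Fin m) (i j : Fin n),
      M (.tmp 9 l i j) = D.zeta (etaPar n ε) (D.uNext (etaPar n ε) s) s.v s.U l i j := by
    intro l i j
    rw [h9]
    simp [rd, tmp, lit, hI.v, u, hS.cost, hS.eta, Problem.zeta]
  have q : ∀ (l : Fin m) (j : Fin n), M (.tmp 10 l j 0) = D.qCol (etaPar n ε) s l j := by
    intro l j
    rw [h10]
    simp [tmp, z, Problem.qCol]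
  have v : ∀ (l : Fin m) (j : Fin n), M (.tmp 13 l j 0) = D.vNext (etaPar n ε) s l j := by
    intro l j
    rw [h13]
    simp [rd, tmp, h11, hI.w, hI.v, q, Problem.vNext, Problem.qGeo]
  refine ⟨u, z, q, fun j => ?_, v, fun l i j => ?_⟩
  · rw [h12]
    simp [rd, tmp, hI.w, q, Problem.qBar]
  · rw [h14]
    simp [tmp, lit, u, v, hS.cost, hS.eta, Problem.zeta]

theorem computes_gradCode {D : Problem m n d} (hn : 0 < n) {ε L₁ L₂ : ℝ} {s : Iterate m n d k} :
    Computes gradCode 25 32 fun M => HoldsInput D ε L₁ L₂ s M → HoldsSetup D ε s M →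
      HoldsDual D (etaPar n ε) s M → ∀ (a : Fin d) (b : Fin k),
        M (.tmp 21 a b 0) = D.gradStep (etaPar n ε) s a b := by
  unfold gradCode
  refine Computes.mono (Computes.append (computes_arr1 rfl (by norm_num) ?_)
    (Computes.append (computes_arr3 rfl (by norm_num) ?_)
    (Computes.append (computes_arr3 rfl (by norm_num) ?_)
    (Computes.append (computes_arr2 rfl (by norm_num) ?_)
    (Computes.append (computes_arr2 rfl (by norm_num) ?_)
    (Computes.append (computes_arr2 rfl (by norm_num) ?_)
    (computes_arr2 rfl (by norm_num) ?_)))))))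
    fun M ⟨h15, h16, h17, h18, h19, h20, h21⟩ hI hS hD a b => ?_
  all_goals try simp [Reg.tag, rd, tmp, lit]
  set η := etaPar n ε with hη
  set Z := eucGrad (fun V => D.g η (D.uNext η s) (D.vNext η s) V) s.U with hZ
  have w : ∀ (l : Fin m) (i j : Fin n), M (.tmp 16 l i j) =
      D.w l * D.plan η (D.uNext η s) (D.vNext η s) s.U l i j := by
    intro l i j
    rw [h16]
    simp [rd, tmp, hI.w, h15, hD.zeta', Problem.plan]
  have g : ∀ (a : Fin d) (b : Fin k), M (.tmp 19 a b 0) = Z a b := by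
    intro a b
    rw [h19, hZ, D.eucGrad_g hn]
    simp only [rd, tmp, lit, Expr.eval_mul, Expr.eval_sub, Expr.eval_div, Expr.eval_const,
      Expr.eval_sum, Expr.eval_reg, hI.X, hI.Y, h17, h18, hS.eta, hS.diff, w, ← hη,
      Matrix.smul_apply, Problem.planGrad, Matrix.sum_apply, Problem.costGrad, Matrix.of_apply,
      smul_eq_mul, Int.cast_zero, Int.cast_ofNat]
    -- Undoes the regrouping of the y-part, so that both parts are sums over (l, i, j).
    have e : ∑ j, D.Y j a * ∑ l, ∑ i, D.w l *
        D.plan η (D.uNext η s) (D.vNext η s) s.U l i j * D.projVec s.U l i j b =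
        ∑ l, ∑ i, ∑ j, D.Y j a * (D.w l *
          D.plan η (D.uNext η s) (D.vNext η s) s.U l i j * D.projVec s.U l i j b) := by
      simp only [Finset.mul_sum]
      rw [Finset.sum_comm]
      exact Finset.sum_congr rfl fun l _ => Finset.sum_comm
    rw [e, ← Finset.sum_sub_distrib]
    simp only [← Finset.sum_sub_distrib, Finset.mul_sum]
    refine Finset.sum_congr rfl fun l _ => Finset.sum_congr rfl fun i _ =>
      Finset.sum_congr rfl fun j _ => ?_
    ring
  have hH : ∀ b c : Fin k, M (.tmp 20 b c 0) = (s.Uᵀ * Z + Zᵀ * s.U) b c := by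
    intro b c
    rw [h20]
    simp [rd, tmp, hI.U, g, Matrix.mul_apply]
  rw [h21, Problem.gradStep, riemGrad, ← hZ, tangentProj]
  simp only [rd, tmp, lit, Expr.eval_mul, Expr.eval_sub, Expr.eval_div, Expr.eval_const,
    Expr.eval_sum, Expr.eval_reg, hI.U, g, hH, Matrix.sub_apply, Matrix.smul_apply,
    smul_eq_mul, Int.cast_one, Int.cast_ofNat]
  rw [Matrix.mul_apply]

open Classical in
theorem computes_testCode {D : Problem m n d} (hv : D.Valid) (hm : 1 ≤ m) {ε L₁ L₂ : ℝ}
    {s : Iterate m n d k} :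
    Computes testCode 32 61 fun M => HoldsInput D ε L₁ L₂ s M → HoldsSetup D ε s M →
      HoldsDual D (etaPar n ε) s M →
      (∀ (a : Fin d) (b : Fin k), M (.tmp 21 a b 0) = D.gradStep (etaPar n ε) s a b) →
      (∀ (a : Fin d) (b : Fin k), M (.tmp 23 a b 0) =
        (-(D.tau ε L₁ L₂) • D.gradStep (etaPar n ε) s) a b) ∧
      M .flag = if D.Stop ε s then 1 else 0 := by
  unfold testCode
  refine Computes.mono (Computes.append (computes_arr0 rfl (by norm_num) ?_)
    (Computes.append (computes_arr2 rfl (by norm_num) ?_)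
    (Computes.append (computes_arr0 rfl (by norm_num) ?_)
    (Computes.append (computes_arr0 rfl (by norm_num) ?_)
    (computes_assignAll (fun _ _ _ => rfl) (fun _ => rfl) (by norm_num [Reg.tag]) ?_)))))
    fun M ⟨h22, h23, h24, h25, h26⟩ hI hS hD hG => ?_
  all_goals try simp [Reg.tag, rd, tmp, lit]
  constructor
  · intro a b
    rw [h23]
    simp [tmp, lit, rd, h22, hI.L₁, hI.L₂, hS.cbar, hS.eta, hG, Problem.tau, Problem.rho, sq]
  · have e1 : M (.tmp 25 0 0 0) = frobNorm (D.gradStep (etaPar n ε) s) := by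
      rw [h25, frobNorm]
      simp [tmp, hG, sq]
    have e2 : M (.tmp 24 0 0 0) = ∑ l, D.w l * ∑ j,
        |D.qCol (etaPar n ε) s l j - D.qBar (etaPar n ε) s j| := by
      rw [h24]
      simp [rd, tmp, hI.w, hD.qCol, hD.qBar]
    rw [h26 ()]
    simp only [rd, tmp, lit, Expr.eval_mul, Expr.eval_le, Expr.eval_div, Expr.eval_sqrt,
      Expr.eval_const, Expr.eval_reg, e1, e2, hS.wmin, hS.eta, hS.cbar, hI.eps, Problem.Stop,
      Problem.rpow_three_halves (hv.wmin_pos hm).le, Int.cast_ofNat, mul_ite, mul_one, mul_zero]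
    split_ifs <;> first | rfl | tauto

open Classical in
theorem computes_evalCode {D : Problem m n d} (hv : D.Valid) (hm : 1 ≤ m) (hn : 0 < n)
    {ε L₁ L₂ : ℝ} {s : Iterate m n d k} (hs : Stiefel s.U)
    {Retr : Matrix (Fin d) (Fin k) ℝ → Matrix (Fin d) (Fin k) ℝ → Matrix (Fin d) (Fin k) ℝ}
    {Q : List (Instr (RetrReg d k))} (hQ : ComputesRetr Q Retr) :
    Computes (evalCode Q) 10 62 fun M => HoldsInput D ε L₁ L₂ s M → HoldsSetup D ε s M ∧
      HoldsDual D (etaPar n ε) s M ∧ (M .flag = if D.Stop ε s then 1 else 0) ∧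
      ∀ (a : Fin d) (b : Fin k), M (.tmp 51 2 a b) = (D.step Retr ε L₁ L₂ s).U a b := by
  unfold evalCode
  refine Computes.mono ((computes_setupCode (ε := ε) (L₁ := L₁) (L₂ := L₂) (s := s) hv hm).append
    (computes_dualCode (D := D) (ε := ε) (L₁ := L₁) (L₂ := L₂) (s := s) |>.append
    ((computes_gradCode (D := D) (ε := ε) (L₁ := L₁) (L₂ := L₂) (s := s) hn).append
    ((computes_testCode (ε := ε) (L₁ := L₁) (L₂ := L₂) (s := s) hv hm).append
    (computes_retrCall hQ (fun _ _ => by norm_num [Reg.tag]) fun _ _ => by norm_num [Reg.tag])))))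
    fun M ⟨h1, h2, h3, h4, h5⟩ hI => ?_
  have hS := h1 hI
  have hD := h2 hI hS
  have hG := h3 hI hS hD
  obtain ⟨hξ, hf⟩ := h4 hI hS hD hG
  exact ⟨hS, hD, hf, h5 _ _ hs (Problem.tangent_gradStep hs _) hI.U hξ⟩

/-- The memory holds what the output block needs when the iteration started from `s`. -/
structure HoldsSaved (D : Problem m n d) (ε : ℝ) (s : Iterate m n d k)
    (M : Reg m n d k → ℝ) : Prop where
  p : ∀ l i, M (.p l i) = D.p l i
  U : ∀ (a : Fin d) (b : Fin k), M (.tmp 0 a b 0) = s.U a b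
  zeta : ∀ (l : Fin m) (i j : Fin n),
    M (.tmp 9 l i j) = D.zeta (etaPar n ε) (D.uNext (etaPar n ε) s) s.v s.U l i j
  qBar : ∀ (j : Fin n), M (.tmp 12 j 0 0) = D.qBar (etaPar n ε) s j

/-- The update overwrites the registers of lowest tag, against the order that `Computes` requires,
so its frame is stated separately. -/
theorem run_updateCode (M : Reg m n d k → ℝ) :
    (∀ l i, runBlock updateCode M (.u l i) = M (.tmp 8 l i 0)) ∧
    (∀ l j, runBlock updateCode M (.v l j) = M (.tmp 13 l j 0)) ∧
    (∀ a b, runBlock updateCode M (.U a b) = M (.tmp 51 2 a b)) ∧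
    ∀ r : Reg m n d k, r.tag ≠ 1010 → r.tag ≠ 7 → r.tag ≠ 8 → r.tag ≠ 9 →
      runBlock updateCode M r = M r := by
  simp only [updateCode, runBlock_append]
  obtain ⟨a₁, a₂⟩ := run_assignAll_of_tag
    (dst := fun x : Fin m × Fin n => (.u x.1 x.2 : Reg m n d k))
    (e := fun x => tmp 8 x.1 x.2 0) (N := 7) (fun x y h => by simpa [Prod.ext_iff] using h)
    (fun _ => rfl) (by norm_num) (fun _ => by simp [tmp, Reg.tag]) M
  generalize runBlock (assignAll regScr (fun x : Fin m × Fin n => (.u x.1 x.2 : Reg m n d k))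
    fun x => tmp 8 x.1 x.2 0) M = M₁ at *
  obtain ⟨b₁, b₂⟩ := run_assignAll_of_tag
    (dst := fun x : Fin m × Fin n => (.v x.1 x.2 : Reg m n d k))
    (e := fun x => tmp 13 x.1 x.2 0) (N := 8) (fun x y h => by simpa [Prod.ext_iff] using h)
    (fun _ => rfl) (by norm_num) (fun _ => by simp [tmp, Reg.tag]) M₁
  generalize runBlock (assignAll regScr (fun x : Fin m × Fin n => (.v x.1 x.2 : Reg m n d k))
    fun x => tmp 13 x.1 x.2 0) M₁ = M₂ at *
  obtain ⟨c₁, c₂⟩ := run_assignAll_of_tag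
    (dst := fun x : Fin d × Fin k => (.U x.1 x.2 : Reg m n d k))
    (e := fun x => tmp 51 2 x.1 x.2) (N := 9) (fun x y h => by simpa [Prod.ext_iff] using h)
    (fun _ => rfl) (by norm_num) (fun _ => by simp [tmp, Reg.tag]) M₂
  generalize runBlock (assignAll regScr (fun x : Fin d × Fin k => (.U x.1 x.2 : Reg m n d k))
    fun x => tmp 51 2 x.1 x.2) M₂ = M₃ at *
  refine ⟨fun l i => ?_, fun l j => ?_, fun a b => ?_, fun r h h7 h8 h9 => ?_⟩
  · rw [c₂ _ (by simp [Reg.tag]) (by simp [Reg.tag]), b₂ _ (by simp [Reg.tag]) (by simp [Reg.tag])]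
    exact a₁ (l, i)
  · rw [c₂ _ (by simp [Reg.tag]) (by simp [Reg.tag])]
    exact (b₁ (l, j)).trans (a₂ _ (by simp [Reg.tag]) (by simp [Reg.tag]))
  · refine (c₁ (a, b)).trans ((b₂ _ (by simp [Reg.tag]) (by simp [Reg.tag])).trans
      (a₂ _ (by simp [Reg.tag]) (by simp [Reg.tag])))
  · rw [c₂ r h h9, b₂ r h h8, a₂ r h h7]

open Classical in
-- After the body, the iterate registers belong to the next iterate, while the flag and the saved
-- arrays still refer to s.
theorem run_body {D : Problem m n d} (hv : D.Valid) (hm : 1 ≤ m) (hn : 0 < n)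
    {ε L₁ L₂ : ℝ} {s : Iterate m n d k} (hs : Stiefel s.U)
    {Retr : Matrix (Fin d) (Fin k) ℝ → Matrix (Fin d) (Fin k) ℝ → Matrix (Fin d) (Fin k) ℝ}
    {Q : List (Instr (RetrReg d k))} (hQ : ComputesRetr Q Retr) {M : Reg m n d k → ℝ}
    (hM : HoldsInput D ε L₁ L₂ s M) :
    let M' := runBlock (rbcdProgram Q).body M
    HoldsInput D ε L₁ L₂ (D.step Retr ε L₁ L₂ s) M' ∧ HoldsSaved D ε s M' ∧
      M' .flag = if D.Stop ε s then 1 else 0 := by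
  simp only [rbcdProgram, runBlock_append]
  obtain ⟨h1, h2⟩ := computes_evalCode (ε := ε) (L₁ := L₁) (L₂ := L₂) hv hm hn hs hQ M
  have h3 := h2 _ fun _ _ => rfl
  generalize runBlock (evalCode Q) M = M₁ at *
  have hI : HoldsInput D ε L₁ L₂ s M₁ := by
    refine ⟨fun l i a => ?_, fun j a => ?_, fun l i => ?_, fun l => ?_, ?_, ?_, ?_, fun l i => ?_,
      fun l j => ?_, fun a b => ?_⟩ <;> rw [h1 _ (by simp [Reg.tag])]
    exacts [hM.X .., hM.Y .., hM.p .., hM.w .., hM.eps, hM.L₁, hM.L₂, hM.u .., hM.v .., hM.U ..]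
  obtain ⟨hS, hD, hf, hU⟩ := h3 hI
  obtain ⟨u1, u2, u3, u4⟩ := run_updateCode M₁
  generalize runBlock updateCode M₁ = M₂ at *
  have u5 : ∀ r : Reg m n d k, r.tag ∉ [1010, 7, 8, 9] → M₂ r = M₁ r := fun r h => by
    simp only [List.mem_cons, List.not_mem_nil, or_false, not_or] at h
    exact u4 r h.1 h.2.1 h.2.2.1 h.2.2.2
  refine ⟨⟨fun l i a => ?_, fun j a => ?_, fun l i => ?_, fun l => ?_, ?_, ?_, ?_, fun l i => ?_,
      fun l j => ?_, fun a b => ?_⟩, ⟨fun l i => ?_, fun a b => ?_, fun l i j => ?_, fun j => ?_⟩,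
      ?_⟩
  · rw [u5 _ (by simp [Reg.tag]), hI.X]
  · rw [u5 _ (by simp [Reg.tag]), hI.Y]
  · rw [u5 _ (by simp [Reg.tag]), hI.p]
  · rw [u5 _ (by simp [Reg.tag]), hI.w]
  · rw [u5 _ (by simp [Reg.tag]), hI.eps]
  · rw [u5 _ (by simp [Reg.tag]), hI.L₁]
  · rw [u5 _ (by simp [Reg.tag]), hI.L₂]
  · rw [u1, hD.u]; rfl
  · rw [u2, hD.v]; rfl
  · rw [u3, hU]
  · rw [u5 _ (by simp [Reg.tag]), hI.p]
  · rw [u5 _ (by simp [Reg.tag]), hS.U]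
  · rw [u5 _ (by simp [Reg.tag]), hD.zeta]
  · rw [u5 _ (by simp [Reg.tag]), hD.qBar]
  · rw [u5 _ (by simp [Reg.tag]), hf]

theorem computes_outputCode {D : Problem m n d} {ε : ℝ} {s : Iterate m n d k} :
    Computes outputCode 70 103 fun M => HoldsSaved D ε s M →
      HoldsOutput M (D.qBar (etaPar n ε) s) s.U (D.planOut ε s) := by
  unfold outputCode
  refine Computes.mono (Computes.append (computes_arr1 rfl (by norm_num) ?_)
    (Computes.append (computes_arr3 rfl (by norm_num) ?_)
    (Computes.append (computes_arr2 rfl (by norm_num) ?_)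
    (Computes.append (computes_arr3 rfl (by norm_num) ?_)
    (Computes.append (computes_arr2 rfl (by norm_num) ?_)
    (Computes.append (computes_arr3 rfl (by norm_num) ?_)
    (Computes.append (computes_arr2 rfl (by norm_num) ?_)
    (Computes.append (computes_arr2 rfl (by norm_num) ?_)
    (Computes.append (computes_arr1 rfl (by norm_num) ?_)
    (Computes.append (N₁ := 101) (N₂ := 101)
      (computes_assignAll (fun x y h => by simpa using h) (fun _ => rfl) (by norm_num [Reg.tag]) ?_)
    (Computes.append (N₁ := 102) (N₂ := 102)
      (computes_assignAll (fun x y h => by simpa [Prod.ext_iff] using h) (fun _ => rfl)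
        (by norm_num [Reg.tag]) ?_)
    (computes_assignAll (fun x y h => by simpa [Prod.ext_iff] using h) (fun _ => rfl)
        (by norm_num [Reg.tag]) ?_))))))))))))
    fun M ⟨h60, h61, h62, h63, h64, h65, h66, h67, h68, hq, hU, hP⟩ hS => ?_
  all_goals try simp [Reg.tag, rd, tmp, lit]
  have p : ∀ (l : Fin m) (i j : Fin n), M (.tmp 61 l i j) =
      D.plan (etaPar n ε) (D.uNext (etaPar n ε) s) s.v s.U l i j := by
    intro l i j
    rw [h61]
    simp [tmp, h60, hS.zeta, Problem.plan]
  refine ⟨fun j => ?_, fun a b => ?_, fun l i j => ?_⟩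
  · rw [hq, tmp, Expr.eval_reg, hS.qBar]
  · refine (hU (a, b)).trans ?_
    rw [tmp, Expr.eval_reg, hS.U]
  · refine (hP (l, i, j)).trans ?_
    simp [rd, tmp, lit, h62, h63, h64, h65, h66, h67, h68, p, hS.p, hS.qBar, Problem.planOut,
      roundPlan]

/-! ### Complexity -/

/-- The inequality k ≤ n trades a factor k for n in mndk and in dk², and k ≤ d handles mn²k and k³.
-/
theorem setup_monomials_le_of_le (hm : 1 ≤ m) (hkn : k ≤ n) (hkd : k ≤ d) :
    m * n * d * k + m * n ^ 2 * k + m * n ^ 2 * d + d * k ^ 2 ≤ 4 * (m * n ^ 2 * d) ∧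
      d * k ^ 2 + k ^ 3 ≤ 2 * (m * n ^ 2 * d) := by
  have h1 : m * n * d * k ≤ m * n ^ 2 * d := by
    calc m * n * d * k ≤ m * n * d * n := Nat.mul_le_mul_left _ hkn
      _ = m * n ^ 2 * d := by ring
  have h2 : m * n ^ 2 * k ≤ m * n ^ 2 * d := Nat.mul_le_mul_left _ hkd
  have h3 : d * k ^ 2 ≤ m * n ^ 2 * d := by
    calc d * k ^ 2 ≤ d * n ^ 2 := Nat.mul_le_mul_left _ (Nat.pow_le_pow_left hkn 2)
      _ ≤ m * (d * n ^ 2) := Nat.le_mul_of_pos_left _ hm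
      _ = m * n ^ 2 * d := by ring
  have h4 : k ^ 3 ≤ d * k ^ 2 := by
    calc k ^ 3 = k * k ^ 2 := by ring
      _ ≤ d * k ^ 2 := Nat.mul_le_mul_right _ hkd
  omega

theorem setup_monomials_le (hk : 1 ≤ k) (hkd : k ≤ d) (hn : 1 ≤ n) :
    m * n * d * k + m * n ^ 2 * k + m * n ^ 2 * d + d * k ^ 2 ≤
        4 * (m * n ^ 2 * d * k + d * k ^ 2) ∧
      d * k ^ 2 + k ^ 3 ≤ 2 * (m * n ^ 2 * d * k + d * k ^ 2) := by
  have h1 : m * n * d * k ≤ m * n ^ 2 * d * k := by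
    calc m * n * d * k ≤ m * n * d * k * n := Nat.le_mul_of_pos_right _ hn
      _ = m * n ^ 2 * d * k := by ring
  have h2 : m * n ^ 2 * k ≤ m * n ^ 2 * d * k := by
    rw [mul_assoc _ d k]
    exact Nat.mul_le_mul_left _ (Nat.le_mul_of_pos_left _ (hk.trans hkd))
  have h3 : m * n ^ 2 * d ≤ m * n ^ 2 * d * k := Nat.le_mul_of_pos_right _ hk
  have h4 : k ^ 3 ≤ d * k ^ 2 := by
    calc k ^ 3 = k * k ^ 2 := by ring
      _ ≤ d * k ^ 2 := Nat.mul_le_mul_right _ hkd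
  omega

theorem iterOps_le_of_monomials (hm : 1 ≤ m) (hn : 1 ≤ n) (hk : 1 ≤ k) (hkd : k ≤ d) {K : ℝ}
    {Q : List (Instr (RetrReg d k))} (hQ : (Q.length : ℝ) ≤ K * ((d : ℝ) * k ^ 2 + k ^ 3)) {W : ℕ}
    (hW : m * n * d * k + m * n ^ 2 * k + m * n ^ 2 * d + d * k ^ 2 ≤ 4 * W ∧
      d * k ^ 2 + k ^ 3 ≤ 2 * W) :
    ((rbcdProgram (m := m) (n := n) Q).iterOps : ℝ) ≤ (4000 + 2 * |K|) * W := by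
  have h1 : (rbcdProgram (m := m) (n := n) Q).iterOps ≤ 4000 * W + Q.length :=
    (length_rbcd_body_le hm hn hk (hk.trans hkd) Q).trans (by omega)
  have h2 : ((rbcdProgram (m := m) (n := n) Q).iterOps : ℝ) ≤ 4000 * W + Q.length := by
    exact_mod_cast h1
  have h3 : (d : ℝ) * k ^ 2 + k ^ 3 ≤ 2 * W := by exact_mod_cast hW.2
  have h4 : K * ((d : ℝ) * k ^ 2 + k ^ 3) ≤ |K| * (2 * W) :=
    (mul_le_mul_of_nonneg_right (le_abs_self K) (by positivity)).trans
      (mul_le_mul_of_nonneg_left h3 (abs_nonneg K))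
  linarith

/-- A constant for all bounds on the number of iterations and of operations. -/
noncomputable def opsConst (K : ℝ) : ℝ :=
  4000 + 2 * |K| + |Problem.iterConst K| + |Problem.iterConst K| * (16000 + 4 * |K|)

theorem le_opsConst (K : ℝ) : 4000 + 2 * |K| ≤ opsConst K := by
  unfold opsConst
  have : 0 ≤ |Problem.iterConst K| + |Problem.iterConst K| * (16000 + 4 * |K|) := by positivity
  linarith

theorem iterConst_le_opsConst (K : ℝ) : Problem.iterConst K ≤ opsConst K := by
  unfold opsConst
  have h1 : 0 ≤ 4000 + 2 * |K| + |Problem.iterConst K| * (16000 + 4 * |K|) := by positivity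
  linarith [le_abs_self (Problem.iterConst K)]

theorem iterConst_mul_le_opsConst (K : ℝ) :
    Problem.iterConst K * (16000 + 4 * |K|) ≤ opsConst K := by
  unfold opsConst
  have h1 : 0 ≤ 4000 + 2 * |K| + |Problem.iterConst K| := by positivity
  have h2 : Problem.iterConst K * (16000 + 4 * |K|) ≤ |Problem.iterConst K| * (16000 + 4 * |K|) :=
    mul_le_mul_of_nonneg_right (le_abs_self _) (by positivity)
  linarith

/-- k ≤ mn² absorbs dk² into mn²dk. The output block costs at most 8000 such units and is charged to
the iterations, as T + 1 ≥ 1; hence 16000. -/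
theorem totalOps_le (hm : 1 ≤ m) (hn : 1 ≤ n) (hk : 1 ≤ k) (hkd : k ≤ d)
    (hkm : k ≤ m * n ^ 2) {K X : ℝ} {Q : List (Instr (RetrReg d k))}
    (hQ : (Q.length : ℝ) ≤ K * ((d : ℝ) * k ^ 2 + k ^ 3)) {T : ℕ} (hX : 0 ≤ X)
    (hT : (T : ℝ) + 1 ≤ Problem.iterConst K * X) :
    ((rbcdProgram (m := m) (n := n) Q).totalOps (T + 1) : ℝ) ≤
      opsConst K * (X * ((m : ℝ) * n ^ 2 * d * k)) := by
  have hdk : d * k ^ 2 ≤ m * n ^ 2 * d * k := by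
    calc d * k ^ 2 = k * (d * k) := by ring
      _ ≤ m * n ^ 2 * (d * k) := Nat.mul_le_mul_right _ hkm
      _ = m * n ^ 2 * d * k := by ring
  have hW := setup_monomials_le (m := m) hk hkd hn
  have h1 := iterOps_le_of_monomials hm hn hk hkd hQ hW
  have h2 : (rbcdProgram (m := m) (n := n) Q).final.length ≤ 4000 * (2 * (m * n ^ 2 * d * k)) :=
    (length_rbcd_final_le hm hn hk (hk.trans hkd) Q).trans (by omega)
  have h3 : ((rbcdProgram (m := m) (n := n) Q).final.length : ℝ) ≤
      4000 * (2 * ((m : ℝ) * n ^ 2 * d * k)) := by exact_mod_cast h2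
  have h4 : ((m * n ^ 2 * d * k + d * k ^ 2 : ℕ) : ℝ) ≤ 2 * ((m : ℝ) * n ^ 2 * d * k) := by
    have : m * n ^ 2 * d * k + d * k ^ 2 ≤ 2 * (m * n ^ 2 * d * k) := by omega
    exact_mod_cast this
  have h5 : ((rbcdProgram (m := m) (n := n) Q).iterOps : ℝ) ≤
      (8000 + 4 * |K|) * ((m : ℝ) * n ^ 2 * d * k) :=
    (h1.trans (mul_le_mul_of_nonneg_left h4 (by positivity))).trans (by linarith)
  have h6 : (0 : ℝ) ≤ (m : ℝ) * n ^ 2 * d * k := by positivity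
  have h7 : ((rbcdProgram (m := m) (n := n) Q).totalOps (T + 1) : ℝ) =
      ((T : ℝ) + 1) * (rbcdProgram (m := m) (n := n) Q).iterOps +
        (rbcdProgram (m := m) (n := n) Q).final.length := by
    simp [LoopProgram.totalOps, rbcdProgram]
  generalize (m : ℝ) * n ^ 2 * d * k = W at *
  calc _ ≤ ((T : ℝ) + 1) * ((8000 + 4 * |K|) * W) + ((T : ℝ) + 1) * (4000 * (2 * W)) := by
        rw [h7]
        refine add_le_add (mul_le_mul_of_nonneg_left h5 (by positivity)) (h3.trans ?_)
        exact le_mul_of_one_le_left (by positivity) (by linarith [Nat.cast_nonneg (α := ℝ) T])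
    _ = ((T : ℝ) + 1) * ((16000 + 4 * |K|) * W) := by ring
    _ ≤ Problem.iterConst K * X * ((16000 + 4 * |K|) * W) :=
        mul_le_mul_of_nonneg_right hT (by positivity)
    _ = Problem.iterConst K * (16000 + 4 * |K|) * (X * W) := by ring
    _ ≤ opsConst K * (X * W) :=
        mul_le_mul_of_nonneg_right (iterConst_mul_le_opsConst K) (by positivity)

/-! ### Executions of the program -/

section Run

variable {D : Problem m n d} {ε L₁ L₂ : ℝ}
  {Retr : Matrix (Fin d) (Fin k) ℝ → Matrix (Fin d) (Fin k) ℝ → Matrix (Fin d) (Fin k) ℝ}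
  {Q : List (Instr (RetrReg d k))} {s₀ : Iterate m n d k}

theorem holdsInput_memAt (hv : D.Valid) (hm : 1 ≤ m) (hn : 0 < n) (hQ : ComputesRetr Q Retr)
    (hs : ∀ t, Stiefel (D.iter Retr ε L₁ L₂ s₀ t).U) (t : ℕ) :
    HoldsInput D ε L₁ L₂ (D.iter Retr ε L₁ L₂ s₀ t)
      ((rbcdProgram Q).memAt (inputMem D ε L₁ L₂ s₀) t) := by
  induction t with
  | zero => constructor <;> intros <;> rfl
  | succ t ih => exact (run_body hv hm hn (hs t) hQ ih).1

theorem holdsOutput_final {s : Iterate m n d k} {M : Reg m n d k → ℝ} (hM : HoldsSaved D ε s M) :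
    HoldsOutput (runBlock (rbcdProgram Q).final M) (D.qBar (etaPar n ε) s) s.U
      (D.planOut ε s) := by
  obtain ⟨h1, h2⟩ := computes_outputCode (D := D) (ε := ε) (s := s) M
  change HoldsOutput (runBlock outputCode M) _ _ _
  refine h2 _ (fun _ _ => rfl) ⟨fun l i => ?_, fun a b => ?_, fun l i j => ?_, fun j => ?_⟩
  · rw [h1 _ (by simp [Reg.tag]), hM.p]
  · rw [h1 _ (by simp [Reg.tag]), hM.U]
  · rw [h1 _ (by simp [Reg.tag]), hM.zeta]
  · rw [h1 _ (by simp [Reg.tag]), hM.qBar]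

end Run

end RPRWB

/-! ### The main theorem -/

theorem mainTheorem4 :
    -- retractions that cost `O(dk² + k³)` operations exist
    (∃ K : ℝ, ∀ d k : ℕ, 1 ≤ k → k ≤ d →
      ∃ (Retr : Matrix (Fin d) (Fin k) ℝ → Matrix (Fin d) (Fin k) ℝ → Matrix (Fin d) (Fin k) ℝ)
        (L₁ L₂ : ℝ) (Q : List (RPRWB.Instr (RPRWB.RetrReg d k))),
        RPRWB.IsRetraction Retr L₁ L₂ ∧ RPRWB.ComputesRetr Q Retr ∧
          (Q.length : ℝ) ≤ K * ((d : ℝ) * k ^ 2 + k ^ 3)) ∧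
    -- and RBCD with any such retraction has the claimed complexity
    ∀ K : ℝ, ∃ C : ℝ, ∀ m n d k : ℕ, 1 ≤ m → 2 ≤ n → 1 ≤ k → k ≤ d →
      ∀ (Retr : Matrix (Fin d) (Fin k) ℝ → Matrix (Fin d) (Fin k) ℝ → Matrix (Fin d) (Fin k) ℝ)
        (Q : List (RPRWB.Instr (RPRWB.RetrReg d k))),
        RPRWB.ComputesRetr Q Retr → (Q.length : ℝ) ≤ K * ((d : ℝ) * k ^ 2 + k ^ 3) →
      ∃ P : RPRWB.LoopProgram (RPRWB.Reg m n d k),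
        -- operations per iteration
        (k ≤ n → (P.iterOps : ℝ) ≤ C * ((m : ℝ) * n ^ 2 * d)) ∧
        ((P.iterOps : ℝ) ≤ C * ((m : ℝ) * n ^ 2 * d * k + (d : ℝ) * k ^ 2)) ∧
        -- `P` is an implementation of RBCD, with the claimed total number of operations
        ∀ (D : RPRWB.Problem m n d) (ε L₁ L₂ : ℝ) (s₀ : RPRWB.Iterate m n d k),
          D.Valid → 0 < ε → RPRWB.IsRetraction Retr L₁ L₂ → RPRWB.Stiefel s₀.U →
          (∀ j, ∑ l, D.w l * s₀.v l j = 0) →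
          (∀ l j j', s₀.v l j - s₀.v l j' ≤ 2 * D.cbar / RPRWB.etaPar n ε) →
          ε ≤ K → 1 ≤ K * D.cbar → 1 ≤ K * L₁ → L₂ * ε ≤ K * (L₁ ^ 2 * D.cbar) →
          ∃ T : ℕ,
            (∀ t, t < T → ¬ D.Stop ε (D.iter Retr ε L₁ L₂ s₀ t)) ∧
            D.Stop ε (D.iter Retr ε L₁ L₂ s₀ T) ∧
            D.EpsStationary ε (D.planOut ε (D.iter Retr ε L₁ L₂ s₀ T))
              (D.iter Retr ε L₁ L₂ s₀ T).U ∧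
            ((T : ℝ) + 1 ≤
              C * (Real.log n * L₁ ^ 2 * D.cbar ^ 5 / (D.wmin ^ 3 * ε ^ 3))) ∧
            P.LoopEndsAt .flag (RPRWB.inputMem D ε L₁ L₂ s₀) (T + 1) ∧
            (∀ t, t ≤ T + 1 →
              RPRWB.HoldsIterate (P.memAt (RPRWB.inputMem D ε L₁ L₂ s₀) t)
                (D.iter Retr ε L₁ L₂ s₀ t)) ∧
            RPRWB.HoldsOutput
              (RPRWB.runBlock P.final (P.memAt (RPRWB.inputMem D ε L₁ L₂ s₀) (T + 1)))
              (D.qBar (RPRWB.etaPar n ε) (D.iter Retr ε L₁ L₂ s₀ T))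
              (D.iter Retr ε L₁ L₂ s₀ T).U
              (D.planOut ε (D.iter Retr ε L₁ L₂ s₀ T)) ∧
            (k ≤ m * n ^ 2 → (P.totalOps (T + 1) : ℝ) ≤
              C * ((m : ℝ) * n ^ 2 * Real.log n * d * L₁ ^ 2 * D.cbar ^ 5 * k /
                (D.wmin ^ 3 * ε ^ 3))) := by
  refine ⟨⟨30, fun d k hk hkd => RPRWB.exists_retraction d k hk hkd⟩, fun K =>
    ⟨RPRWB.opsConst K, fun m n d k hm hn hk hkd Retr Q hQ hQK => ⟨RPRWB.rbcdProgram Q, ?_, ?_, ?_⟩⟩⟩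
  · intro hkn
    refine (RPRWB.iterOps_le_of_monomials hm (by omega) hk hkd hQK
      (RPRWB.setup_monomials_le_of_le hm hkn hkd)).trans ?_
    push_cast
    exact mul_le_mul_of_nonneg_right (RPRWB.le_opsConst K) (by positivity)
  · refine (RPRWB.iterOps_le_of_monomials hm (by omega) hk hkd hQK
      (RPRWB.setup_monomials_le hk hkd (by omega))).trans ?_
    push_cast
    exact mul_le_mul_of_nonneg_right (RPRWB.le_opsConst K) (by positivity)
  · intro D ε L₁ L₂ s₀ hv hε hR hU hsum hrange hεK hcK hLK hL
    have hn0 : 0 < n := by omega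
    -- Only here is K known to be positive; the operation counts above hold for every real K, which
    -- is why `opsConst` contains |K|.
    have hK : 0 < K := hε.trans_le hεK
    have hc : 0 < D.cbar := pos_of_mul_pos_right (one_pos.trans_le hcK) hK.le
    have hs : D.Inv (RPRWB.etaPar n ε) s₀ := ⟨hU, hsum, hrange⟩
    have hI := fun t => RPRWB.Problem.Inv.iter hv hn0 hε hR hs t
    obtain ⟨T, hT, hStop, hTle⟩ :=
      RPRWB.Problem.exists_stop hv hm hn hε hR hc hK hεK hcK hLK hL hs
    have hX : 0 ≤ Real.log n * L₁ ^ 2 * D.cbar ^ 5 / (D.wmin ^ 3 * ε ^ 3) := by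
      have := (hv.wmin_pos hm).le
      have := Real.log_natCast_nonneg n
      positivity
    have hmem := RPRWB.holdsInput_memAt (L₁ := L₁) (L₂ := L₂) (s₀ := s₀) (ε := ε) hv hm hn0 hQ
      fun t => (hI t).stiefel
    have hrun := fun t => RPRWB.run_body hv hm hn0 (hI t).stiefel hQ (hmem t)
    refine ⟨T, hT, hStop, RPRWB.Problem.epsStationary_of_stop hv hn0 hm hε hc _ (hI T) hStop,
      hTle.trans (mul_le_mul_of_nonneg_right (RPRWB.iterConst_le_opsConst K) hX),
      ⟨by omega, ?_, ?_⟩, fun t _ => ⟨(hmem t).u, (hmem t).v, (hmem t).U⟩,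
      RPRWB.holdsOutput_final (hrun T).2.1, fun hkm => ?_⟩
    · refine ne_of_eq_of_ne (hrun T).2.2 ?_
      rw [if_pos hStop]
      exact one_ne_zero
    · intro t ht htT
      -- The flag after t + 1 executions tests the iterate with index t, so stopping at T means T +
      -- 1 executions.
      obtain ⟨t, rfl⟩ := Nat.exists_eq_add_of_le' ht
      exact (hrun t).2.2.trans (if_neg (hT t (by omega)))
    · refine (RPRWB.totalOps_le hm hn0 hk hkd hkm hQK hX hTle).trans_eq ?_
      ring
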